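/- **Setting.** Asynchronous processes run in shared memory with atomic reads, writes and CAS. A *camera* $S$ supports $S.\mathrm{takeSnapshot}()$, which returns an integer handle. A *versioned CAS object* $O$ is associated with one camera when it is created; it stores a value and supports $O.\mathrm{vRead}()$, $O.\mathrm{vCAS}(old,new)$ and $O.\mathrm{readSnapshot}(ts)$. Sequential specification: $\mathrm{vRead}$ returns the current value; $\mathrm{vCAS}(old,new)$ sets the value to $new$ and returns true if the current value is $old$, and otherwise changes nothing and returns false; if a $\mathrm{takeSnapshot}$ $T$ on the camera of $O$ returns $ts$, then every $O.\mathrm{readSnapshot}(ts)$ returns the value that $O$ had when $T$ occurred. Constructors create new cameras and new versioned CAS objects with a given initial value and an existing camera. Preconditions: an object is used only after its constructor has returned, and $O.\mathrm{readSnapshot}(ts)$ is invoked only after some $\mathrm{takeSnapshot}$ on the camera of $O$, itself invoked after the constructor of $O$ returned, has returned $ts$. **Algorithm.** A camera is an integer `timestamp`. A version node has fields `val`, `nextv`, `ts`. An object $O$ has a pointer `VHead` to a version node and a pointer `S` to its camera. Each call `new Node(v,n)` creates a node with `val = v`, `nextv = n`, `ts = TBD`. - `Camera()`: `timestamp = 0`.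 - `takeSnapshot()`: `ts = timestamp; CAS(&timestamp, ts, ts+1); return ts`. - `VersionedCAS(v, s)`: `S = s; VHead = new Node(v, NULL); initTS(VHead)`. - `initTS(n)`: `if (n->ts == TBD) { curTS = S->timestamp; CAS(&n->ts, TBD, curTS) }`. - `readSnapshot(ts)`: `node = VHead; initTS(node); while (node->ts > ts) node = node->nextv; return node->val`. - `vRead()`: `head = VHead; initTS(head); return head->val`. - `vCAS(oldV, newV)`: `head = VHead; initTS(head); if (head->val != oldV) return false; if (newV == oldV) return true; newN = new Node(newV, head); if (CAS(&VHead, head, newN)) { initTS(newN); return true } else { delete newN; initTS(VHead); return false }`. **Theorem.** There is an absolute constant $C$ such that the following holds for every finite execution of this algorithm, with any set of processes, any set of values, and any number of cameras and versioned CAS objects created at any time, in which the preconditions are respected. 1. The history of the execution is linearizable with respect to the sequential specification. 2. Every process with a pending operation can always take its next step (in particular no null pointer is dereferenced). 3. Every $\mathrm{vRead}$, $\mathrm{vCAS}$ and $\mathrm{takeSnapshot}$ operation performs at most $C$ instructions. 4. The number of instructions performed by $O.\mathrm{readSnapshot}(ts)$ is proportional to one plus the number of successful $O.\mathrm{vCAS}$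 operations that have been assigned timestamps larger than $ts$. Precisely, let $k$ be the number of $\mathrm{vCAS}$ operations on $O$ that, at the time the $\mathrm{readSnapshot}$ reads `VHead` (its first instruction), have added a node to the version list of $O$ whose `ts` field holds a timestamp larger than $ts$. Then the $\mathrm{readSnapshot}$ performs at most $C(k+1)$ instructions, and at least $k+1$ instructions if it completes. -/

import Mathlib

/-! ### Histories and linearizability -/

/-- What happens at one point of time in an execution: a process invokes an operation, executes one
instruction of its current operation, or returns a response from it. -/
inductive Label (P Op R : Type*) where
  | inv (p : P) (op : Op)
  | instr (p : P)
  | res (p : P) (r : R)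

/-- A finite history: the events at times `0, …, len - 1` (labels at later times are ignored).
An operation instance is identified by the time of its invocation. -/
structure History (P Op R : Type*) where
  len : ℕ
  lab : ℕ → Label P Op R

namespace History

/-- At time `i` some process invokes `op`. -/
def Invoked {P Op R : Type*} (H : History P Op R) (i : ℕ) (op : Op) : Prop :=
  i < H.len ∧ ∃ p, H.lab i = .inv p op

/-- Process `p` invoked an operation at time `i`, which has not responded before time `k`. -/
def Ongoing {P Op R : Type*} (H : History P Op R) (p : P) (i k : ℕ) : Prop :=
  (∃ op, H.lab i = .inv p op) ∧ i < k ∧ k < H.len ∧ ∀ m r, i < m → m < k → H.lab m ≠ .res p r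

/-- The operation invoked at time `i` returns the response `r` at time `b`. -/
def RespondsAt {P Op R : Type*} (H : History P Op R) (i b : ℕ) (r : R) : Prop :=
  ∃ p, H.Ongoing p i b ∧ H.lab b = .res p r

/-- The event at time `k` is an instruction of the operation invoked at time `i`. -/
def Performs {P Op R : Type*} (H : History P Op R) (i k : ℕ) : Prop :=
  ∃ p, H.Ongoing p i k ∧ H.lab k = .instr p

/-- The number of instructions that the operation invoked at time `i` performs. -/
noncomputable def instrCount {P Op R : Type*} (H : History P Op R) (i : ℕ) : ℕ :=
  {k | H.Performs i k}.ncard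

/-- Before time `k`, an instance of `op` has returned the response `r`. -/
def ReturnedBefore {P Op R : Type*} (H : History P Op R) (op : Op) (r : R) (k : ℕ) : Prop :=
  ∃ i b, H.Invoked i op ∧ H.RespondsAt i b r ∧ b < k

/-- The real-time order: the operation invoked at `i` responds before the one at `j` is invoked. -/
def Precedes {P Op R : Type*} (H : History P Op R) (i j : ℕ) : Prop :=
  ∃ b r, H.RespondsAt i b r ∧ b < j

/-- `L` lists operation instances (invocation time, operation, response) in an order that witnesses
the linearizability of `H`: all completed operations occur with their actual responses, possibly
some pending operations occur with some responses, the order extends the real-time order, and the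
resulting sequential history is allowed by the sequential specification `spec`. -/
structure IsLinearization {P Op R : Type*} (H : History P Op R)
    (spec : List (Op × R) → Prop) (L : List (ℕ × Op × R)) : Prop where
  invoked : ∀ e ∈ L, H.Invoked e.1 e.2.1
  nodup : (L.map Prod.fst).Nodup
  complete : ∀ i b op r, H.Invoked i op → H.RespondsAt i b r → (i, op, r) ∈ L
  order : L.Pairwise fun x y => ¬ H.Precedes y.1 x.1
  legal : spec (L.map Prod.snd)

/-- Linearizability with respect to a sequential specification. -/
def Linearizable {P Op R : Type*} (H : History P Op R) (spec : List (Op × R) → Prop) : Prop :=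
  ∃ L, H.IsLinearization spec L

end History

/-! ### Operations and their sequential specification

Pointers to cameras, to versioned CAS objects and to version nodes are natural numbers, with a
separate address space for each of the three kinds. -/

/-- The operations, including the two constructors. -/
inductive Op (V : Type*) where
  /-- `new Camera()` -/
  | newCamera
  /-- `new VersionedCAS(v, s)`, associated with the camera `s` -/
  | newVCAS (v : V) (s : ℕ)
  /-- `s.takeSnapshot()` on the camera `s` -/
  | takeSnapshot (s : ℕ)
  /-- `o.vRead()` -/
  | vRead (o : ℕ)
  /-- `o.vCAS(oldV, newV)` -/
  | vCAS (o : ℕ) (oldV newV : V)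
  /-- `o.readSnapshot(ts)` -/
  | readSnapshot (o ts : ℕ)

/-- The responses: a camera, a versioned CAS object, a snapshot handle, a value or a Boolean. -/
inductive Resp (V : Type*) where
  | cam (s : ℕ)
  | obj (o : ℕ)
  | handle (ts : ℕ)
  | val (v : V)
  | bool (b : Bool)

/-- The abstract state: the cameras that exist, and for each existing versioned CAS object its
associated camera and its current value. -/
structure SeqState (V : Type*) where
  cams : Set ℕ
  objs : ℕ → Option (ℕ × V)

namespace SeqState

/-- No object exists. -/
def empty {V : Type*} : SeqState V := ⟨∅, fun _ => none⟩

open Classical in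
/-- The effect of an operation with a given response on the abstract state. -/
noncomputable def apply {V : Type*} (st : SeqState V) : Op V × Resp V → SeqState V
  | (.newCamera, .cam s) => { st with cams := insert s st.cams }
  | (.newVCAS v s, .obj o) => { st with objs := Function.update st.objs o (some (s, v)) }
  | (.vCAS o oldV newV, _) =>
      match st.objs o with
      | some (s, x) =>
          if x = oldV then { st with objs := Function.update st.objs o (some (s, newV)) } else st
      | none => st
  | _ => st

/-- The abstract state after the first `k` operations of the sequential history `h`. -/
noncomputable def after {V : Type*} (h : List (Op V × Resp V)) (k : ℕ) : SeqState V :=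
  (h.take k).foldl apply empty

end SeqState

/-- The operation with index `k` of the sequential history `h`, when it is `op` with response `r`,
satisfies its precondition and returns what it should. -/
def LegalAt {V : Type*} (h : List (Op V × Resp V)) (k : ℕ) : Op V × Resp V → Prop
  | (.newCamera, .cam s) => s ∉ (SeqState.after h k).cams
  | (.newVCAS _ s, .obj o) =>
      s ∈ (SeqState.after h k).cams ∧ (SeqState.after h k).objs o = none
  | (.takeSnapshot s, .handle _) => s ∈ (SeqState.after h k).cams
  | (.vRead o, .val v) => ∃ s, (SeqState.after h k).objs o = some (s, v)
  | (.vCAS o oldV _, .bool b) =>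
      ∃ s x, (SeqState.after h k).objs o = some (s, x) ∧ (b = true ↔ x = oldV)
  | (.readSnapshot o ts, .val v) =>
      ∃ s x, (SeqState.after h k).objs o = some (s, x) ∧
        -- an earlier `takeSnapshot` on the associated camera, made when `o` existed, returned `ts`
        (∃ m < k, h[m]? = some (.takeSnapshot s, .handle ts) ∧
          (SeqState.after h m).objs o ≠ none) ∧
        -- `v` is the value that `o` had at every `takeSnapshot` that returned `ts`
        (∀ m, h[m]? = some (.takeSnapshot s, .handle ts) →
          ∀ s' y, (SeqState.after h m).objs o = some (s', y) → v = y)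
  | _ => False

/-- The sequential specification of camera objects and versioned CAS objects. -/
def SeqSpec {V : Type*} (h : List (Op V × Resp V)) : Prop :=
  ∀ k e, h[k]? = some e → LegalAt h k e

/-! ### The algorithm -/

/-- A `VNode`; the timestamp `none` is `TBD`, the pointer `none` is `NULL`. -/
structure VNode (V : Type*) where
  val : V
  nextv : Option ℕ
  ts : Option ℕ

/-- The fields of a `VersionedCAS` object. -/
structure VObj where
  VHead : Option ℕ
  S : ℕ

/-- The shared memory. A camera is its field `timestamp`; `none` marks unallocated addresses. -/
structure Mem (V : Type*) where
  cams : ℕ → Option ℕ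
  objs : ℕ → Option VObj
  nodes : ℕ → Option (VNode V)

/-- The local state of a process: the next instruction of its current operation, together with the
values of the local variables that are still needed. -/
inductive Loc (V : Type*) where
  /-- no current operation -/
  | idle
  /-- about to return the response `r` -/
  | ret (r : Resp V)
  -- constructor `Camera()`
  | camNew
  -- constructor `VersionedCAS(v, s)` of the object `o`
  | objNew (v : V) (s : ℕ)
  | objNode (o : ℕ) (v : V)
  | objSetHead (o n : ℕ)
  | objInit (o : ℕ)
  -- subroutine `o.initTS(n)`, followed by `next`
  | tsCheck (o n : ℕ) (next : Loc V)
  | tsRead (o n : ℕ) (next : Loc V)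
  | tsCAS (o n curTS : ℕ) (next : Loc V)
  -- `s.takeSnapshot()`
  | snapRead (s : ℕ)
  | snapCAS (s ts : ℕ)
  -- `o.readSnapshot(ts)`
  | rsHead (o ts : ℕ)
  | rsWhile (ts node : ℕ)
  | rsNext (ts node : ℕ)
  | rsVal (node : ℕ)
  -- `o.vRead()`
  | readHead (o : ℕ)
  | readVal (head : ℕ)
  -- `o.vCAS(oldV, newV)`
  | casHead (o : ℕ) (oldV newV : V)
  | casCmpVal (o : ℕ) (oldV newV : V) (head : ℕ)
  | casCmpNew (o : ℕ) (oldV newV : V) (head : ℕ)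
  | casNode (o : ℕ) (newV : V) (head : ℕ)
  | casAppend (o head newN : ℕ)
  | casDelete (o newN : ℕ)
  | casInit (o : ℕ)

/-- The first instruction of an operation. -/
def Op.start {V : Type*} : Op V → Loc V
  | .newCamera => .camNew
  | .newVCAS v s => .objNew v s
  | .takeSnapshot s => .snapRead s
  | .vRead o => .readHead o
  | .vCAS o oldV newV => .casHead o oldV newV
  | .readSnapshot o ts => .rsHead o ts

/-- `Instr M l M' l'`: one instruction takes a process from local state `l` to `l'` and the shared
memory from `M` to `M'`. Allocation picks an arbitrary unallocated address, so memory that has been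
deleted may be reused. A process that would have to follow a null or dangling pointer, or to
compare `TBD` with a timestamp, has no instruction. -/
inductive Instr {V : Type*} : Mem V → Loc V → Mem V → Loc V → Prop where
  /-- `timestamp = 0` in a new camera -/
  | camNew {M : Mem V} {s : ℕ} (h : M.cams s = none) :
      Instr M .camNew { M with cams := Function.update M.cams s (some 0) } (.ret (.cam s))
  /-- `S = s` in a new versioned CAS object -/
  | objNew {M : Mem V} {v : V} {s o : ℕ} (h : M.objs o = none) :
      Instr M (.objNew v s)
        { M with objs := Function.update M.objs o (some ⟨none, s⟩) } (.objNode o v)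
  /-- `new VNode(v, NULL)` -/
  | objNode {M : Mem V} {o n : ℕ} {v : V} (h : M.nodes n = none) :
      Instr M (.objNode o v)
        { M with nodes := Function.update M.nodes n (some ⟨v, none, none⟩) } (.objSetHead o n)
  /-- `VHead = …` -/
  | objSetHead {M : Mem V} {o n : ℕ} {O : VObj} (h : M.objs o = some O) :
      Instr M (.objSetHead o n)
        { M with objs := Function.update M.objs o (some { O with VHead := some n }) } (.objInit o)
  /-- `initTS(VHead)`, then return the new object -/
  | objInit {M : Mem V} {o n : ℕ} {O : VObj} (h : M.objs o = some O) (hn : O.VHead = some n) :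
      Instr M (.objInit o) M (.tsCheck o n (.ret (.obj o)))
  /-- `if(n->ts == TBD)`, condition true -/
  | tsCheckTBD {M : Mem V} {o n : ℕ} {next : Loc V} {N : VNode V} (h : M.nodes n = some N)
      (hts : N.ts = none) :
      Instr M (.tsCheck o n next) M (.tsRead o n next)
  /-- `if(n->ts == TBD)`, condition false -/
  | tsCheckValid {M : Mem V} {o n : ℕ} {next : Loc V} {N : VNode V} (h : M.nodes n = some N)
      (hts : N.ts ≠ none) :
      Instr M (.tsCheck o n next) M next
  /-- `curTS = S->timestamp` -/
  | tsRead {M : Mem V} {o n t : ℕ} {next : Loc V} {O : VObj} (h : M.objs o = some O)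
      (ht : M.cams O.S = some t) :
      Instr M (.tsRead o n next) M (.tsCAS o n t next)
  /-- `CAS(&n->ts, TBD, curTS)`, success -/
  | tsCASSucc {M : Mem V} {o n t : ℕ} {next : Loc V} {N : VNode V} (h : M.nodes n = some N)
      (hts : N.ts = none) :
      Instr M (.tsCAS o n t next)
        { M with nodes := Function.update M.nodes n (some { N with ts := some t }) } next
  /-- `CAS(&n->ts, TBD, curTS)`, failure -/
  | tsCASFail {M : Mem V} {o n t : ℕ} {next : Loc V} {N : VNode V} (h : M.nodes n = some N)
      (hts : N.ts ≠ none) :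
      Instr M (.tsCAS o n t next) M next
  /-- `ts = timestamp` -/
  | snapRead {M : Mem V} {s t : ℕ} (h : M.cams s = some t) :
      Instr M (.snapRead s) M (.snapCAS s t)
  /-- `CAS(&timestamp, ts, ts+1)`, success; then `return ts` -/
  | snapCASSucc {M : Mem V} {s t : ℕ} (h : M.cams s = some t) :
      Instr M (.snapCAS s t)
        { M with cams := Function.update M.cams s (some (t + 1)) } (.ret (.handle t))
  /-- `CAS(&timestamp, ts, ts+1)`, failure; then `return ts` -/
  | snapCASFail {M : Mem V} {s t t' : ℕ} (h : M.cams s = some t') (hne : t' ≠ t) :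
      Instr M (.snapCAS s t) M (.ret (.handle t))
  /-- `node = VHead`, then `initTS(node)` -/
  | rsHead {M : Mem V} {o ts n : ℕ} {O : VObj} (h : M.objs o = some O) (hn : O.VHead = some n) :
      Instr M (.rsHead o ts) M (.tsCheck o n (.rsWhile ts n))
  /-- `while(node->ts > ts)`, condition true -/
  | rsWhileTrue {M : Mem V} {ts n t : ℕ} {N : VNode V} (h : M.nodes n = some N)
      (ht : N.ts = some t) (hgt : ts < t) :
      Instr M (.rsWhile ts n) M (.rsNext ts n)
  /-- `while(node->ts > ts)`, condition false -/
  | rsWhileFalse {M : Mem V} {ts n t : ℕ} {N : VNode V} (h : M.nodes n = some N)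
      (ht : N.ts = some t) (hle : t ≤ ts) :
      Instr M (.rsWhile ts n) M (.rsVal n)
  /-- `node = node->nextv` -/
  | rsNext {M : Mem V} {ts n n' : ℕ} {N : VNode V} (h : M.nodes n = some N)
      (hn : N.nextv = some n') :
      Instr M (.rsNext ts n) M (.rsWhile ts n')
  /-- `return node->val` -/
  | rsVal {M : Mem V} {n : ℕ} {N : VNode V} (h : M.nodes n = some N) :
      Instr M (.rsVal n) M (.ret (.val N.val))
  /-- `head = VHead`, then `initTS(head)` -/
  | readHead {M : Mem V} {o n : ℕ} {O : VObj} (h : M.objs o = some O) (hn : O.VHead = some n) :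
      Instr M (.readHead o) M (.tsCheck o n (.readVal n))
  /-- `return head->val` -/
  | readVal {M : Mem V} {n : ℕ} {N : VNode V} (h : M.nodes n = some N) :
      Instr M (.readVal n) M (.ret (.val N.val))
  /-- `head = VHead`, then `initTS(head)` -/
  | casHead {M : Mem V} {o n : ℕ} {oldV newV : V} {O : VObj} (h : M.objs o = some O)
      (hn : O.VHead = some n) :
      Instr M (.casHead o oldV newV) M (.tsCheck o n (.casCmpVal o oldV newV n))
  /-- `if(head->val != oldV) return false`, condition true -/
  | casCmpValNe {M : Mem V} {o n : ℕ} {oldV newV : V} {N : VNode V} (h : M.nodes n = some N)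
      (hv : N.val ≠ oldV) :
      Instr M (.casCmpVal o oldV newV n) M (.ret (.bool false))
  /-- `if(head->val != oldV) return false`, condition false -/
  | casCmpValEq {M : Mem V} {o n : ℕ} {oldV newV : V} {N : VNode V} (h : M.nodes n = some N)
      (hv : N.val = oldV) :
      Instr M (.casCmpVal o oldV newV n) M (.casCmpNew o oldV newV n)
  /-- `if(newV == oldV) return true`, condition true -/
  | casCmpNewEq {M : Mem V} {o n : ℕ} {oldV newV : V} (hv : newV = oldV) :
      Instr M (.casCmpNew o oldV newV n) M (.ret (.bool true))
  /-- `if(newV == oldV) return true`, condition false -/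
  | casCmpNewNe {M : Mem V} {o n : ℕ} {oldV newV : V} (hv : newV ≠ oldV) :
      Instr M (.casCmpNew o oldV newV n) M (.casNode o newV n)
  /-- `newN = new VNode(newV, head)` -/
  | casNode {M : Mem V} {o head n : ℕ} {newV : V} (h : M.nodes n = none) :
      Instr M (.casNode o newV head)
        { M with nodes := Function.update M.nodes n (some ⟨newV, some head, none⟩) }
        (.casAppend o head n)
  /-- `CAS(&VHead, head, newN)`, success; then `initTS(newN)` and `return true` -/
  | casAppendSucc {M : Mem V} {o head n : ℕ} {O : VObj} (h : M.objs o = some O)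
      (hh : O.VHead = some head) :
      Instr M (.casAppend o head n)
        { M with objs := Function.update M.objs o (some { O with VHead := some n }) }
        (.tsCheck o n (.ret (.bool true)))
  /-- `CAS(&VHead, head, newN)`, failure -/
  | casAppendFail {M : Mem V} {o head n : ℕ} {O : VObj} (h : M.objs o = some O)
      (hh : O.VHead ≠ some head) :
      Instr M (.casAppend o head n) M (.casDelete o n)
  /-- `delete newN` -/
  | casDelete {M : Mem V} {o n : ℕ} {N : VNode V} (h : M.nodes n = some N) :
      Instr M (.casDelete o n) { M with nodes := Function.update M.nodes n none } (.casInit o)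
  /-- `initTS(VHead)`, then `return false` -/
  | casInit {M : Mem V} {o n : ℕ} {O : VObj} (h : M.objs o = some O) (hn : O.VHead = some n) :
      Instr M (.casInit o) M (.tsCheck o n (.ret (.bool false)))

/-- A configuration: the shared memory and the local states of all processes. -/
structure Config (P V : Type*) where
  mem : Mem V
  loc : P → Loc V

/-- No memory is allocated and all processes are idle. -/
def Config.initial {P V : Type*} : Config P V :=
  ⟨⟨fun _ => none, fun _ => none, fun _ => none⟩, fun _ => .idle⟩

open Classical in
/-- The steps of the system: an idle process invokes an operation, a process executes one
instruction, or a process whose operation is finished returns its response. -/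
inductive Step {P V : Type*} : Config P V → Label P (Op V) (Resp V) → Config P V → Prop where
  | inv {c : Config P V} {p : P} {op : Op V} (h : c.loc p = .idle) :
      Step c (.inv p op) ⟨c.mem, Function.update c.loc p op.start⟩
  | instr {c : Config P V} {p : P} {M' : Mem V} {l' : Loc V}
      (h : Instr c.mem (c.loc p) M' l') :
      Step c (.instr p) ⟨M', Function.update c.loc p l'⟩
  | res {c : Config P V} {p : P} {r : Resp V} (h : c.loc p = .ret r) :
      Step c (.res p r) ⟨c.mem, Function.update c.loc p .idle⟩

/-- A finite execution of the algorithm: an arbitrary interleaving of the steps of the processes,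
where `cfg i` is the configuration just before the event at time `i`. -/
structure Execution (P V : Type*) extends History P (Op V) (Resp V) where
  cfg : ℕ → Config P V
  start : cfg 0 = Config.initial
  step : ∀ i < len, Step (cfg i) (lab i) (cfg (i + 1))

/-- The preconditions on the use of the objects. -/
structure History.RespectsPreconditions {P V : Type*} (H : History P (Op V) (Resp V)) : Prop where
  /-- A camera is used only after its constructor has returned. -/
  camera : ∀ i s, (H.Invoked i (.takeSnapshot s) ∨ ∃ v, H.Invoked i (.newVCAS v s)) →
    H.ReturnedBefore .newCamera (.cam s) i
  /-- A versioned CAS object is used only after its constructor has returned. -/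
  object : ∀ i o, (H.Invoked i (.vRead o) ∨ ∃ oldV newV, H.Invoked i (.vCAS o oldV newV)) →
    ∃ v s, H.ReturnedBefore (.newVCAS v s) (.obj o) i
  /-- `o.readSnapshot(ts)` is invoked only after a `takeSnapshot` on the camera of `o` has returned
  `ts` that was invoked after the constructor of `o` had returned. -/
  snapshot : ∀ i o ts, H.Invoked i (.readSnapshot o ts) →
    ∃ v s a b, H.Invoked a (.takeSnapshot s) ∧ H.RespondsAt a b (.handle ts) ∧ b < i ∧
      H.ReturnedBefore (.newVCAS v s) (.obj o) a

namespace Execution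

/-- Each process with a current operation can execute its next instruction or return. -/
def NeverStuck {P V : Type*} (E : Execution P V) : Prop :=
  ∀ i ≤ E.len, ∀ p, (E.cfg i).loc p ≠ .idle →
    ∃ c', Step (E.cfg i) (.instr p) c' ∨ ∃ r, Step (E.cfg i) (.res p r) c'

/-- The event at time `k` is a successful `CAS(&VHead, head, newN)` on the object `o` by the
operation invoked at time `i`, where `newN` is the node `n`. -/
def Appends {P V : Type*} (E : Execution P V) (i k o n : ℕ) : Prop :=
  ∃ p head O, E.Ongoing p i k ∧ E.lab k = .instr p ∧
    (E.cfg k).loc p = .casAppend o head n ∧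
    (E.cfg k).mem.objs o = some O ∧ O.VHead = some head

/-- The `vCAS` operations on `o` that, at time `m`, have added a node to the version list of `o` and
have been assigned a timestamp larger than `ts`, which is the one stored in that node. -/
def newerVCAS {P V : Type*} (E : Execution P V) (m o ts : ℕ) : Set ℕ :=
  {i | (∃ oldV newV, E.Invoked i (.vCAS o oldV newV)) ∧
    ∃ k n N t, k < m ∧ E.Appends i k o n ∧
      (E.cfg m).mem.nodes n = some N ∧ N.ts = some t ∧ ts < t}

/-- At time `m` the operation invoked at time `i` executes `node = VHead` in
`o.readSnapshot(ts)`. -/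
def ReadsHead {P V : Type*} (E : Execution P V) (i m o ts : ℕ) : Prop :=
  ∃ p, E.Ongoing p i m ∧ E.lab m = .instr p ∧ (E.cfg m).loc p = .rsHead o ts

end Execution

/-! A successful `vCAS` is linearized neither when its node enters `VHead` nor when the timestamp is
written into the node, but when the timestamp that ends up there was read from the camera. The same
holds for the constructor of an object. A `takeSnapshot` returning `ts` is linearized when the
camera goes from `ts` to `ts + 1`. This moment lies inside its interval even if its own CAS fails,
because then another process made the increment. With these choices a version has a timestamp at
most `ts` exactly if it was linearized before that increment, so the newest version with such a
timestamp carries the value that the object had at the snapshot.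

The order of versions is consistent because a `vCAS` runs `initTS` on the head before it tries to
append to it. Hence only the newest version can lack a timestamp, and every timestamp was read while
its version was the newest. The times of these reads therefore decrease strictly, and the timestamps
weakly, from newer to older versions. Since listed nodes are never deleted, an address identifies a
version, and the CAS on `VHead` has no ABA problem.

A `vRead`, or a `vCAS` that adds no version, is linearized at a moment of its interval when the
version that determines its answer is the newest and its timestamp has been read. If the CAS on
`VHead` fails, this version is the one that was put directly on top of the expected head. Its value
differs from `oldV`, since a `vCAS` with equal values never appends. A `readSnapshot` is linearized
when it reads `VHead`. Its search ends because the version added by the constructor got its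
timestamp before the snapshot was invoked.

History variables record the version lists and the times at which timestamps were read. The
invariant `Inv` relates them to the memory and to the local state of each process, and `inv_of_le`
establishes it by strong induction on time. Progress (`neverStuck`) and the bounds for
`readSnapshot` are read off from the invariant; the constant bounds come from a potential function.
Linearizability follows from the general criterion `History.linearizable_of_points`, with two points
per time: one for operations that change the abstract state, and a later one for those that do not.
-/

/-! ### History variables -/

/-- A version of an object: its node, the value stored there, and the operation (given by its
invocation time) that added the node to the version list. -/
structure Version (V : Type*) where
  node : ℕ
  val : V
  op : ℕ

/-- Auxiliary history variables. -/
structure Ghost (P V : Type*) where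
  /-- the current operation of each process and its invocation time -/
  cur : P → Option (ℕ × Op V)
  /-- the time of the last event of each process -/
  last : P → ℕ
  /-- the number of instructions performed by the current operation of each process -/
  cnt : P → ℕ
  /-- the version list of each object, newest version first -/
  vers : ℕ → List (Version V)
  /-- for each node with a timestamp, the time at which that timestamp was read from the camera,
  and the timestamp -/
  dec : ℕ → Option (ℕ × ℕ)

namespace Ghost

/-- The version added to an object by the next instruction of `p`, if any. -/
def published {P V : Type*} (c : Config P V) (g : Ghost P V) (p : P) : Option (ℕ × Version V) :=
  match c.loc p, g.cur p with
  | .objSetHead o n, some (i, _) => (c.mem.nodes n).map fun N => (o, ⟨n, N.val, i⟩)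
  | .casAppend o head n, some (i, _) =>
      if (c.mem.objs o).bind VObj.VHead = some head then
        (c.mem.nodes n).map fun N => (o, ⟨n, N.val, i⟩)
      else none
  | _, _ => none

/-- The version lists after the next instruction of `p`. -/
def nextVers {P V : Type*} (c : Config P V) (g : Ghost P V) (p : P) : ℕ → List (Version V) :=
  match g.published c p with
  | some (o, v) => Function.update g.vers o (v :: g.vers o)
  | none => g.vers

/-- The assigned timestamps after the next instruction of `p`. -/
def nextDec {P V : Type*} (c : Config P V) (g : Ghost P V) (p : P) : ℕ → Option (ℕ × ℕ) :=
  match c.loc p with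
  | .tsCAS _ n t _ =>
      -- A process about to execute `tsCAS` has just executed `tsRead`, so its last event is the
      -- moment at which `t` was read.
      if g.dec n = none then Function.update g.dec n (some (g.last p, t)) else g.dec
  | _ => g.dec

open Classical in
/-- The history variables after an event at time `k`. -/
noncomputable def next {P V : Type*} (c : Config P V) (g : Ghost P V) (k : ℕ) :
    Label P (Op V) (Resp V) → Ghost P V
  | .inv p op => { g with
      cur := Function.update g.cur p (some (k, op))
      last := Function.update g.last p k
      cnt := Function.update g.cnt p 0 }
  | .res p _ => { g with
      cur := Function.update g.cur p none
      last := Function.update g.last p k }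
  | .instr p =>
    { cur := g.cur
      last := Function.update g.last p k
      cnt := Function.update g.cnt p (g.cnt p + 1)
      vers := g.nextVers c p
      dec := g.nextDec c p }

end Ghost

/-- The process of an event. -/
def Label.proc {P Op R : Type*} : Label P Op R → P
  | .inv p _ => p
  | .instr p => p
  | .res p _ => p

namespace Execution

variable {P V : Type*} (E : Execution P V)

/-- The history variables at time `k`. -/
noncomputable def ghost : ℕ → Ghost P V
  | 0 => ⟨fun _ => none, fun _ => 0, fun _ => 0, fun _ => [], fun _ => none⟩
  | k + 1 => (ghost k).next (E.cfg k) k (E.lab k)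

/-- The version list of `o` at time `k`. -/
noncomputable abbrev vers (k o : ℕ) : List (Version V) := (E.ghost k).vers o

/-- The timestamp of the node `n` at time `k`, with the time at which it was read. -/
noncomputable abbrev dec (k n : ℕ) : Option (ℕ × ℕ) := (E.ghost k).dec n

open Classical in
theorem step_cases {k : ℕ} (hk : k < E.len) :
    (∃ p op, E.lab k = .inv p op ∧ (E.cfg k).loc p = .idle ∧
      E.cfg (k + 1) = ⟨(E.cfg k).mem, Function.update (E.cfg k).loc p op.start⟩) ∨
    (∃ p M' l', E.lab k = .instr p ∧ Instr (E.cfg k).mem ((E.cfg k).loc p) M' l' ∧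
      E.cfg (k + 1) = ⟨M', Function.update (E.cfg k).loc p l'⟩) ∨
    (∃ p r, E.lab k = .res p r ∧ (E.cfg k).loc p = .ret r ∧
      E.cfg (k + 1) = ⟨(E.cfg k).mem, Function.update (E.cfg k).loc p .idle⟩) := by
  have h := E.step k hk
  generalize E.lab k = l at *
  generalize E.cfg (k + 1) = c' at *
  cases h with
  | inv h => exact .inl ⟨_, _, rfl, h, rfl⟩
  | instr h => exact .inr (.inl ⟨_, _, _, rfl, h, rfl⟩)
  | res h => exact .inr (.inr ⟨_, _, rfl, h, rfl⟩)

theorem mem_step {k : ℕ} (hk : k < E.len) :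
    (E.cfg (k + 1)).mem = (E.cfg k).mem ∨
      ∃ p l', E.lab k = .instr p ∧ Instr (E.cfg k).mem ((E.cfg k).loc p) (E.cfg (k + 1)).mem l' := by
  rcases E.step_cases hk with ⟨p, op, h1, h2, h3⟩ | ⟨p, M', l', h1, h2, h3⟩ | ⟨p, r, h1, h2, h3⟩
  · left; rw [h3]
  · right; exact ⟨p, l', h1, by rw [h3]; exact h2⟩
  · left; rw [h3]

theorem loc_step {k : ℕ} (hk : k < E.len) {p : P} (hp : (E.lab k).proc ≠ p) :
    (E.cfg (k + 1)).loc p = (E.cfg k).loc p := by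
  classical
  rcases E.step_cases hk with ⟨q, op, h1, h2, h3⟩ | ⟨q, M', l', h1, h2, h3⟩ | ⟨q, r, h1, h2, h3⟩ <;>
  · rw [h1] at hp
    rw [h3]
    exact Function.update_of_ne (Ne.symm hp) _ _

theorem ghost_step_other {k : ℕ} {p : P} (hp : (E.lab k).proc ≠ p) :
    (E.ghost (k + 1)).cur p = (E.ghost k).cur p ∧ (E.ghost (k + 1)).last p = (E.ghost k).last p ∧
      (E.ghost (k + 1)).cnt p = (E.ghost k).cnt p := by
  classical
  simp only [ghost]
  cases h : E.lab k <;> rw [h] at hp <;> simp only [Label.proc] at hp <;>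
    simp [Ghost.next, Function.update_of_ne (Ne.symm hp)]

theorem vers_succ (k o : ℕ) : E.vers (k + 1) o = E.vers k o ∨
    ∃ p v, E.lab k = .instr p ∧ (E.ghost k).published (E.cfg k) p = some (o, v) ∧
      E.vers (k + 1) o = v :: E.vers k o := by
  simp only [vers, ghost]
  cases h : E.lab k with
  | inv => simp [Ghost.next]
  | res => simp [Ghost.next]
  | instr p =>
    simp only [Ghost.next, Ghost.nextVers]
    cases h' : (E.ghost k).published (E.cfg k) p with
    | none => simp
    | some x =>
      obtain ⟨o', v⟩ := x
      by_cases ho : o = o'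
      · subst ho
        right
        exact ⟨p, v, rfl, h', by simp⟩
      · left
        simp [Function.update_of_ne ho]

theorem dec_succ (k n : ℕ) : E.dec (k + 1) n = E.dec k n ∨
    E.dec k n = none ∧ ∃ p o t next, E.lab k = .instr p ∧
      (E.cfg k).loc p = .tsCAS o n t next ∧ E.dec (k + 1) n = some ((E.ghost k).last p, t) := by
  simp only [dec, ghost]
  cases h : E.lab k with
  | inv => simp [Ghost.next]
  | res => simp [Ghost.next]
  | instr p =>
    simp only [Ghost.next]
    cases hl : (E.cfg k).loc p
    case tsCAS o n' t next =>
      simp only [Ghost.nextDec, hl]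
      split
      · by_cases hn : n = n'
        · subst hn
          right
          exact ⟨by assumption, p, o, t, next, rfl, hl, by simp⟩
        · left; simp [Function.update_of_ne hn]
      · simp
    all_goals simp [Ghost.nextDec, hl]

theorem vers_suffix {k k' : ℕ} (h : k ≤ k') (o : ℕ) : E.vers k o <:+ E.vers k' o := by
  induction h with
  | refl => exact List.suffix_rfl
  | step h ih =>
    refine ih.trans ?_
    rcases E.vers_succ _ o with h | ⟨p, v, _, _, h⟩
    · rw [Nat.succ_eq_add_one, h]
    · rw [Nat.succ_eq_add_one, h]; exact List.suffix_cons _ _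

theorem vers_mono {k k' : ℕ} (h : k ≤ k') {o : ℕ} {v : Version V} (hv : v ∈ E.vers k o) :
    v ∈ E.vers k' o := (E.vers_suffix h o).subset hv

/-- Version lists only grow, so comparing their lengths orders the times at which they were
observed. -/
theorem vers_lt {k k' o : ℕ} (h : (E.vers k o).length < (E.vers k' o).length) : k < k' := by
  by_contra hc
  exact absurd (E.vers_suffix (not_lt.1 hc) o).length_le (not_le.2 h)

theorem dec_mono {k k' : ℕ} (h : k ≤ k') {n : ℕ} {x : ℕ × ℕ} (hv : E.dec k n = some x) :
    E.dec k' n = some x := by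
  induction h with
  | refl => exact hv
  | step h ih =>
    rcases E.dec_succ _ n with h | ⟨h, _⟩
    · rw [Nat.succ_eq_add_one, h, ih]
    · rw [h] at ih; simp at ih

theorem cur_spec {k : ℕ} {p : P} {i : ℕ} {op : Op V} (h : (E.ghost k).cur p = some (i, op)) :
    i < k ∧ E.lab i = .inv p op ∧ ∀ m r, i < m → m < k → E.lab m ≠ .res p r := by
  induction k with
  | zero => simp [ghost] at h
  | succ k ih =>
    by_cases hp : (E.lab k).proc = p
    · simp only [ghost] at h
      cases hl : E.lab k with
      | inv q op' =>
        rw [hl] at hp h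
        simp only [Label.proc] at hp
        subst hp
        simp only [Ghost.next, Function.update_self, Option.some.injEq, Prod.mk.injEq] at h
        obtain ⟨rfl, rfl⟩ := h
        exact ⟨Nat.lt_succ_self _, hl, fun m r h1 h2 => by omega⟩
      | res q r =>
        rw [hl] at hp h
        simp only [Label.proc] at hp
        subst hp
        simp [Ghost.next] at h
      | instr q =>
        rw [hl] at h
        simp only [Ghost.next] at h
        obtain ⟨h1, h2, h3⟩ := ih h
        refine ⟨by omega, h2, fun m r hm hm' => ?_⟩
        rcases Nat.lt_succ_iff_lt_or_eq.1 hm' with h | rfl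
        · exact h3 m r hm h
        · rw [hl]; simp
    · rw [(E.ghost_step_other hp).1] at h
      obtain ⟨h1, h2, h3⟩ := ih h
      refine ⟨by omega, h2, fun m r hm hm' => ?_⟩
      rcases Nat.lt_succ_iff_lt_or_eq.1 hm' with h | rfl
      · exact h3 m r hm h
      · intro he
        rw [he] at hp
        exact hp rfl

theorem ongoing_of_cur {k : ℕ} (hk : k < E.len) {p : P} {i : ℕ} {op : Op V}
    (h : (E.ghost k).cur p = some (i, op)) : E.Ongoing p i k :=
  ⟨⟨op, (E.cur_spec h).2.1⟩, (E.cur_spec h).1, hk, (E.cur_spec h).2.2⟩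

theorem cnt_eq_ncard {k : ℕ} (hk : k ≤ E.len) {p : P} {i : ℕ} {op : Op V}
    (h : (E.ghost k).cur p = some (i, op)) :
    (E.ghost k).cnt p = {j | j < k ∧ E.Performs i j}.ncard := by
  induction k with
  | zero => simp [ghost] at h
  | succ k ih =>
    have hlab := (E.cur_spec h).2.1
    have key : ∀ j, E.Performs i j → E.lab j = .instr p := by
      rintro j ⟨q, ⟨⟨op', h1⟩, _⟩, h2⟩
      rw [hlab] at h1
      cases h1
      exact h2
    have same : E.lab k ≠ .instr p →
        {j | j < k + 1 ∧ E.Performs i j} = {j | j < k ∧ E.Performs i j} := by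
      intro hne
      ext j
      simp only [Set.mem_ofPred_eq]
      constructor
      · rintro ⟨h1, h2⟩
        rcases Nat.lt_succ_iff_lt_or_eq.1 h1 with h | rfl
        · exact ⟨h, h2⟩
        · exact absurd (key _ h2) hne
      · rintro ⟨h1, h2⟩; exact ⟨by omega, h2⟩
    by_cases hp : (E.lab k).proc = p
    · cases hl : E.lab k with
      | inv q op' =>
        rw [same (by simp [hl])]
        simp only [ghost] at h ⊢
        rw [hl] at hp h
        simp only [Label.proc] at hp
        subst hp
        simp only [Ghost.next, Function.update_self, Option.some.injEq, Prod.mk.injEq] at h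
        obtain ⟨rfl, rfl⟩ := h
        have : {j | j < k ∧ E.Performs k j} = ∅ := by
          ext j
          simp only [Set.mem_ofPred_eq, Set.mem_empty_iff_false, iff_false, not_and]
          rintro h1 ⟨q, ⟨_, h2, _⟩, _⟩
          omega
        rw [this]
        simp only [hl, Ghost.next, Function.update_self, Set.ncard_empty]
      | res q r =>
        simp only [ghost] at h
        rw [hl] at hp h
        simp only [Label.proc] at hp
        subst hp
        simp [Ghost.next] at h
      | instr q =>
        rw [hl] at hp
        simp only [Label.proc] at hp
        subst hp
        have h' : (E.ghost k).cur q = some (i, op) := by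
          simp only [ghost] at h
          rw [hl] at h
          exact h
        have hperf : E.Performs i k := ⟨q, E.ongoing_of_cur (by omega) h', hl⟩
        have : {j | j < k + 1 ∧ E.Performs i j} = insert k {j | j < k ∧ E.Performs i j} := by
          ext j
          simp only [Set.mem_ofPred_eq, Set.mem_insert_iff]
          constructor
          · rintro ⟨h1, h2⟩
            rcases Nat.lt_succ_iff_lt_or_eq.1 h1 with h | rfl
            · exact .inr ⟨h, h2⟩
            · exact .inl rfl
          · rintro (rfl | ⟨h1, h2⟩)
            · exact ⟨by omega, hperf⟩
            · exact ⟨by omega, h2⟩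
        rw [this, Set.ncard_insert_of_notMem (by simp)
          ((Set.finite_lt_nat k).subset fun j hj => hj.1), ← ih (by omega) h']
        simp only [ghost]
        rw [hl]
        simp [Ghost.next]
    · rw [(E.ghost_step_other hp).1] at h
      rw [(E.ghost_step_other hp).2.2, ih (by omega) h, same]
      intro he
      rw [he] at hp
      exact hp rfl

end Execution

/-! ### Monotonicity of cameras and objects -/

/-- Instructions never decrease the timestamp of a camera and increase it by at most one. -/
theorem Instr.cams {V : Type*} {M M' : Mem V} {l l' : Loc V} (h : Instr M l M' l') {s t : ℕ}
    (hs : M.cams s = some t) :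
    M'.cams s = some t ∨ M'.cams s = some (t + 1) := by
  cases h <;> try exact .inl hs
  · rename_i s' h
    left
    rw [← hs]
    exact Function.update_of_ne (by rintro rfl; simp [h] at hs) _ _
  · rename_i s' t' h
    by_cases e : s = s'
    · subst e
      rw [hs] at h
      cases h
      right; simp
    · left; simpa [Function.update_of_ne e] using hs

/-- Objects are never deallocated and keep their camera. -/
theorem Instr.objs {V : Type*} {M M' : Mem V} {l l' : Loc V} (h : Instr M l M' l') {o : ℕ}
    {O : VObj} (ho : M.objs o = some O) : ∃ O', M'.objs o = some O' ∧ O'.S = O.S := by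
  cases h <;> try exact ⟨O, ho, rfl⟩
  · rename_i s o' h
    refine ⟨O, ?_, rfl⟩
    rw [← ho]
    exact Function.update_of_ne (by rintro rfl; simp [h] at ho) _ _
  case objSetHead o' _ O' h =>
    by_cases e : o = o'
    · subst e
      rw [ho] at h
      cases h
      exact ⟨_, Function.update_self .., rfl⟩
    · exact ⟨O, by simpa [Function.update_of_ne e] using ho, rfl⟩
  case casAppendSucc o' _ _ O' h _ =>
    by_cases e : o = o'
    · subst e
      rw [ho] at h
      cases h
      exact ⟨_, Function.update_self .., rfl⟩
    · exact ⟨O, by simpa [Function.update_of_ne e] using ho, rfl⟩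

namespace Execution

variable {P V : Type*} (E : Execution P V)

theorem cams_succ {k : ℕ} (hk : k < E.len) {s t : ℕ} (h : (E.cfg k).mem.cams s = some t) :
    (E.cfg (k + 1)).mem.cams s = some t ∨ (E.cfg (k + 1)).mem.cams s = some (t + 1) := by
  rcases E.mem_step hk with h' | ⟨p, l', _, h'⟩
  · rw [h']; exact .inl h
  · exact h'.cams h

theorem cams_mono {k k' : ℕ} (h : k ≤ k') (hk : k' ≤ E.len) {s t : ℕ}
    (hs : (E.cfg k).mem.cams s = some t) :
    ∃ t', (E.cfg k').mem.cams s = some t' ∧ t ≤ t' := by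
  induction h with
  | refl => exact ⟨t, hs, le_rfl⟩
  | step h ih =>
    obtain ⟨t', h1, h2⟩ := ih (by omega)
    rcases E.cams_succ (by omega) h1 with h | h
    · exact ⟨_, h, h2⟩
    · exact ⟨_, h, by omega⟩

theorem cams_le {k k' : ℕ} (h : k ≤ k') (hk : k' ≤ E.len) {s t t' : ℕ}
    (hs : (E.cfg k).mem.cams s = some t) (hs' : (E.cfg k').mem.cams s = some t') : t ≤ t' := by
  obtain ⟨t'', h1, h2⟩ := E.cams_mono h hk hs
  rw [hs'] at h1
  cases h1
  exact h2

/-- The timestamp of a camera takes all intermediate values. -/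
theorem exists_bump {k k' : ℕ} (h : k ≤ k') (hk : k' ≤ E.len) {s t t' : ℕ}
    (hs : (E.cfg k).mem.cams s = some t) (hs' : (E.cfg k').mem.cams s = some t') (ht : t < t') :
    ∃ τ, k ≤ τ ∧ τ < k' ∧ (E.cfg τ).mem.cams s = some t ∧
      (E.cfg (τ + 1)).mem.cams s = some (t + 1) := by
  induction h generalizing t' with
  | refl => rw [hs] at hs'; cases hs'; omega
  | @step m h ih =>
    obtain ⟨t1, h1, h2⟩ := E.cams_mono h (by omega) hs
    rcases h2.eq_or_lt with rfl | h2
    · rcases E.cams_succ (by omega) h1 with h3 | h3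
      · rw [Nat.succ_eq_add_one, h3] at hs'
        cases hs'
        omega
      · exact ⟨m, h, Nat.lt_succ_self _, h1, h3⟩
    · obtain ⟨τ, h3, h4, h5⟩ := ih (by omega) h1 h2
      exact ⟨τ, h3, by omega, h5⟩

/-- The object `o` exists at time `k` and is associated with the camera `s`. -/
def HasCam (k o s : ℕ) : Prop := ∃ O, (E.cfg k).mem.objs o = some O ∧ O.S = s

variable {E}

theorem HasCam.mono {k k' o s : ℕ} (hc : E.HasCam k o s) (h : k ≤ k') (hk : k' ≤ E.len) :
    E.HasCam k' o s := by
  induction h with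
  | refl => exact hc
  | @step m h ih =>
    obtain ⟨O, h1, h2⟩ := ih (by omega)
    rcases E.mem_step (k := m) (by omega) with h' | ⟨p, l', _, h'⟩
    · exact ⟨O, by rw [Nat.succ_eq_add_one, h']; exact h1, h2⟩
    · obtain ⟨O', h3, h4⟩ := h'.objs h1
      exact ⟨O', h3, h4.trans h2⟩

theorem HasCam.unique {k o s s' : ℕ} (h : E.HasCam k o s) (h' : E.HasCam k o s') : s = s' := by
  obtain ⟨O, h1, rfl⟩ := h
  obtain ⟨O', h2, rfl⟩ := h'
  rw [h1] at h2
  cases h2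
  rfl

end Execution

/-! ### The invariant -/

/-- The node that has been allocated but not yet added to a version list. -/
def Loc.priv {V : Type*} : Loc V → Option ℕ
  | .objSetHead _ n => some n
  | .casAppend _ _ n => some n
  | .casDelete _ n => some n
  | _ => none

/-- The object under construction whose version list is still empty. -/
def Loc.ctor {V : Type*} : Loc V → Option ℕ
  | .objNode o _ => some o
  | .objSetHead o _ => some o
  | _ => none

namespace Execution

variable {P V : Type*} (E : Execution P V)

/-- At time `d` a process reads the timestamp `t` of the camera of `o` in order to assign it to the
node `n`. -/
structure ReadsTs (d o n t : ℕ) : Prop where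
  lab : ∃ q next, E.lab d = .instr q ∧ (E.cfg d).loc q = .tsRead o n next
  ts : ∃ s, E.HasCam d o s ∧ (E.cfg d).mem.cams s = some t
  vers : E.vers (d + 1) o = E.vers d o
  mem : ∃ v ∈ E.vers d o, v.node = n

/-- The operation `i` has not added a version before time `k`. -/
def Unpub (k i : ℕ) : Prop := ∀ o, ∀ v ∈ E.vers k o, v.op ≠ i

/-- Between `i` and `k`, the version `v` was the newest one of `o`. -/
def HeadRead (i k o : ℕ) (v : Version V) : Prop :=
  ∃ τ post, i < τ ∧ τ < k ∧ E.vers τ o = v :: post ∧ E.vers (τ + 1) o = v :: post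

/-- Between `i` and `k`, the version `v` was the newest one of `o` and its timestamp had been
read. -/
def ReadPoint (i k o : ℕ) (v : Version V) : Prop :=
  ∃ τ d t post, i < τ ∧ τ < k ∧ E.vers (τ + 1) o = v :: post ∧ E.dec k v.node = some (d, t) ∧ d ≤ τ

/-- Between `i` and `k`, the newest version of `o` had value `a`, and `x` was added after it. -/
def Overtaken (i k o : ℕ) (a : V) (x : Version V) : Prop :=
  ∃ τ h pre post, i < τ ∧ τ < k ∧ E.vers τ o = h :: post ∧ h.val = a ∧
    E.vers k o = pre ++ x :: h :: post

/-- Some version of `o` has a timestamp that is at most `ts`. -/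
def HasOld (k ts : ℕ) (l : List (Version V)) : Prop :=
  ∃ w ∈ l, ∃ d t, E.dec k w.node = some (d, t) ∧ t ≤ ts

/-- The operation `o.readSnapshot(ts)` invoked at `i` has reached the version `v`, after having
skipped the versions in `pre`. -/
def Scan (i k o ts : ℕ) (pre : List (Version V)) (v : Version V) : Prop :=
  ∃ m post, i < m ∧ m < k ∧ E.ReadsHead i m o ts ∧ E.vers m o = pre ++ v :: post ∧
    (∀ w ∈ pre, ∃ d t, E.dec k w.node = some (d, t) ∧ ts < t) ∧ E.HasOld k ts (v :: post)

/-- At time `τ` the operation invoked at `i` creates the camera `s`. -/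
def CreatesCam (i τ s : ℕ) : Prop :=
  ∃ p, E.Ongoing p i τ ∧ E.lab τ = .instr p ∧ (E.cfg τ).loc p = .camNew ∧
    (E.cfg τ).mem.cams s = none ∧ (E.cfg (τ + 1)).mem.cams s ≠ none

/-- At time `τ` the timestamp of the camera `s` is incremented from `t` to `t + 1`. -/
def Bump (τ s t : ℕ) : Prop :=
  (E.cfg τ).mem.cams s = some t ∧ (E.cfg (τ + 1)).mem.cams s = some (t + 1)

/-- What is known about a process in the subroutine `o.initTS(n)`, followed by a given
instruction; the operation has performed at most `c` instructions. -/
inductive AfterTS (k : ℕ) (p : P) (i : ℕ) : ℕ → Op V → ℕ → ℕ → Loc V → Prop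
  -- The head passed to `initTS` need not be `x` itself. If it is a newer version, then `x` already
  -- has its timestamp. The same alternative occurs in `casFalse`.
  | ctor {c v s o n} {x : Version V} (hx : x ∈ E.vers k o) (ho : x.op = i)
      (hn : x.node = n ∨ E.dec k x.node ≠ none) :
      AfterTS k p i c (.newVCAS v s) o n (.ret (.obj o))
  | read {c o n} {v : Version V} (h : E.HeadRead i k o v) (hn : v.node = n) :
      AfterTS k p i c (.vRead o) o n (.readVal n)
  | cas {c o n a b} {v : Version V} (hu : E.Unpub k i) (h : E.HeadRead i k o v) (hn : v.node = n) :
      AfterTS k p i c (.vCAS o a b) o n (.casCmpVal o a b n)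
  | casTrue {c o n a b} {x : Version V} (hx : x ∈ E.vers k o) (ho : x.op = i) (hn : x.node = n) :
      AfterTS k p i c (.vCAS o a b) o n (.ret (.bool true))
  | casFalse {c o n a b} {x : Version V} (hu : E.Unpub k i) (h : E.Overtaken i k o a x)
      (hn : x.node = n ∨ E.dec k x.node ≠ none) :
      AfterTS k p i c (.vCAS o a b) o n (.ret (.bool false))
  | snap {c o n ts} {v : Version V} (h : E.Scan i k o ts [] v) (hn : v.node = n)
      (hc : (E.ghost k).cnt p ≤ c) (hc' : 1 ≤ (E.ghost k).cnt p) :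
      AfterTS k p i c (.readSnapshot o ts) o n (.rsWhile ts n)

/-- What is known about a process that executes the operation invoked at time `i`. -/
inductive LocOK (k : ℕ) (p : P) (i : ℕ) : Op V → Loc V → Prop
  | camNew : LocOK k p i .newCamera .camNew
  | camRet {s τ} (h : i < τ) (h' : τ < k) (ha : E.CreatesCam i τ s) :
      LocOK k p i .newCamera (.ret (.cam s))
  | objNew {v s t} (hs : (E.cfg k).mem.cams s = some t) (hu : E.Unpub k i) :
      LocOK k p i (.newVCAS v s) (.objNew v s)
  | objNode {v s o} (hs : E.HasCam k o s) (hu : E.Unpub k i) :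
      LocOK k p i (.newVCAS v s) (.objNode o v)
  | objSetHead {v s o n} (hs : E.HasCam k o s) (hu : E.Unpub k i)
      (hn : (E.cfg k).mem.nodes n = some ⟨v, none, none⟩) :
      LocOK k p i (.newVCAS v s) (.objSetHead o n)
  | objInit {v s o} {x : Version V} (hx : x ∈ E.vers k o) (ho : x.op = i) :
      LocOK k p i (.newVCAS v s) (.objInit o)
  | objRet {v s o} {x : Version V} (hx : x ∈ E.vers k o) (ho : x.op = i)
      (hd : E.dec k x.node ≠ none) : LocOK k p i (.newVCAS v s) (.ret (.obj o))
  -- The bounds 1, 2, 3 count the read of `VHead` and the instructions of `initTS` executed so far;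
  -- they matter only for `readSnapshot`.
  | tsCheck {op o n next} (hn : ∃ v ∈ E.vers k o, v.node = n)
      (h : E.AfterTS k p i 1 op o n next) : LocOK k p i op (.tsCheck o n next)
  | tsRead {op o n next} (hn : ∃ v ∈ E.vers k o, v.node = n)
      (h : E.AfterTS k p i 2 op o n next) : LocOK k p i op (.tsRead o n next)
  | tsCAS {op o n t next} (hn : ∃ v ∈ E.vers k o, v.node = n)
      (h : E.AfterTS k p i 3 op o n next) (hl : (E.ghost k).last p < k)
      (hr : E.ReadsTs ((E.ghost k).last p) o n t) : LocOK k p i op (.tsCAS o n t next)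
  | snapRead {s t} (hs : (E.cfg k).mem.cams s = some t) :
      LocOK k p i (.takeSnapshot s) (.snapRead s)
  | snapCAS {s t τ} (h : i < τ) (h' : τ < k) (hs : (E.cfg τ).mem.cams s = some t) :
      LocOK k p i (.takeSnapshot s) (.snapCAS s t)
  | snapRet {s t τ} (h : i < τ) (h' : τ < k) (hs : E.Bump τ s t) :
      LocOK k p i (.takeSnapshot s) (.ret (.handle t))
  | readHead {o} (h : E.vers k o ≠ []) : LocOK k p i (.vRead o) (.readHead o)
  | readVal {o n} {v : Version V} (h : E.HeadRead i k o v) (hn : v.node = n)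
      (hd : E.dec k n ≠ none) : LocOK k p i (.vRead o) (.readVal n)
  | readRet {o x} {v : Version V} (h : E.ReadPoint i k o v) (hv : v.val = x) :
      LocOK k p i (.vRead o) (.ret (.val x))
  | casHead {o a b} (h : E.vers k o ≠ []) (hu : E.Unpub k i) :
      LocOK k p i (.vCAS o a b) (.casHead o a b)
  | casCmpVal {o a b n} {v : Version V} (hu : E.Unpub k i) (h : E.HeadRead i k o v)
      (hn : v.node = n) (hd : E.dec k n ≠ none) :
      LocOK k p i (.vCAS o a b) (.casCmpVal o a b n)
  | casCmpNew {o a b n} {v : Version V} (hu : E.Unpub k i) (h : E.HeadRead i k o v)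
      (hn : v.node = n) (hd : E.dec k n ≠ none) (hv : v.val = a) :
      LocOK k p i (.vCAS o a b) (.casCmpNew o a b n)
  | casNode {o a b n} {v : Version V} (hu : E.Unpub k i) (h : E.HeadRead i k o v)
      (hn : v.node = n) (hd : E.dec k n ≠ none) (hv : v.val = a) (hab : b ≠ a) :
      LocOK k p i (.vCAS o a b) (.casNode o b n)
  | casAppend {o a b n n'} {v : Version V} (hu : E.Unpub k i) (h : E.HeadRead i k o v)
      (hn : v.node = n) (hd : E.dec k n ≠ none) (hv : v.val = a) (hab : b ≠ a)
      (hn' : (E.cfg k).mem.nodes n' = some ⟨b, some n, none⟩) :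
      LocOK k p i (.vCAS o a b) (.casAppend o n n')
  | casDelete {o a b n} {x : Version V} (hu : E.Unpub k i) (h : E.Overtaken i k o a x) :
      LocOK k p i (.vCAS o a b) (.casDelete o n)
  | casInit {o a b} {x : Version V} (hu : E.Unpub k i) (h : E.Overtaken i k o a x) :
      LocOK k p i (.vCAS o a b) (.casInit o)
  -- The answers of a `vCAS` that adds no version: it can return true only when old and new value
  -- agree.
  | casRet {o a b r} {v : Version V} (hu : E.Unpub k i) (h : E.ReadPoint i k o v)
      (hr : r = true ↔ v.val = a) (hb : r = true → b = a) :
      LocOK k p i (.vCAS o a b) (.ret (.bool r))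
  | casRetTrue {o a b} {x : Version V} (hx : x ∈ E.vers k o) (ho : x.op = i)
      (hd : E.dec k x.node ≠ none) : LocOK k p i (.vCAS o a b) (.ret (.bool true))
  | rsHead {o ts} (h : E.HasOld k ts (E.vers k o)) (hc : (E.ghost k).cnt p = 0) :
      LocOK k p i (.readSnapshot o ts) (.rsHead o ts)
  -- Each skipped version costs two instructions, the read of `VHead` one, and `initTS` between one
  -- and three. The weaker lower bound suffices.
  | rsWhile {o ts n pre} {v : Version V} (h : E.Scan i k o ts pre v) (hn : v.node = n)
      (hd : E.dec k n ≠ none) (hc : (E.ghost k).cnt p ≤ 2 * pre.length + 4)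
      (hc' : 2 * pre.length + 1 ≤ (E.ghost k).cnt p) :
      LocOK k p i (.readSnapshot o ts) (.rsWhile ts n)
  | rsNext {o ts n pre d t} {v : Version V} (h : E.Scan i k o ts pre v) (hn : v.node = n)
      (hd : E.dec k n = some (d, t)) (ht : ts < t)
      (hc : (E.ghost k).cnt p ≤ 2 * pre.length + 5)
      (hc' : 2 * pre.length + 2 ≤ (E.ghost k).cnt p) :
      LocOK k p i (.readSnapshot o ts) (.rsNext ts n)
  | rsVal {o ts n pre d t} {v : Version V} (h : E.Scan i k o ts pre v) (hn : v.node = n)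
      (hd : E.dec k n = some (d, t)) (ht : t ≤ ts)
      (hc : (E.ghost k).cnt p ≤ 2 * pre.length + 5)
      (hc' : 2 * pre.length + 1 ≤ (E.ghost k).cnt p) :
      LocOK k p i (.readSnapshot o ts) (.rsVal n)
  | rsRet {o ts x pre d t} {v : Version V} (h : E.Scan i k o ts pre v) (hv : v.val = x)
      (hd : E.dec k v.node = some (d, t)) (ht : t ≤ ts)
      (hc : (E.ghost k).cnt p ≤ 2 * pre.length + 6)
      (hc' : 2 * pre.length + 1 ≤ (E.ghost k).cnt p) :
      LocOK k p i (.readSnapshot o ts) (.ret (.val x))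

/-- The relation between the shared memory, the version lists and the assigned timestamps. -/
structure MemInv (k : ℕ) : Prop where
  obj_none : ∀ o, (E.cfg k).mem.objs o = none → E.vers k o = []
  obj_some : ∀ o O, (E.cfg k).mem.objs o = some O →
    O.VHead = (E.vers k o).head?.map Version.node ∧ ∃ t, (E.cfg k).mem.cams O.S = some t
  node : ∀ o pre v post, E.vers k o = pre ++ v :: post →
    (E.cfg k).mem.nodes v.node =
      some ⟨v.val, post.head?.map Version.node, (E.dec k v.node).map Prod.snd⟩
  -- Only the newest version can still be `TBD`, as a `vCAS` executes `initTS` on the head before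
  -- appending to it.
  tail : ∀ o pre v post, E.vers k o = pre ++ v :: post → pre ≠ [] → E.dec k v.node ≠ none
  -- The timestamp was read while the version was the newest one; this is the source of all
  -- comparisons between linearization points.
  decided : ∀ o pre v post d t, E.vers k o = pre ++ v :: post → E.dec k v.node = some (d, t) →
    d < k ∧ E.vers d o = v :: post ∧ E.ReadsTs d o v.node t
  undecided : ∀ n, (∀ o, ∀ v ∈ E.vers k o, v.node ≠ n) → E.dec k n = none
  -- Deleted addresses may be reused, but only nodes outside all version lists are deleted, so among
  -- listed versions an address identifies the version and everything below it.
  node_inj : ∀ o o' pre pre' v v' post post', E.vers k o = pre ++ v :: post →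
    E.vers k o' = pre' ++ v' :: post' → v.node = v'.node → o = o' ∧ v = v' ∧ post = post'
  op_inj : ∀ o o' pre pre' v v' post post', E.vers k o = pre ++ v :: post →
    E.vers k o' = pre' ++ v' :: post' → v.op = v'.op → o = o' ∧ v = v' ∧ post = post'
  op_lt : ∀ o, ∀ v ∈ E.vers k o, v.op < k
  first : ∀ o pre v, E.vers k o = pre ++ [v] →
    ∃ p s, E.lab v.op = .inv p (.newVCAS v.val s) ∧ E.HasCam k o s
  -- Adjacent versions differ in value because a `vCAS` with equal values returns early. This is why
  -- a `vCAS` that loses the race for `VHead` may answer false.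
  later : ∀ o pre v w post, E.vers k o = pre ++ v :: w :: post →
    v.val ≠ w.val ∧ (∃ p, E.lab v.op = .inv p (.vCAS o w.val v.val)) ∧
      ∃ a < k, E.Appends v.op a o v.node

/-- The invariant of the algorithm. -/
structure Inv (k : ℕ) : Prop where
  mem : E.MemInv k
  idle : ∀ p, (E.ghost k).cur p = none → (E.cfg k).loc p = .idle
  loc : ∀ p i op, (E.ghost k).cur p = some (i, op) → E.LocOK k p i op ((E.cfg k).loc p)
  priv : ∀ p n, ((E.cfg k).loc p).priv = some n →
    (E.cfg k).mem.nodes n ≠ none ∧ (∀ o, ∀ v ∈ E.vers k o, v.node ≠ n) ∧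
      ∀ q ≠ p, ((E.cfg k).loc q).priv ≠ some n
  ctor : ∀ p o, ((E.cfg k).loc p).ctor = some o →
    E.vers k o = [] ∧ (E.cfg k).mem.objs o ≠ none ∧ ∀ q ≠ p, ((E.cfg k).loc q).ctor ≠ some o

/-! ### Stability of the assertions -/

variable {E}

theorem HeadRead.mono {i k k' o : ℕ} {v : Version V} (h : E.HeadRead i k o v) (hk : k ≤ k') :
    E.HeadRead i k' o v := by
  obtain ⟨τ, post, h1, h2, h3⟩ := h
  exact ⟨τ, post, h1, by omega, h3⟩

theorem HeadRead.mem {i k o : ℕ} {v : Version V} (h : E.HeadRead i k o v) : v ∈ E.vers k o := by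
  obtain ⟨τ, post, h1, h2, h3, _⟩ := h
  exact E.vers_mono h2.le (by rw [h3]; simp)

theorem ReadPoint.mono {i k k' o : ℕ} {v : Version V} (h : E.ReadPoint i k o v) (hk : k ≤ k') :
    E.ReadPoint i k' o v := by
  obtain ⟨τ, d, t, post, h1, h2, h3, h4, h5⟩ := h
  exact ⟨τ, d, t, post, h1, by omega, h3, E.dec_mono hk h4, h5⟩

theorem Overtaken.mono {i k k' o : ℕ} {a : V} {x : Version V} (h : E.Overtaken i k o a x)
    (hk : k ≤ k') : E.Overtaken i k' o a x := by
  obtain ⟨τ, h, pre, post, h1, h2, h3, h4, h5⟩ := h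
  obtain ⟨pre', h6⟩ := E.vers_suffix hk o
  exact ⟨τ, h, pre' ++ pre, post, h1, by omega, h3, h4, by rw [← h6, h5]; simp⟩

theorem HasOld.mono {k k' ts : ℕ} {l : List (Version V)} (h : E.HasOld k ts l)
    (hk : k ≤ k') : E.HasOld k' ts l := by
  obtain ⟨w, hw, d, t, h1, h2⟩ := h
  exact ⟨w, hw, d, t, E.dec_mono hk h1, h2⟩

theorem HasOld.mono_list {k ts : ℕ} {l l' : List (Version V)} (h : E.HasOld k ts l)
    (hl : l ⊆ l') : E.HasOld k ts l' := by
  obtain ⟨w, hw, h⟩ := h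
  exact ⟨w, hl hw, h⟩

theorem Scan.mono {i k k' o ts : ℕ} {pre : List (Version V)} {v : Version V}
    (h : E.Scan i k o ts pre v) (hk : k ≤ k') : E.Scan i k' o ts pre v := by
  obtain ⟨m, post, h1, h2, h3, h4, h5, h6⟩ := h
  refine ⟨m, post, h1, by omega, h3, h4, fun w hw => ?_, h6.mono hk⟩
  obtain ⟨d, t, h7, h8⟩ := h5 w hw
  exact ⟨d, t, E.dec_mono hk h7, h8⟩

theorem Scan.mem {i k o ts : ℕ} {pre : List (Version V)} {v : Version V}
    (h : E.Scan i k o ts pre v) : v ∈ E.vers k o := by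
  obtain ⟨m, post, h1, h2, h3, h4, h5, h6⟩ := h
  exact E.vers_mono h2.le (by rw [h4]; simp)

theorem dec_ne_mono {k k' n : ℕ} (h : E.dec k n ≠ none) (hk : k ≤ k') : E.dec k' n ≠ none := by
  obtain ⟨x, hx⟩ := Option.ne_none_iff_exists'.1 h
  rw [E.dec_mono hk hx]
  simp

theorem vers_ne_mono {k k' o : ℕ} (h : E.vers k o ≠ []) (hk : k ≤ k') : E.vers k' o ≠ [] := by
  intro h'
  have := E.vers_suffix hk o
  rw [h'] at this
  exact h (List.suffix_nil.1 this)

theorem exists_node_mono {k k' o n : ℕ} (h : ∃ v ∈ E.vers k o, v.node = n) (hk : k ≤ k') :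
    ∃ v ∈ E.vers k' o, v.node = n := by
  obtain ⟨v, hv, hn⟩ := h
  exact ⟨v, E.vers_mono hk hv, hn⟩

theorem AfterTS.mono {k k' : ℕ} {p : P} {i c c' : ℕ} {op : Op V} {o n : ℕ} {l : Loc V}
    (h : E.AfterTS k p i c op o n l) (hk : k ≤ k') (hU : E.Unpub k i → E.Unpub k' i)
    (hcnt : (E.ghost k).cnt p ≤ c → (E.ghost k').cnt p ≤ c')
    (hcnt' : (E.ghost k).cnt p ≤ (E.ghost k').cnt p) : E.AfterTS k' p i c' op o n l := by
  cases h with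
  | ctor hx ho hn => exact .ctor (E.vers_mono hk hx) ho (hn.imp_right (dec_ne_mono · hk))
  | read h hn => exact .read (h.mono hk) hn
  | cas hu h hn => exact .cas (hU hu) (h.mono hk) hn
  | casTrue hx ho hn => exact .casTrue (E.vers_mono hk hx) ho hn
  | casFalse hu h hn => exact .casFalse (hU hu) (h.mono hk) (hn.imp_right (dec_ne_mono · hk))
  | snap h hn hc hc' => exact .snap (h.mono hk) hn (hcnt hc) (hc'.trans hcnt')

/-- The assertions concern past events, history variables that only grow, the existence of cameras
and objects, the private node of `p`, and counters of `p`. None of this can be destroyed by a step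
of another process that leaves the private node alone. -/
theorem LocOK.frame {k : ℕ} {p : P} {i : ℕ} {op : Op V} {l : Loc V} (h : E.LocOK k p i op l)
    (hk : k < E.len) (hU : E.Unpub k i → E.Unpub (k + 1) i)
    (hN : ∀ n, l.priv = some n → (E.cfg (k + 1)).mem.nodes n = (E.cfg k).mem.nodes n)
    (hp : (E.lab k).proc ≠ p) : E.LocOK (k + 1) p i op l := by
  obtain ⟨-, hlast, hcnt⟩ := E.ghost_step_other hp
  have hk1 := Nat.le_succ k
  have hA : ∀ {c op o n l}, E.AfterTS k p i c op o n l → E.AfterTS (k + 1) p i c op o n l :=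
    fun h => h.mono hk1 hU (by rw [hcnt]; exact id) hcnt.ge
  cases h with
  | camNew => exact .camNew
  | camRet h h' ha => exact .camRet h (by omega) ha
  | objNew hs hu =>
    obtain ⟨t', h, _⟩ := E.cams_mono hk1 hk hs
    exact .objNew h (hU hu)
  | objNode hs hu => exact .objNode (hs.mono hk1 hk) (hU hu)
  | objSetHead hs hu hn => exact .objSetHead (hs.mono hk1 hk) (hU hu) (by rw [hN _ rfl, hn])
  | objInit hx ho => exact .objInit (E.vers_mono hk1 hx) ho
  | objRet hx ho hd => exact .objRet (E.vers_mono hk1 hx) ho (dec_ne_mono hd hk1)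
  | tsCheck hn h => exact .tsCheck (exists_node_mono hn hk1) (hA h)
  | tsRead hn h => exact .tsRead (exists_node_mono hn hk1) (hA h)
  | tsCAS hn h hl hr =>
    exact .tsCAS (exists_node_mono hn hk1) (hA h) (by rw [hlast]; omega) (by rwa [hlast])
  | snapRead hs =>
    obtain ⟨t', h, _⟩ := E.cams_mono hk1 hk hs
    exact .snapRead h
  | snapCAS h h' hs => exact .snapCAS h (by omega) hs
  | snapRet h h' hs => exact .snapRet h (by omega) hs
  | readHead h => exact .readHead (vers_ne_mono h hk1)
  | readVal h hn hd => exact .readVal (h.mono hk1) hn (dec_ne_mono hd hk1)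
  | readRet h hv => exact .readRet (h.mono hk1) hv
  | casHead h hu => exact .casHead (vers_ne_mono h hk1) (hU hu)
  | casCmpVal hu h hn hd => exact .casCmpVal (hU hu) (h.mono hk1) hn (dec_ne_mono hd hk1)
  | casCmpNew hu h hn hd hv => exact .casCmpNew (hU hu) (h.mono hk1) hn (dec_ne_mono hd hk1) hv
  | casNode hu h hn hd hv hab =>
    exact .casNode (hU hu) (h.mono hk1) hn (dec_ne_mono hd hk1) hv hab
  | casAppend hu h hn hd hv hab hn' =>
    exact .casAppend (hU hu) (h.mono hk1) hn (dec_ne_mono hd hk1) hv hab (by rw [hN _ rfl, hn'])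
  | casDelete hu h => exact .casDelete (hU hu) (h.mono hk1)
  | casInit hu h => exact .casInit (hU hu) (h.mono hk1)
  | casRet hu h hr hb => exact .casRet (hU hu) (h.mono hk1) hr hb
  | casRetTrue hx ho hd => exact .casRetTrue (E.vers_mono hk1 hx) ho (dec_ne_mono hd hk1)
  | rsHead h hc =>
    exact .rsHead ((h.mono hk1).mono_list (E.vers_suffix hk1 _).subset) (by rw [hcnt, hc])
  | rsWhile h hn hd hc hc' =>
    exact .rsWhile (h.mono hk1) hn (dec_ne_mono hd hk1) (by rwa [hcnt]) (by rwa [hcnt])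
  | rsNext h hn hd ht hc hc' =>
    exact .rsNext (h.mono hk1) hn (E.dec_mono hk1 hd) ht (by rwa [hcnt]) (by rwa [hcnt])
  | rsVal h hn hd ht hc hc' =>
    exact .rsVal (h.mono hk1) hn (E.dec_mono hk1 hd) ht (by rwa [hcnt]) (by rwa [hcnt])
  | rsRet h hv hd ht hc hc' =>
    exact .rsRet (h.mono hk1) hv (E.dec_mono hk1 hd) ht (by rwa [hcnt]) (by rwa [hcnt])

/-- The history variables that an event leaves unchanged unless it adds a version. -/
theorem ghost_of_instr {k : ℕ} {p : P} (hl : E.lab k = .instr p) :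
    E.ghost (k + 1) =
      { cur := (E.ghost k).cur
        last := by classical exact Function.update (E.ghost k).last p k
        cnt := by classical exact Function.update (E.ghost k).cnt p ((E.ghost k).cnt p + 1)
        vers := (E.ghost k).nextVers (E.cfg k) p
        dec := (E.ghost k).nextDec (E.cfg k) p } := by
  rw [ghost, hl]
  rfl

theorem cur_of_published {k : ℕ} {p : P} {o : ℕ} {v : Version V}
    (h : (E.ghost k).published (E.cfg k) p = some (o, v)) :
    ∃ op, (E.ghost k).cur p = some (v.op, op) := by
  unfold Ghost.published at h
  split at h
  · simp only [Option.map_eq_some_iff, Prod.mk.injEq] at h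
    obtain ⟨N, _, _, rfl⟩ := h
    exact ⟨_, by assumption⟩
  · split_ifs at h
    simp only [Option.map_eq_some_iff, Prod.mk.injEq] at h
    obtain ⟨N, _, _, rfl⟩ := h
    exact ⟨_, by assumption⟩
  · simp at h

/-- A version carries the invocation time of the operation that adds it, and this time determines
the process that takes the step. -/
theorem unpub_succ {k : ℕ} {p : P} {i : ℕ} {op : Op V} (hc : (E.ghost k).cur p = some (i, op))
    (hp : (E.lab k).proc ≠ p) (h : E.Unpub k i) : E.Unpub (k + 1) i := by
  intro o v hv
  rcases E.vers_succ k o with h' | ⟨q, w, h1, h2, h3⟩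
  · rw [h'] at hv
    exact h o v hv
  · rw [h3] at hv
    rcases List.mem_cons.1 hv with rfl | hv
    · rintro rfl
      obtain ⟨op', h4⟩ := cur_of_published h2
      have e1 := (E.cur_spec h4).2.1
      rw [(E.cur_spec hc).2.1] at e1
      cases e1
      rw [h1] at hp
      exact hp rfl
    · exact h o v hv

theorem vers_eq_of_instr {k : ℕ} {p : P} (hl : E.lab k = .instr p) (o : ℕ) :
    E.vers (k + 1) o = (E.ghost k).nextVers (E.cfg k) p o := by
  simp only [vers, ghost_of_instr hl]

theorem dec_eq_of_instr {k : ℕ} {p : P} (hl : E.lab k = .instr p) (n : ℕ) :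
    E.dec (k + 1) n = (E.ghost k).nextDec (E.cfg k) p n := by
  simp only [dec, ghost_of_instr hl]

theorem vers_eq_of_published {k : ℕ} {p : P} (hl : E.lab k = .instr p)
    (h : (E.ghost k).published (E.cfg k) p = none) (o : ℕ) : E.vers (k + 1) o = E.vers k o := by
  rw [vers_eq_of_instr hl]
  simp [Ghost.nextVers, h]

/-! ### Preservation of the memory invariant -/

theorem MemInv.node_of_mem {k : ℕ} (h : E.MemInv k) {o : ℕ} {v : Version V}
    (hv : v ∈ E.vers k o) : ∃ nx, (E.cfg k).mem.nodes v.node =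
      some ⟨v.val, nx, (E.dec k v.node).map Prod.snd⟩ := by
  obtain ⟨pre, post, hv⟩ := List.append_of_mem hv
  exact ⟨_, h.node o pre v post hv⟩

theorem MemInv.version_of_head {k : ℕ} (h : E.MemInv k) {o n : ℕ} {O : VObj}
    (ho : (E.cfg k).mem.objs o = some O) (hn : O.VHead = some n) :
    ∃ v post, E.vers k o = v :: post ∧ v.node = n := by
  have := (h.obj_some o O ho).1
  rw [hn] at this
  cases hv : E.vers k o with
  | nil => simp [hv] at this
  | cons v post => exact ⟨v, post, rfl, by simpa [hv, eq_comm] using this⟩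

/-- Covers every event that neither adds a version nor assigns a timestamp, including the allocation
of objects, whose lists are still empty, and of nodes that are not yet listed. -/
theorem MemInv.frame {k : ℕ} (h : E.MemInv k) (hk : k < E.len)
    (hv : ∀ o, E.vers (k + 1) o = E.vers k o) (hd : ∀ n, E.dec (k + 1) n = E.dec k n)
    (hn : ∀ o, ∀ v ∈ E.vers k o,
      (E.cfg (k + 1)).mem.nodes v.node = (E.cfg k).mem.nodes v.node)
    (ho : ∀ o O', (E.cfg (k + 1)).mem.objs o = some O' → (E.cfg k).mem.objs o = some O' ∨
      (E.vers k o = [] ∧ O'.VHead = none ∧ ∃ t, (E.cfg k).mem.cams O'.S = some t)) :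
    E.MemInv (k + 1) where
  obj_none o h' := by
    rw [hv]
    apply h.obj_none
    by_contra hc
    obtain ⟨O, hO⟩ := Option.ne_none_iff_exists'.1 hc
    obtain ⟨O', h1, _⟩ := HasCam.mono (E := E) (s := O.S) ⟨O, hO, rfl⟩ k.le_succ hk
    rw [Nat.succ_eq_add_one, h'] at h1
    simp at h1
  obj_some o O h' := by
    rw [hv]
    rcases ho o O h' with h1 | ⟨h1, h2, t, h3⟩
    · obtain ⟨h2, t, h3⟩ := h.obj_some o O h1
      obtain ⟨t', h4, _⟩ := E.cams_mono k.le_succ hk h3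
      exact ⟨h2, t', h4⟩
    · obtain ⟨t', h4, _⟩ := E.cams_mono k.le_succ hk h3
      exact ⟨by rw [h1, h2]; rfl, t', h4⟩
  node o pre v post h' := by
    rw [hv] at h'
    rw [hd, hn o v (by rw [h']; simp)]
    exact h.node o pre v post h'
  tail o pre v post h' := by
    rw [hv] at h'
    rw [hd]
    exact h.tail o pre v post h'
  decided o pre v post d t h' h'' := by
    rw [hv] at h'
    rw [hd] at h''
    obtain ⟨h1, h2⟩ := h.decided o pre v post d t h' h''
    exact ⟨by omega, h2⟩
  undecided n h' := by
    rw [hd]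
    exact h.undecided n fun o v hvo => h' o v (by rwa [hv])
  node_inj o o' pre pre' v v' post post' h1 h2 := by
    rw [hv] at h1 h2
    exact h.node_inj o o' pre pre' v v' post post' h1 h2
  op_inj o o' pre pre' v v' post post' h1 h2 := by
    rw [hv] at h1 h2
    exact h.op_inj o o' pre pre' v v' post post' h1 h2
  op_lt o v h' := by
    rw [hv] at h'
    have := h.op_lt o v h'
    omega
  first o pre v h' := by
    rw [hv] at h'
    obtain ⟨p, s, h1, h2⟩ := h.first o pre v h'
    exact ⟨p, s, h1, h2.mono k.le_succ hk⟩
  later o pre v w post h' := by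
    rw [hv] at h'
    obtain ⟨h1, h2, a, h3, h4⟩ := h.later o pre v w post h'
    exact ⟨h1, h2, a, by omega, h4⟩

/-- Covers the two instructions that set `VHead`: in the constructor (`hfirst`) and in a successful
append (`hlater`). -/
theorem MemInv.publish {k : ℕ} (h : E.MemInv k) (hk : k < E.len) {o : ℕ} {v : Version V}
    {O : VObj} (hv : E.vers (k + 1) o = v :: E.vers k o)
    (hv' : ∀ o' ≠ o, E.vers (k + 1) o' = E.vers k o') (hd : ∀ n, E.dec (k + 1) n = E.dec k n)
    (hO : (E.cfg k).mem.objs o = some O)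
    (hmem : (E.cfg (k + 1)).mem = { (E.cfg k).mem with
      objs := Function.update (E.cfg k).mem.objs o (some { O with VHead := some v.node }) })
    (hn : (E.cfg k).mem.nodes v.node =
      some ⟨v.val, (E.vers k o).head?.map Version.node, none⟩)
    (hu : ∀ o, ∀ w ∈ E.vers k o, w.node ≠ v.node) (hop : E.Unpub k v.op) (hlt : v.op < k)
    (hfirst : E.vers k o = [] → ∃ p s, E.lab v.op = .inv p (.newVCAS v.val s) ∧ E.HasCam k o s)
    (hlater : ∀ w post, E.vers k o = w :: post → E.dec k w.node ≠ none ∧ v.val ≠ w.val ∧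
      (∃ p, E.lab v.op = .inv p (.vCAS o w.val v.val)) ∧ E.Appends v.op k o v.node) :
    E.MemInv (k + 1) := by
  have hdv : E.dec k v.node = none := h.undecided _ hu
  have split : ∀ {o' pre w post}, E.vers (k + 1) o' = pre ++ w :: post →
      (o' = o ∧ pre = [] ∧ w = v ∧ post = E.vers k o) ∨
      (∃ pre', E.vers k o' = pre' ++ w :: post ∧ (pre = pre' ∨ o' = o ∧ pre = v :: pre')) := by
    intro o' pre w post h'
    by_cases e : o' = o
    · subst e
      rw [hv] at h'
      cases pre with
      | nil =>
        simp only [List.nil_append, List.cons.injEq] at h'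
        exact .inl ⟨rfl, rfl, h'.1.symm, h'.2.symm⟩
      | cons x pre =>
        simp only [List.cons_append, List.cons.injEq] at h'
        exact .inr ⟨pre, h'.2, .inr ⟨rfl, by rw [h'.1]⟩⟩
    · rw [hv' o' e] at h'
      exact .inr ⟨pre, h', .inl rfl⟩
  have hmemv : ∀ {o' pre w post}, E.vers k o' = pre ++ w :: post → w ∈ E.vers k o' := by
    intro o' pre w post h'
    rw [h']
    simp
  constructor
  · intro o' h'
    rw [hmem] at h'
    by_cases e : o' = o
    · subst e
      simp at h'
    · rw [hv' o' e]
      exact h.obj_none o' (by simpa [Function.update_of_ne e] using h')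
  · intro o' O' h'
    rw [hmem] at h' ⊢
    by_cases e : o' = o
    · subst e
      simp only [Function.update_self, Option.some.injEq] at h'
      subst h'
      rw [hv]
      exact ⟨rfl, (h.obj_some o' O hO).2⟩
    · rw [hv' o' e]
      exact h.obj_some o' O' (by simpa [Function.update_of_ne e] using h')
  · intro o' pre w post h'
    rw [hmem, hd]
    rcases split h' with ⟨rfl, rfl, rfl, rfl⟩ | ⟨pre', h1, -⟩
    · rw [hdv]
      exact hn
    · exact h.node o' pre' w post h1
  · intro o' pre w post h' hne
    rw [hd]
    rcases split h' with ⟨rfl, rfl, rfl, rfl⟩ | ⟨pre', h1, rfl | ⟨rfl, rfl⟩⟩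
    · exact absurd rfl hne
    · exact h.tail o' _ w post h1 hne
    · cases pre' with
      | nil => exact (hlater w post h1).1
      | cons x pre' => exact h.tail _ _ w post h1 (by simp)
  · intro o' pre w post d t h' h''
    rw [hd] at h''
    rcases split h' with ⟨rfl, rfl, rfl, rfl⟩ | ⟨pre', h1, -⟩
    · rw [hdv] at h''
      simp at h''
    · obtain ⟨h2, h3⟩ := h.decided o' pre' w post d t h1 h''
      exact ⟨by omega, h3⟩
  · intro n h'
    rw [hd]
    exact h.undecided n fun o' w hw => h' o' w (E.vers_mono k.le_succ hw)
  · intro o1 o2 pre1 pre2 v1 v2 post1 post2 h1 h2 he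
    rcases split h1 with ⟨rfl, rfl, rfl, rfl⟩ | ⟨pre1', h1', -⟩ <;>
    rcases split h2 with ⟨rfl, rfl, rfl, rfl⟩ | ⟨pre2', h2', -⟩
    · exact ⟨rfl, rfl, rfl⟩
    · exact absurd he.symm (hu _ _ (hmemv h2'))
    · exact absurd he (hu _ _ (hmemv h1'))
    · exact h.node_inj _ _ _ _ _ _ _ _ h1' h2' he
  · intro o1 o2 pre1 pre2 v1 v2 post1 post2 h1 h2 he
    rcases split h1 with ⟨rfl, rfl, rfl, rfl⟩ | ⟨pre1', h1', -⟩ <;>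
    rcases split h2 with ⟨rfl, rfl, rfl, rfl⟩ | ⟨pre2', h2', -⟩
    · exact ⟨rfl, rfl, rfl⟩
    · exact absurd he.symm (hop _ _ (hmemv h2'))
    · exact absurd he (hop _ _ (hmemv h1'))
    · exact h.op_inj _ _ _ _ _ _ _ _ h1' h2' he
  · intro o' w hw
    obtain ⟨pre, post, h'⟩ := List.append_of_mem hw
    rcases split h' with ⟨rfl, rfl, rfl, rfl⟩ | ⟨pre', h1, -⟩
    · omega
    · have := h.op_lt o' w (hmemv h1)
      omega
  · intro o' pre w h'
    rcases split h' with ⟨rfl, rfl, rfl, h1⟩ | ⟨pre', h1, -⟩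
    · obtain ⟨p, s, h2, h3⟩ := hfirst h1.symm
      exact ⟨p, s, h2, h3.mono k.le_succ hk⟩
    · obtain ⟨p, s, h2, h3⟩ := h.first o' pre' w h1
      exact ⟨p, s, h2, h3.mono k.le_succ hk⟩
  · intro o' pre w w' post h'
    rcases split h' with ⟨rfl, rfl, rfl, h1⟩ | ⟨pre', h1, -⟩
    · obtain ⟨-, h2, h3, h4⟩ := hlater w' post h1.symm
      exact ⟨h2, h3, k, by omega, h4⟩
    · obtain ⟨h2, h3, a, h4, h5⟩ := h.later o' pre' w w' post h1
      exact ⟨h2, h3, a, by omega, h5⟩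

/-- If the timestamp is still unset when the CAS succeeds, then by `tail` the version is still the
newest. As lists only grow and the version was already listed at `d`, it was the newest at `d` too,
which is what `decided` demands. -/
theorem MemInv.assign {k : ℕ} (h : E.MemInv k) {o n d t : ℕ} {N : VNode V}
    (hv : ∀ o, E.vers (k + 1) o = E.vers k o)
    (hd : E.dec (k + 1) n = some (d, t)) (hd' : ∀ n' ≠ n, E.dec (k + 1) n' = E.dec k n')
    (hdn : E.dec k n = none)
    (hN : (E.cfg k).mem.nodes n = some N)
    (hmem : (E.cfg (k + 1)).mem = { (E.cfg k).mem with
      nodes := Function.update (E.cfg k).mem.nodes n (some { N with ts := some t }) })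
    (hr : E.ReadsTs d o n t) (hdk : d < k) : E.MemInv (k + 1) := by
  obtain ⟨x, hx, rfl⟩ := hr.mem
  obtain ⟨pre0, post0, hx⟩ := List.append_of_mem hx
  obtain ⟨pre1, hx'⟩ := E.vers_suffix hdk.le o
  rw [hx] at hx'
  rw [← List.append_assoc] at hx'
  -- `pre0` holds the versions newer than `x` at time `d`, and `pre1` those added between `d` and
  -- `k`.
  have hpre : pre1 ++ pre0 = [] := by
    by_contra hc
    exact h.tail o _ x post0 hx'.symm hc hdn
  obtain ⟨rfl, rfl⟩ := List.append_eq_nil_iff.1 hpre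
  simp only [List.nil_append] at hx hx'
  have uniq : ∀ {o' pre v post}, E.vers k o' = pre ++ v :: post → v.node = x.node →
      o' = o ∧ v = x ∧ post = post0 := fun h1 h2 =>
    h.node_inj _ _ _ [] _ _ _ _ h1 hx'.symm h2
  have hmono : ∀ n', E.dec k n' ≠ none → E.dec (k + 1) n' ≠ none :=
    fun n' h' => dec_ne_mono h' k.le_succ
  constructor
  · intro o' h'
    rw [hmem] at h'
    rw [hv]
    exact h.obj_none o' h'
  · intro o' O h'
    rw [hmem] at h' ⊢
    rw [hv]
    exact h.obj_some o' O h'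
  · intro o' pre v post h'
    rw [hv] at h'
    have hnode := h.node o' pre v post h'
    rw [hmem]
    by_cases e : v.node = x.node
    · rw [e, hN] at hnode
      rw [e, hd]
      simp only [Function.update_self, Option.some.injEq] at hnode ⊢
      rw [hnode]
      rfl
    · rw [hd' _ e]
      simpa [Function.update_of_ne e] using hnode
  · intro o' pre v post h' hne
    rw [hv] at h'
    exact hmono _ (h.tail o' pre v post h' hne)
  · intro o' pre v post d' t' h' h''
    rw [hv] at h'
    by_cases e : v.node = x.node
    · obtain ⟨rfl, rfl, rfl⟩ := uniq h' e
      rw [hd] at h''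
      cases h''
      exact ⟨by omega, hx, hr⟩
    · rw [hd' _ e] at h''
      obtain ⟨h1, h2⟩ := h.decided o' pre v post d' t' h' h''
      exact ⟨by omega, h2⟩
  · intro n' h'
    have e : n' ≠ x.node := by
      rintro rfl
      exact h' o x (by rw [hv, ← hx']; simp) rfl
    rw [hd' _ e]
    exact h.undecided n' fun o' w hw => h' o' w (by rwa [hv])
  · intro o1 o2 pre1 pre2 v1 v2 post1 post2 h1 h2
    rw [hv] at h1 h2
    exact h.node_inj _ _ _ _ _ _ _ _ h1 h2
  · intro o1 o2 pre1 pre2 v1 v2 post1 post2 h1 h2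
    rw [hv] at h1 h2
    exact h.op_inj _ _ _ _ _ _ _ _ h1 h2
  · intro o' w hw
    rw [hv] at hw
    have := h.op_lt o' w hw
    omega
  · intro o' pre w h'
    rw [hv] at h'
    obtain ⟨p, s, h2, O, h3, h4⟩ := h.first o' pre w h'
    exact ⟨p, s, h2, O, by rw [hmem]; exact h3, h4⟩
  · intro o' pre w w' post h'
    rw [hv] at h'
    obtain ⟨h2, h3, a, h4, h5⟩ := h.later o' pre w w' post h'
    exact ⟨h2, h3, a, by omega, h5⟩

/-- When `initTS` is over, the node has a timestamp. In the case of a lost race, the answer false is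
justified at the time when the timestamp of the overtaking version was read. -/
theorem AfterTS.locOK {k : ℕ} {p : P} {i c : ℕ} {op : Op V} {o n : ℕ} {l : Loc V}
    (h : E.AfterTS k p i c op o n l) (hm : E.MemInv k) (hd : E.dec k n ≠ none) (hc : c ≤ 4) :
    E.LocOK k p i op l := by
  cases h with
  | ctor hx ho hn => exact .objRet hx ho (by rcases hn with rfl | hn <;> assumption)
  | read h hn => exact .readVal h hn hd
  | cas hu h hn => exact .casCmpVal hu h hn hd
  | casTrue hx ho hn => exact .casRetTrue hx ho (by rw [hn]; exact hd)
  | @casFalse _ _ a b x hu h hn =>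
    have hdx : E.dec k x.node ≠ none := by rcases hn with rfl | hn <;> assumption
    obtain ⟨⟨d, t⟩, hdx⟩ := Option.ne_none_iff_exists'.1 hdx
    obtain ⟨τ, h, pre, post, h1, h2, h3, h4, h5⟩ := h
    obtain ⟨h6, h7, h8⟩ := hm.decided _ _ _ _ _ _ h5 hdx
    -- At `d` the list has `x` on top of what it was at `τ`, so the linearization point `d` falls
    -- after the invocation.
    have hτ : τ < d := E.vers_lt (o := o) (by rw [h3, h7]; simp)
    refine .casRet hu (v := x)
      ⟨d, d, t, h :: post, by omega, h6, by rw [h8.vers, h7], hdx, le_rfl⟩ ?_ (by simp)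
    have := (hm.later _ _ _ _ _ h5).1
    rw [h4] at this
    simpa using this
  | snap h hn hc0 hc' => exact .rsWhile h hn hd (by simpa using hc0.trans hc) (by simpa using hc')

/-- If the timestamp was read no later than the time `τ` at which `v` was seen as the head, then `τ`
serves. Otherwise the time `d` of that read serves, because `v` was still the newest version then.
-/
theorem HeadRead.readPoint {k i o : ℕ} {v : Version V} (h : E.HeadRead i k o v)
    (hm : E.MemInv k) (hd : E.dec k v.node ≠ none) : E.ReadPoint i k o v := by
  obtain ⟨⟨d, t⟩, hdx⟩ := Option.ne_none_iff_exists'.1 hd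
  obtain ⟨pre, post', hv⟩ := List.append_of_mem h.mem
  obtain ⟨τ, post, h1, h2, h3, h4⟩ := h
  obtain ⟨h6, h7, h8⟩ := hm.decided _ _ _ _ _ _ hv hdx
  rcases le_or_gt d τ with hdτ | hdτ
  · exact ⟨τ, d, t, post, h1, h2, h4, hdx, hdτ⟩
  · exact ⟨d, d, t, post', by omega, h6, by rw [h8.vers, h7], hdx, le_rfl⟩

open Classical in
-- Only `objSetHead` and a successful append add versions, and only a successful `tsCAS` assigns a
-- timestamp; all other instructions are `quiet`.
theorem Inv.mem_instr {k : ℕ} (h : E.Inv k) (hk : k < E.len) {p : P} (hlab : E.lab k = .instr p)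
    {i : ℕ} {op : Op V} (hcur : (E.ghost k).cur p = some (i, op)) {M' : Mem V} {l' : Loc V}
    (hI : Instr (E.cfg k).mem ((E.cfg k).loc p) M' l')
    (hcfg : E.cfg (k + 1) = ⟨M', Function.update (E.cfg k).loc p l'⟩) : E.MemInv (k + 1) := by
  have hm := h.mem
  have hL := h.loc p i op hcur
  have hpriv := h.priv p
  have hctor := h.ctor p
  have hMem : (E.cfg (k + 1)).mem = M' := by rw [hcfg]
  clear hcfg
  have hvq := fun h => vers_eq_of_published (E := E) hlab h
  have hve := fun o => vers_eq_of_instr (E := E) hlab o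
  have hdq := fun n => dec_eq_of_instr (E := E) hlab n
  have hi := (E.cur_spec hcur).1
  have hong := E.ongoing_of_cur hk hcur
  have hli := (E.cur_spec hcur).2.1
  generalize hl : (E.cfg k).loc p = l at *
  have quiet : (E.ghost k).published (E.cfg k) p = none →
      (E.ghost k).nextDec (E.cfg k) p = (E.ghost k).dec →
      (∀ o, ∀ v ∈ E.vers k o, M'.nodes v.node = (E.cfg k).mem.nodes v.node) →
      (∀ o O', M'.objs o = some O' → (E.cfg k).mem.objs o = some O' ∨
        (E.vers k o = [] ∧ O'.VHead = none ∧ ∃ t, (E.cfg k).mem.cams O'.S = some t)) →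
      E.MemInv (k + 1) := fun h1 h2 h3 h4 =>
    hm.frame hk (hvq h1) (fun n => by rw [hdq, h2]) (by rwa [hMem]) (by rwa [hMem])
  cases hI
  case objNew v s o ho =>
    refine quiet (by simp [Ghost.published, hl]) (by simp [Ghost.nextDec, hl])
      (fun _ _ _ => rfl) fun o' O' h' => ?_
    by_cases e : o' = o
    · subst e
      simp only [Function.update_self, Option.some.injEq] at h'
      subst h'
      cases hL with
      | objNew hs hu => exact .inr ⟨hm.obj_none _ ho, rfl, _, hs⟩
    · exact .inl (by simpa [Function.update_of_ne e] using h')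
  case objNode o n v hn =>
    refine quiet (by simp [Ghost.published, hl]) (by simp [Ghost.nextDec, hl])
      (fun o w hw => Function.update_of_ne ?_ _ _) fun o' O' h' => .inl h'
    rintro rfl
    obtain ⟨nx, h1⟩ := hm.node_of_mem hw
    rw [hn] at h1
    simp at h1
  case casNode o hd n b hn =>
    refine quiet (by simp [Ghost.published, hl]) (by simp [Ghost.nextDec, hl])
      (fun o w hw => Function.update_of_ne ?_ _ _) fun o' O' h' => .inl h'
    rintro rfl
    obtain ⟨nx, h1⟩ := hm.node_of_mem hw
    rw [hn] at h1
    simp at h1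
  case casDelete o n N hn =>
    refine quiet (by simp [Ghost.published, hl]) (by simp [Ghost.nextDec, hl])
      (fun o w hw => Function.update_of_ne ?_ _ _) fun o' O' h' => .inl h'
    exact (hpriv n rfl).2.1 o w hw
  case objSetHead o n O ho =>
    cases hL with
    | @objSetHead v s _ _ hs hu hn =>
      have hpub : (E.ghost k).published (E.cfg k) p = some (o, ⟨n, v, i⟩) := by
        simp [Ghost.published, hl, hcur, hn]
      have hnil := (hctor o rfl).1
      refine hm.publish hk (o := o) (v := ⟨n, v, i⟩) (O := O) ?_ ?_ ?_ ho hMem ?_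
        (hpriv n rfl).2.1 hu hi (fun _ => ⟨p, s, hli, hs⟩) ?_
      · rw [hve]; simp [Ghost.nextVers, hpub]
      · intro o' ho'
        rw [hve]; simp [Ghost.nextVers, hpub, Function.update_of_ne ho']
      · intro n'
        rw [hdq]; simp [Ghost.nextDec, hl]
      · simp only [hnil]; exact hn
      · intro w post hw
        rw [hnil] at hw
        simp at hw
  case casAppendSucc o hd n O ho hh =>
    cases hL with
    | @casAppend _ a b _ _ v hu hr hn hd' hv hab hn' =>
      have hpub : (E.ghost k).published (E.cfg k) p = some (o, ⟨n, b, i⟩) := by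
        simp [Ghost.published, hl, hcur, hn', ho, hh]
      obtain ⟨v', post, hv', hn''⟩ := hm.version_of_head ho hh
      obtain ⟨pre, post', hv''⟩ := List.append_of_mem hr.mem
      -- The CAS compares addresses only. Injectivity turns this into equality of versions, so the
      -- value of the current head is the one that was compared with `oldV`.
      obtain ⟨-, rfl, -⟩ := hm.node_inj _ _ [] _ _ _ _ _ hv' hv'' (hn''.trans hn.symm)
      refine hm.publish hk (o := o) (v := ⟨n, b, i⟩) (O := O) ?_ ?_ ?_ ho hMem ?_
        (hpriv n rfl).2.1 hu hi (fun hnil => ?_) ?_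
      · rw [hve]; simp [Ghost.nextVers, hpub]
      · intro o' ho'
        rw [hve]; simp [Ghost.nextVers, hpub, Function.update_of_ne ho']
      · intro n'
        rw [hdq]; simp [Ghost.nextDec, hl]
      · rw [hv']
        simpa [hn''] using hn'
      · rw [hv'] at hnil
        simp at hnil
      · intro w post'' hw
        rw [hv'] at hw
        cases hw
        refine ⟨by rwa [hn], by simpa [hv] using hab, ⟨p, by simpa [hv] using hli⟩, ?_⟩
        exact ⟨p, hd, O, hong, hlab, hl, ho, hh⟩
  case casAppendFail o hd n O ho hh =>
    exact quiet (by cases hc : (E.ghost k).cur p <;> simp [Ghost.published, hl, hc, ho, hh])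
      (by simp [Ghost.nextDec, hl]) (fun _ _ _ => rfl) fun _ _ h' => .inl h'
  case tsCASSucc o n t N hN hts =>
    cases hL with
    | tsCAS hn ha hlt hr =>
      obtain ⟨x, hx, rfl⟩ := hn
      obtain ⟨nx, h1⟩ := hm.node_of_mem hx
      rw [hN] at h1
      have hdn : E.dec k x.node = none := by
        cases h1
        simpa using hts
      refine hm.assign (hvq (by simp [Ghost.published, hl])) (n := x.node) ?_ ?_ hdn hN hMem hr hlt
      · rw [hdq]; simp [Ghost.nextDec, hl, hdn]
      · intro n' hn'
        rw [hdq]; simp [Ghost.nextDec, hl, hdn, Function.update_of_ne hn']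
  case tsCASFail o n t N hN hts =>
    cases hL with
    | tsCAS hn ha hlt hr =>
      obtain ⟨x, hx, rfl⟩ := hn
      obtain ⟨nx, h1⟩ := hm.node_of_mem hx
      rw [hN] at h1
      have hdn : E.dec k x.node ≠ none := by
        cases h1
        simpa using hts
      exact quiet (by simp [Ghost.published, hl]) (by simp [Ghost.nextDec, hl, hdn])
        (fun _ _ _ => rfl) fun _ _ h' => .inl h'
  all_goals
    exact quiet (by simp [Ghost.published, hl]) (by simp [Ghost.nextDec, hl])
      (fun _ _ _ => rfl) fun _ _ h' => .inl h'

/-! ### Ownership of unpublished nodes and objects -/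

/-- Nodes that are not yet in a version list remain private. -/
theorem Inv.priv_frame {k : ℕ} (h : E.Inv k) {p : P}
    (hother : ∀ q ≠ p, (E.cfg (k + 1)).loc q = (E.cfg k).loc q)
    (hv : ∀ o, ∀ v ∈ E.vers (k + 1) o, v ∈ E.vers k o ∨
      ((E.cfg k).loc p).priv = some v.node ∧ ((E.cfg (k + 1)).loc p).priv = none)
    (hn : ∀ n, (E.cfg k).mem.nodes n ≠ none → (E.cfg (k + 1)).mem.nodes n ≠ none ∨
      ((E.cfg k).loc p).priv = some n ∧ ((E.cfg (k + 1)).loc p).priv = none)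
    (hl : ((E.cfg (k + 1)).loc p).priv = none ∨
      ((E.cfg (k + 1)).loc p).priv = ((E.cfg k).loc p).priv ∨
      ∃ n, ((E.cfg (k + 1)).loc p).priv = some n ∧ (E.cfg k).mem.nodes n = none ∧
        (E.cfg (k + 1)).mem.nodes n ≠ none) :
    ∀ q n, ((E.cfg (k + 1)).loc q).priv = some n →
      (E.cfg (k + 1)).mem.nodes n ≠ none ∧ (∀ o, ∀ v ∈ E.vers (k + 1) o, v.node ≠ n) ∧
        ∀ q' ≠ q, ((E.cfg (k + 1)).loc q').priv ≠ some n := by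
  have own : ∀ n, ((E.cfg (k + 1)).loc p).priv = some n →
      (E.cfg (k + 1)).mem.nodes n ≠ none ∧ (∀ o, ∀ v ∈ E.vers (k + 1) o, v.node ≠ n) ∧
        ∀ q' ≠ p, ((E.cfg (k + 1)).loc q').priv ≠ some n := by
    intro n hpn
    have hv' : ∀ o, ∀ v ∈ E.vers (k + 1) o, v ∈ E.vers k o := by
      intro o v hvo
      rcases hv o v hvo with h1 | ⟨_, h1⟩
      · exact h1
      · rw [hpn] at h1; simp at h1
    rcases hl with h1 | h1 | ⟨n', h1, h2, h3⟩
    · rw [hpn] at h1; simp at h1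
    · rw [hpn] at h1
      obtain ⟨h2, h3, h4⟩ := h.priv p n h1.symm
      refine ⟨?_, fun o v hvo => h3 o v (hv' o v hvo), fun q hq => by rw [hother q hq]; exact h4 q hq⟩
      rcases hn n h2 with h5 | ⟨_, h5⟩
      · exact h5
      · rw [hpn] at h5; simp at h5
    · rw [hpn] at h1
      cases h1
      refine ⟨h3, fun o v hvo hvn => ?_, fun q hq hqn => ?_⟩
      · obtain ⟨nx, h4⟩ := h.mem.node_of_mem (hv' o v hvo)
        rw [hvn, h2] at h4
        simp at h4
      · rw [hother q hq] at hqn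
        exact (h.priv q n hqn).1 h2
  intro q n hqn
  by_cases hqp : q = p
  · subst hqp
    exact own n hqn
  · have hqn' := hqn
    rw [hother q hqp] at hqn
    obtain ⟨h2, h3, h4⟩ := h.priv q n hqn
    refine ⟨?_, fun o v hvo hvn => ?_, fun q' hq' hqn2 => ?_⟩
    · rcases hn n h2 with h5 | ⟨h5, _⟩
      · exact h5
      · exact absurd h5 (h4 p (Ne.symm hqp))
    · rcases hv o v hvo with h5 | ⟨h5, _⟩
      · exact h3 o v h5 hvn
      · rw [hvn] at h5
        exact h4 p (Ne.symm hqp) h5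
    · by_cases hq'p : q' = p
      · subst hq'p
        exact (own n hqn2).2.2 q hqp hqn'
      · rw [hother q' hq'p] at hqn2
        exact h4 q' hq' hqn2

/-- Objects under construction remain private. -/
theorem Inv.ctor_frame {k : ℕ} (h : E.Inv k) {p : P}
    (hother : ∀ q ≠ p, (E.cfg (k + 1)).loc q = (E.cfg k).loc q)
    (hv : ∀ o, E.vers (k + 1) o = E.vers k o ∨ E.vers k o ≠ [] ∨
      ((E.cfg k).loc p).ctor = some o ∧ ((E.cfg (k + 1)).loc p).ctor = none)
    (hn : ∀ o, (E.cfg k).mem.objs o ≠ none → (E.cfg (k + 1)).mem.objs o ≠ none)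
    (hl : ((E.cfg (k + 1)).loc p).ctor = none ∨
      ((E.cfg (k + 1)).loc p).ctor = ((E.cfg k).loc p).ctor ∨
      ∃ o, ((E.cfg (k + 1)).loc p).ctor = some o ∧ (E.cfg k).mem.objs o = none ∧
        (E.cfg (k + 1)).mem.objs o ≠ none ∧ E.vers (k + 1) o = []) :
    ∀ q o, ((E.cfg (k + 1)).loc q).ctor = some o →
      E.vers (k + 1) o = [] ∧ (E.cfg (k + 1)).mem.objs o ≠ none ∧
        ∀ q' ≠ q, ((E.cfg (k + 1)).loc q').ctor ≠ some o := by
  have own : ∀ o, ((E.cfg (k + 1)).loc p).ctor = some o →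
      E.vers (k + 1) o = [] ∧ (E.cfg (k + 1)).mem.objs o ≠ none ∧
        ∀ q' ≠ p, ((E.cfg (k + 1)).loc q').ctor ≠ some o := by
    intro o hpo
    rcases hl with h1 | h1 | ⟨o', h1, h2, h3, h4⟩
    · rw [hpo] at h1; simp at h1
    · rw [hpo] at h1
      obtain ⟨h2, h3, h4⟩ := h.ctor p o h1.symm
      refine ⟨?_, hn o h3, fun q hq => by rw [hother q hq]; exact h4 q hq⟩
      rcases hv o with h5 | h5 | ⟨_, h5⟩
      · rw [h5, h2]
      · exact absurd h2 h5
      · rw [hpo] at h5; simp at h5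
    · rw [hpo] at h1
      cases h1
      refine ⟨h4, h3, fun q hq hqo => ?_⟩
      rw [hother q hq] at hqo
      exact (h.ctor q o hqo).2.1 h2
  intro q o hqo
  by_cases hqp : q = p
  · subst hqp
    exact own o hqo
  · have hqo' := hqo
    rw [hother q hqp] at hqo
    obtain ⟨h2, h3, h4⟩ := h.ctor q o hqo
    refine ⟨?_, hn o h3, fun q' hq' hqo2 => ?_⟩
    · rcases hv o with h5 | h5 | ⟨h5, _⟩
      · rw [h5, h2]
      · exact absurd h2 h5
      · exact absurd h5 (h4 p (Ne.symm hqp))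
    · by_cases hq'p : q' = p
      · subst hq'p
        exact (own o hqo2).2.2 q hqp hqo'
      · rw [hother q' hq'p] at hqo2
        exact h4 q' hq' hqo2

theorem AfterTS.priv_ctor {k : ℕ} {p : P} {i c : ℕ} {op : Op V} {o n : ℕ} {l : Loc V}
    (h : E.AfterTS k p i c op o n l) : l.priv = none ∧ l.ctor = none := by
  cases h <;> exact ⟨rfl, rfl⟩

theorem published_spec {k : ℕ} {p : P} {o : ℕ} {v : Version V}
    (h : (E.ghost k).published (E.cfg k) p = some (o, v)) :
    (E.cfg k).loc p = .objSetHead o v.node ∨ ∃ head O, (E.cfg k).loc p = .casAppend o head v.node ∧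
      (E.cfg k).mem.objs o = some O ∧ O.VHead = some head := by
  unfold Ghost.published at h
  split at h
  · rename_i h1 _
    simp only [Option.map_eq_some_iff, Prod.mk.injEq] at h
    obtain ⟨N, _, rfl, rfl⟩ := h
    exact .inl h1
  · rename_i h1 _
    split_ifs at h with h2
    simp only [Option.map_eq_some_iff, Prod.mk.injEq] at h
    obtain ⟨N, _, rfl, rfl⟩ := h
    obtain ⟨O, h3, h4⟩ := Option.bind_eq_some_iff.1 h2
    exact .inr ⟨_, O, h1, h3, h4⟩
  · simp at h

open Classical in
-- A newly allocated address was free, hence held by no other process. A process that publishes or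
-- deletes its private node gives it up in the same instruction, and likewise for an object whose
-- first head is set.
theorem Inv.priv_ctor_instr {k : ℕ} (h : E.Inv k) {p : P} (hlab : E.lab k = .instr p)
    {i : ℕ} {op : Op V} (hcur : (E.ghost k).cur p = some (i, op)) {M' : Mem V} {l' : Loc V}
    (hI : Instr (E.cfg k).mem ((E.cfg k).loc p) M' l')
    (hcfg : E.cfg (k + 1) = ⟨M', Function.update (E.cfg k).loc p l'⟩) :
    (∀ q n, ((E.cfg (k + 1)).loc q).priv = some n →
      (E.cfg (k + 1)).mem.nodes n ≠ none ∧ (∀ o, ∀ v ∈ E.vers (k + 1) o, v.node ≠ n) ∧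
        ∀ q' ≠ q, ((E.cfg (k + 1)).loc q').priv ≠ some n) ∧
    (∀ q o, ((E.cfg (k + 1)).loc q).ctor = some o →
      E.vers (k + 1) o = [] ∧ (E.cfg (k + 1)).mem.objs o ≠ none ∧
        ∀ q' ≠ q, ((E.cfg (k + 1)).loc q').ctor ≠ some o) := by
  have hMem : (E.cfg (k + 1)).mem = M' := by rw [hcfg]
  have hloc : (E.cfg (k + 1)).loc p = l' := by simp [hcfg]
  have hL := h.loc p i op hcur
  have hlive : ∀ {o head n O}, (E.cfg k).loc p = .casAppend o head n →
      (E.cfg k).mem.objs o = some O → O.VHead = some head → E.vers k o ≠ [] ∧ l'.priv = none := by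
    intro o head n O h1 h2 h3
    refine ⟨?_, ?_⟩
    · obtain ⟨v, post, h4, -⟩ := h.mem.version_of_head h2 h3
      simp [h4]
    · rw [h1] at hI
      cases hI with
      | casAppendSucc => rfl
      | casAppendFail h4 h5 =>
        rw [h2] at h4
        cases h4
        exact absurd h3 h5
  have hset : ∀ {o n}, (E.cfg k).loc p = .objSetHead o n → l'.priv = none ∧ l'.ctor = none := by
    intro o n h1
    rw [h1] at hI
    cases hI
    exact ⟨rfl, rfl⟩
  have hother : ∀ q ≠ p, (E.cfg (k + 1)).loc q = (E.cfg k).loc q := by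
    intro q hq
    rw [hcfg]
    exact Function.update_of_ne hq _ _
  constructor
  · refine h.priv_frame hother ?_ ?_ ?_
    · intro o v hv
      rcases E.vers_succ k o with h1 | ⟨q, w, h1, h2, h3⟩
      · left; rwa [h1] at hv
      · rw [hlab] at h1
        cases h1
        rw [h3] at hv
        rcases List.mem_cons.1 hv with rfl | hv
        · right
          rw [hloc]
          rcases published_spec h2 with h4 | ⟨hd, O, h4, h5, h6⟩
          · exact ⟨by rw [h4]; rfl, (hset h4).1⟩
          · exact ⟨by rw [h4]; rfl, (hlive h4 h5 h6).2⟩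
        · exact .inl hv
    · rw [hMem, hloc]
      clear hlive hset hother hloc hMem hcfg
      generalize (E.cfg k).loc p = l at *
      intro n hn
      cases hI <;> try exact .inl hn
      case objNode n' _ _ =>
        left
        by_cases e : n = n'
        · subst e; simp
        · simpa [Function.update_of_ne e] using hn
      case casNode n' _ _ =>
        left
        by_cases e : n = n'
        · subst e; simp
        · simpa [Function.update_of_ne e] using hn
      case tsCASSucc n' _ _ _ _ =>
        left
        by_cases e : n = n'
        · subst e; simp
        · simpa [Function.update_of_ne e] using hn
      case casDelete n' _ _ =>
        by_cases e : n = n'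
        · subst e; exact .inr ⟨rfl, rfl⟩
        · left; simpa [Function.update_of_ne e] using hn
    · rw [hMem, hloc]
      clear hlive hset hother hloc hMem hcfg
      generalize (E.cfg k).loc p = l at *
      cases hI <;> try exact .inl rfl
      case tsCheckValid => cases hL with | tsCheck _ h => exact .inl h.priv_ctor.1
      case tsCASSucc => cases hL with | tsCAS _ h => exact .inl h.priv_ctor.1
      case tsCASFail => cases hL with | tsCAS _ h => exact .inl h.priv_ctor.1
      case objNode n v hn => exact .inr (.inr ⟨n, rfl, hn, by simp⟩)
      case casNode n v hn => exact .inr (.inr ⟨n, rfl, hn, by simp⟩)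
      case casAppendFail => exact .inr (.inl rfl)
  · refine h.ctor_frame hother ?_ ?_ ?_
    · intro o
      rcases E.vers_succ k o with h1 | ⟨q, w, h1, h2, h3⟩
      · exact .inl h1
      · rw [hlab] at h1
        cases h1
        right
        rw [hloc]
        rcases published_spec h2 with h4 | ⟨hd, O, h4, h5, h6⟩
        · exact .inr ⟨by rw [h4]; rfl, (hset h4).2⟩
        · exact .inl (hlive h4 h5 h6).1
    · intro o ho
      rw [hMem]
      obtain ⟨O, hO⟩ := Option.ne_none_iff_exists'.1 ho
      obtain ⟨O', hO', _⟩ := hI.objs hO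
      simp [hO']
    · rw [hMem, hloc]
      have hvq := fun h => vers_eq_of_published (E := E) hlab h
      clear hlive hset hother hloc hMem hcfg
      generalize hl : (E.cfg k).loc p = l at *
      cases hI <;> try exact .inl rfl
      case tsCheckValid => cases hL with | tsCheck _ h => exact .inl h.priv_ctor.2
      case tsCASSucc => cases hL with | tsCAS _ h => exact .inl h.priv_ctor.2
      case tsCASFail => cases hL with | tsCAS _ h => exact .inl h.priv_ctor.2
      case objNew v s o ho =>
        refine .inr (.inr ⟨o, rfl, ho, by simp, ?_⟩)
        rw [hvq (by simp [Ghost.published, hl])]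
        exact h.mem.obj_none o ho
      case objNode => exact .inr (.inl rfl)

/-! ### Preservation of the local assertions -/

open Classical in
theorem Inv.loc_instr {k : ℕ} (h : E.Inv k) (hk : k < E.len) {p : P} (hlab : E.lab k = .instr p)
    {i : ℕ} {op : Op V} (hcur : (E.ghost k).cur p = some (i, op)) {M' : Mem V} {l' : Loc V}
    (hI : Instr (E.cfg k).mem ((E.cfg k).loc p) M' l')
    (hcfg : E.cfg (k + 1) = ⟨M', Function.update (E.cfg k).loc p l'⟩) :
    E.LocOK (k + 1) p i op l' := by
  have hm := h.mem
  have hm' := h.mem_instr hk hlab hcur hI hcfg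
  have hL := h.loc p i op hcur
  have hMem : (E.cfg (k + 1)).mem = M' := by rw [hcfg]
  clear hcfg
  have hvq := fun h => vers_eq_of_published (E := E) hlab h
  have hve := fun o => vers_eq_of_instr (E := E) hlab o
  have hdq := fun n => dec_eq_of_instr (E := E) hlab n
  obtain ⟨hi, hli, -⟩ := E.cur_spec hcur
  have hong := E.ongoing_of_cur hk hcur
  have hk1 := Nat.le_succ k
  have hk2 := Nat.lt_succ_self k
  have hcnt : (E.ghost (k + 1)).cnt p = (E.ghost k).cnt p + 1 := by simp [ghost_of_instr hlab]
  have hlast : (E.ghost (k + 1)).last p = k := by simp [ghost_of_instr hlab]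
  have hU : (E.ghost k).published (E.cfg k) p = none → E.Unpub k i → E.Unpub (k + 1) i := by
    intro h1 h2 o v hv
    rw [hvq h1] at hv
    exact h2 o v hv
  have hA : ∀ {c op o n l}, (E.ghost k).published (E.cfg k) p = none →
      E.AfterTS k p i c op o n l → E.AfterTS (k + 1) p i (c + 1) op o n l :=
    fun h1 h2 => h2.mono hk1 (hU h1) (by omega) (by omega)
  have tsOf : ∀ {o n N}, (∃ v ∈ E.vers k o, v.node = n) → (E.cfg k).mem.nodes n = some N →
      N.ts = (E.dec k n).map Prod.snd := by
    rintro o n N ⟨v, hv, rfl⟩ hN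
    obtain ⟨nx, h1⟩ := hm.node_of_mem hv
    rw [hN] at h1
    cases h1
    rfl
  have valOf : ∀ {o v n N}, v ∈ E.vers k o → v.node = n → (E.cfg k).mem.nodes n = some N →
      N.val = v.val := by
    rintro o v n N hv rfl hN
    obtain ⟨nx, h1⟩ := hm.node_of_mem hv
    rw [hN] at h1
    cases h1
    rfl
  have hreads : ∀ {o n O}, (E.cfg k).mem.objs o = some O → O.VHead = some n →
      (E.ghost k).published (E.cfg k) p = none →
      ∃ v post, E.vers k o = v :: post ∧ E.vers (k + 1) o = v :: post ∧ v.node = n ∧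
        E.HeadRead i (k + 1) o v ∧ ∃ v ∈ E.vers (k + 1) o, v.node = n := by
    intro o n O h1 h2 h3
    obtain ⟨v, post, h4, h5⟩ := hm.version_of_head h1 h2
    have h6 := (hvq h3 o).trans h4
    exact ⟨v, post, h4, h6, h5, ⟨k, post, hi, hk2, h4, h6⟩, v, by rw [h6]; simp, h5⟩
  generalize hl : (E.cfg k).loc p = l at *
  -- Running `initTS` on the head suffices to have a timestamp in `x`: either `x` is the head, or it
  -- lies below the head and `tail` applies.
  have hheadTS : ∀ {o n O pre x post}, (E.cfg k).mem.objs o = some O → O.VHead = some n →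
      E.vers k o = pre ++ x :: post → x.node = n ∨ E.dec (k + 1) x.node ≠ none := by
    intro o n O pre x post h1 h2 h3
    obtain ⟨v, post', h4, h5⟩ := hm.version_of_head h1 h2
    cases pre with
    | nil =>
      rw [h4] at h3
      simp only [List.nil_append, List.cons.injEq] at h3
      exact .inl (h3.1 ▸ h5)
    | cons y pre => exact .inr (dec_ne_mono (hm.tail _ _ _ _ h3 (by simp)) hk1)
  cases hL with
  | camNew =>
    cases hI with
    | camNew hs => exact .camRet hi hk2 ⟨p, hong, hlab, hl, hs, by rw [hMem]; simp⟩
  | camRet => cases hI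
  | objNew hs hu =>
    cases hI with
    | objNew ho =>
      exact .objNode ⟨_, by rw [hMem]; exact Function.update_self .., rfl⟩
        (hU (by simp [Ghost.published, hl]) hu)
  | objNode hs hu =>
    cases hI with
    | objNode hn =>
      exact .objSetHead (hs.mono hk1 hk) (hU (by simp [Ghost.published, hl]) hu)
        (by rw [hMem]; exact Function.update_self ..)
  | @objSetHead v s o n hs hu hn =>
    cases hI with
    | objSetHead ho =>
      have hpub : (E.ghost k).published (E.cfg k) p = some (o, ⟨n, v, i⟩) := by
        simp [Ghost.published, hl, hcur, hn]
      exact .objInit (x := ⟨n, v, i⟩) (by rw [hve]; simp [Ghost.nextVers, hpub]) rfl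
  | objInit hx ho =>
    cases hI with
    | objInit hO hn =>
      obtain ⟨v, post, -, -, -, -, h2⟩ := hreads hO hn (by simp [Ghost.published, hl])
      obtain ⟨pre, post, hx'⟩ := List.append_of_mem hx
      exact .tsCheck h2 (.ctor (E.vers_mono hk1 hx) ho (hheadTS hO hn hx'))
  | objRet => cases hI
  | tsCheck hn ha =>
    have ha' := hA (by simp [Ghost.published, hl]) ha
    cases hI with
    | tsCheckTBD hN hts => exact .tsRead (exists_node_mono hn hk1) ha'
    | tsCheckValid hN hts =>
      refine ha'.locOK hm' (dec_ne_mono ?_ hk1) (by omega)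
      rw [tsOf hn hN] at hts
      simpa using hts
  | tsRead hn ha =>
    have ha' := hA (by simp [Ghost.published, hl]) ha
    cases hI with
    | tsRead hO ht =>
      refine .tsCAS (exists_node_mono hn hk1) ha' (by rw [hlast]; omega) ?_
      rw [hlast]
      exact ⟨⟨p, _, hlab, hl⟩, ⟨_, ⟨_, hO, rfl⟩, ht⟩, hvq (by simp [Ghost.published, hl]) _, hn⟩
  | tsCAS hn ha hlt hr =>
    have ha' := hA (by simp [Ghost.published, hl]) ha
    cases hI with
    | tsCASSucc hN hts =>
      refine ha'.locOK hm' ?_ (by omega)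
      rw [tsOf hn hN] at hts
      rw [hdq]
      simp only [Option.map_eq_none_iff] at hts
      simp [Ghost.nextDec, hl, hts]
    | tsCASFail hN hts =>
      refine ha'.locOK hm' (dec_ne_mono ?_ hk1) (by omega)
      rw [tsOf hn hN] at hts
      simpa using hts
  | snapRead hs =>
    cases hI with
    | snapRead hs' => exact .snapCAS hi hk2 hs'
  | snapCAS hiτ hτ hs =>
    cases hI with
    | snapCASSucc hs' => exact .snapRet hi hk2 ⟨hs', by rw [hMem]; simp⟩
    | snapCASFail hs' hne =>
      -- The CAS fails because the timestamp has moved past the value read at `τ`; the increment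
      -- away from this value happened in between.
      obtain ⟨τ', h1, h2, h3⟩ := E.exists_bump hτ.le hk.le hs hs'
        (lt_of_le_of_ne (E.cams_le hτ.le hk.le hs hs') hne.symm)
      exact .snapRet (by omega) (by omega) h3
  | snapRet => cases hI
  | readHead hne =>
    cases hI with
    | readHead hO hn =>
      obtain ⟨v, post, -, -, h1, h2, h3⟩ := hreads hO hn (by simp [Ghost.published, hl])
      exact .tsCheck h3 (.read h2 h1)
  | readVal hr hn hd =>
    cases hI with
    | readVal hN =>
      exact .readRet ((hr.readPoint hm (by rwa [hn])).mono hk1) (valOf hr.mem hn hN).symm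
  | readRet => cases hI
  | casHead hne hu =>
    cases hI with
    | casHead hO hn =>
      have hpub : (E.ghost k).published (E.cfg k) p = none := by simp [Ghost.published, hl]
      obtain ⟨v, post, -, -, h1, h2, h3⟩ := hreads hO hn hpub
      exact .tsCheck h3 (.cas (hU hpub hu) h2 h1)
  | casCmpVal hu hr hn hd =>
    have hu' := hU (by simp [Ghost.published, hl]) hu
    cases hI with
    | casCmpValNe hN hv =>
      rw [valOf hr.mem hn hN] at hv
      exact .casRet hu' ((hr.readPoint hm (by rwa [hn])).mono hk1) (by simpa using hv) (by simp)
    | casCmpValEq hN hv =>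
      rw [valOf hr.mem hn hN] at hv
      exact .casCmpNew hu' (hr.mono hk1) hn (dec_ne_mono hd hk1) hv
  | casCmpNew hu hr hn hd hv =>
    have hu' := hU (by simp [Ghost.published, hl]) hu
    cases hI with
    | casCmpNewEq hab =>
      exact .casRet hu' ((hr.readPoint hm (by rwa [hn])).mono hk1) (by simpa using hv)
        (fun _ => hab)
    | casCmpNewNe hab => exact .casNode hu' (hr.mono hk1) hn (dec_ne_mono hd hk1) hv hab
  | casNode hu hr hn hd hv hab =>
    have hu' := hU (by simp [Ghost.published, hl]) hu
    cases hI with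
    | casNode hN =>
      exact .casAppend hu' (hr.mono hk1) hn (dec_ne_mono hd hk1) hv hab
        (by rw [hMem]; exact Function.update_self ..)
  | @casAppend o a b n n' v hu hr hn hd hv hab hn' =>
    cases hI with
    | casAppendSucc hO hh =>
      have hpub : (E.ghost k).published (E.cfg k) p = some (o, ⟨n', b, i⟩) := by
        simp [Ghost.published, hl, hcur, hn', hO, hh]
      have hx : (⟨n', b, i⟩ : Version V) ∈ E.vers (k + 1) o := by
        rw [hve]; simp [Ghost.nextVers, hpub]
      exact .tsCheck ⟨_, hx, rfl⟩ (.casTrue hx rfl rfl)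
    | casAppendFail hO hh =>
      have hu' := hU (by
        simp only [Ghost.published, hl, hcur]
        simp [hO, hh]) hu
      obtain ⟨τ, post, h1, h2, h3, h4⟩ := hr
      obtain ⟨pre, h5⟩ := E.vers_suffix h2.le o
      -- `pre` holds the versions added since `v` was seen as the head. If there were none, the CAS
      -- would have succeeded; otherwise the last entry of `pre` was put directly on top of `v`.
      rcases List.eq_nil_or_concat pre with rfl | ⟨pre', x, rfl⟩
      · rw [(hm.obj_some o _ hO).1, ← h5, h3] at hh
        simp [hn] at hh
      · exact .casDelete (x := x) hu'
          ⟨τ, v, pre', post, h1, by omega, h3, hv, by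
            rw [hvq (by simp [Ghost.published, hl, hcur, hO, hh]), ← h5, h3]; simp⟩
  | casDelete hu ho =>
    cases hI with
    | casDelete hN => exact .casInit (hU (by simp [Ghost.published, hl]) hu) (ho.mono hk1)
  | casInit hu ho =>
    cases hI with
    | casInit hO hn =>
      have hpub : (E.ghost k).published (E.cfg k) p = none := by simp [Ghost.published, hl]
      obtain ⟨v, post, -, -, h1, -, h3⟩ := hreads hO hn hpub
      refine .tsCheck h3 (.casFalse (hU hpub hu) (ho.mono hk1) ?_)
      obtain ⟨τ, h, pre, post, -, -, -, -, h5⟩ := ho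
      exact hheadTS hO hn h5
  | casRet => cases hI
  | casRetTrue => cases hI
  | rsHead hold hc =>
    cases hI with
    | rsHead hO hn =>
      obtain ⟨v, post, h1, h2, h3, h4, h5⟩ := hreads hO hn (by simp [Ghost.published, hl])
      refine .tsCheck h5 (.snap ⟨k, post, hi, hk2, ⟨p, hong, hlab, hl⟩, h1, by simp, ?_⟩ h3
        (by omega) (by omega))
      rw [h1] at hold
      exact hold.mono hk1
  | @rsWhile o ts n pre v hs hn hd hc hc' =>
    have hdt : ∀ {N t}, (E.cfg k).mem.nodes n = some N → N.ts = some t →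
        ∃ d, E.dec (k + 1) n = some (d, t) := by
      intro N t hN ht
      rw [tsOf ⟨v, hs.mem, hn⟩ hN] at ht
      obtain ⟨⟨d, t'⟩, h1, rfl⟩ := Option.map_eq_some_iff.1 ht
      exact ⟨d, E.dec_mono hk1 h1⟩
    cases hI with
    | rsWhileTrue hN ht hgt =>
      obtain ⟨d, h1⟩ := hdt hN ht
      exact .rsNext (hs.mono hk1) hn h1 hgt (by omega) (by omega)
    | rsWhileFalse hN ht hle =>
      obtain ⟨d, h1⟩ := hdt hN ht
      exact .rsVal (hs.mono hk1) hn h1 hle (by omega) (by omega)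
  | @rsNext o ts n pre d t v hs hn hd ht hc hc' =>
    cases hI with
    | @rsNext _ _ n' N hN hnx =>
      obtain ⟨m, post, h1, h2, h3, h4, h5, h6⟩ := hs
      obtain ⟨pre', h7⟩ := E.vers_suffix h2.le o
      rw [h4, ← List.append_assoc] at h7
      have h8 := hm.node o _ v post h7.symm
      rw [hn, hN] at h8
      cases h8
      cases post with
      | nil => simp at hnx
      | cons v' post' =>
        simp only [List.head?_cons, Option.map_some, Option.some.injEq] at hnx
        refine .rsWhile (pre := pre ++ [v]) (v := v')
          (Scan.mono ⟨m, post', h1, h2, h3, by simp [h4], ?_, ?_⟩ hk1) hnx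
          (dec_ne_mono ?_ hk1) (by simp; omega) (by simp; omega)
        · intro w hw
          rcases List.mem_append.1 hw with hw | hw
          · exact h5 w hw
          · rw [List.mem_singleton.1 hw, hn]
            exact ⟨d, t, hd, ht⟩
        -- The version just rejected is too new, so the old version promised by `HasOld` lies
        -- further down the list.
        · obtain ⟨w, hw, d', t', h9, h10⟩ := h6
          rcases List.mem_cons.1 hw with rfl | hw
          · rw [hn, hd] at h9
            cases h9
            omega
          · exact ⟨w, hw, d', t', h9, h10⟩
        · rw [← hnx]
          exact hm.tail o (pre' ++ pre ++ [v]) v' post' (by simp [← h7]) (by simp)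
  | rsVal hs hn hd ht hc hc' =>
    cases hI with
    | rsVal hN =>
      exact .rsRet (hs.mono hk1) (valOf hs.mem hn hN).symm (by rw [hn]; exact E.dec_mono hk1 hd)
        ht (by omega) (by omega)
  | rsRet => cases hI

/-! ### The invariant at all times -/

theorem Inv.zero : E.Inv 0 where
  mem := by constructor <;> simp [vers, dec, ghost, E.start, Config.initial]
  idle := by simp [E.start, Config.initial]
  loc := by simp [ghost]
  priv := by simp [E.start, Config.initial, Loc.priv]
  ctor := by simp [E.start, Config.initial, Loc.ctor]

theorem Inv.exists_cur {k : ℕ} (h : E.Inv k) {p : P} (hp : (E.cfg k).loc p ≠ .idle) :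
    ∃ i op, (E.ghost k).cur p = some (i, op) := by
  cases hc : (E.ghost k).cur p with
  | none => exact absurd (h.idle p hc) hp
  | some x => exact ⟨x.1, x.2, rfl⟩

theorem LocOK.ne_idle {k : ℕ} {p : P} {i : ℕ} {op : Op V} {l : Loc V}
    (h : E.LocOK k p i op l) : l ≠ .idle := by
  rintro rfl
  cases h

/-- The invariant enters because a process with a current operation is not idle and so cannot invoke
another one. -/
theorem cur_of_pending {k : ℕ} (hk : k ≤ E.len) (hI : ∀ j < k, E.Inv j) {p : P} {i : ℕ} {op : Op V}
    (hi : E.lab i = .inv p op) (hik : i < k) (hr : ∀ m r, i < m → m < k → E.lab m ≠ .res p r) :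
    (E.ghost k).cur p = some (i, op) := by
  induction hik with
  | refl => simp [ghost, hi, Ghost.next]
  | @step m him ih =>
    have him' : i < m := him
    have hc := ih (by omega) (fun j hj => hI j (by omega)) (fun j r h1 h2 => hr j r h1 (by omega))
    by_cases hp : (E.lab m).proc = p
    · cases hl : E.lab m with
      | inv q op' =>
        rw [hl] at hp
        simp only [Label.proc] at hp
        subst hp
        rcases E.step_cases (k := m) (by omega) with ⟨q', op'', h1, h2, -⟩ | ⟨_, _, _, h1, -⟩ |
          ⟨_, _, h1, -⟩
        · rw [hl] at h1
          cases h1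
          exact absurd h2 ((hI m (by omega)).loc _ _ _ hc).ne_idle
        · rw [hl] at h1; cases h1
        · rw [hl] at h1; cases h1
      | res q r =>
        rw [hl] at hp
        simp only [Label.proc] at hp
        subst hp
        exact absurd hl (hr m r him' (by omega))
      | instr q =>
        rw [ghost, hl]
        exact hc
    · rw [Nat.succ_eq_add_one, (E.ghost_step_other hp).1, hc]

theorem locOK_of_respondsAt {b : ℕ} (hI : ∀ j ≤ b, E.Inv j) {i : ℕ} {op : Op V} {r : Resp V}
    (hi : E.Invoked i op) (hr : E.RespondsAt i b r) :
    ∃ p, (E.ghost b).cur p = some (i, op) ∧ E.LocOK b p i op (.ret r) := by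
  obtain ⟨p, ⟨⟨op', h1⟩, h2, h3, h4⟩, h5⟩ := hr
  obtain ⟨_, q, h6⟩ := hi
  rw [h1] at h6
  cases h6
  have hc := cur_of_pending h3.le (fun j hj => hI j hj.le) h1 h2 h4
  refine ⟨p, hc, ?_⟩
  have hL := (hI b le_rfl).loc _ _ _ hc
  rcases E.step_cases h3 with ⟨_, _, h, -⟩ | ⟨_, _, _, h, -⟩ | ⟨q, r', h, h', -⟩
  · rw [h5] at h; cases h
  · rw [h5] at h; cases h
  · rw [h5] at h
    cases h
    rwa [h'] at hL

/-- The version in question is the one added by the constructor itself, which returns only after its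
timestamp has been set. -/
theorem exists_version_of_created {b : ℕ} (hI : ∀ j ≤ b, E.Inv j) {i o s : ℕ} {v : V}
    (hi : E.Invoked i (.newVCAS v s)) (hr : E.RespondsAt i b (.obj o)) :
    ∃ x ∈ E.vers b o, E.HasCam b o s ∧ ∃ d t, d < b ∧ E.dec b x.node = some (d, t) ∧
      (E.cfg d).mem.cams s = some t := by
  obtain ⟨p, hc, hL⟩ := locOK_of_respondsAt hI hi hr
  obtain ⟨q, ⟨_, -, hb, -⟩, -⟩ := hr
  have hlab := (E.cur_spec hc).2.1
  have hm := (hI b le_rfl).mem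
  cases hL with
  | @objRet _ _ _ x hx ho hd =>
    obtain ⟨pre, post, hx'⟩ := List.append_of_mem hx
    have hcam : E.HasCam b o s := by
      cases post with
      | nil =>
        obtain ⟨p', s', h1, h2⟩ := hm.first _ _ _ hx'
        rw [ho, hlab] at h1
        cases h1
        exact h2
      | cons w post =>
        obtain ⟨-, ⟨p', h1⟩, -⟩ := hm.later _ _ _ _ _ hx'
        rw [ho, hlab] at h1
        cases h1
    obtain ⟨⟨d, t⟩, hd⟩ := Option.ne_none_iff_exists'.1 hd
    obtain ⟨h1, -, h2⟩ := hm.decided _ _ _ _ _ _ hx' hd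
    obtain ⟨s', h3, h4⟩ := h2.ts
    obtain rfl := (h3.mono h1.le hb.le).unique hcam
    exact ⟨x, hx, hcam, d, t, h1, hd, h4⟩

/-- The object was constructed before the snapshot was invoked, so a timestamp in its list was read
before the camera left the value `ts`. That version guarantees that the search of `readSnapshot`
ends before `NULL`. -/
theorem snapshot_spec (hpre : E.RespectsPreconditions) {k o ts : ℕ} (hI : ∀ j < k, E.Inv j)
    (hk : E.Invoked k (.readSnapshot o ts)) :
    ∃ s a b τ, E.Invoked a (.takeSnapshot s) ∧ E.RespondsAt a b (.handle ts) ∧ b < k ∧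
      a < τ ∧ τ < b ∧ E.Bump τ s ts ∧ E.HasCam a o s ∧ ∃ x ∈ E.vers a o, ∃ d t, d < a ∧
        E.dec a x.node = some (d, t) ∧ t ≤ ts := by
  obtain ⟨v, s, a, b, h1, h2, h3, i', b', h4, h5, h6⟩ := hpre.snapshot k o ts hk
  have h1a := h1.1
  obtain ⟨p, hc, hL⟩ := locOK_of_respondsAt (fun j hj => hI j (by omega)) h1 h2
  have hab := (E.cur_spec hc).1
  obtain ⟨x, hx, hcam, d, t, h7, h8, h9⟩ :=
    exists_version_of_created (fun j hj => hI j (by omega)) h4 h5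
  have hb : b < E.len := by
    obtain ⟨_, ⟨_, _, hb, _⟩, _⟩ := h2
    exact hb
  cases hL with
  | @snapRet _ _ τ h10 h11 h12 =>
    exact ⟨s, a, b, τ, h1, h2, h3, h10, h11, h12, hcam.mono h6.le (by omega), x,
      E.vers_mono h6.le hx, d, t, by omega, E.dec_mono h6.le h8,
      E.cams_le (by omega) (by omega) h9 h12.1⟩

theorem locOK_start (hpre : E.RespectsPreconditions) {k : ℕ} (hk : k < E.len)
    (hI : ∀ j ≤ k, E.Inv j) {p : P} {op : Op V} (hl : E.lab k = .inv p op) :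
    E.LocOK (k + 1) p k op op.start := by
  have hm := (hI k le_rfl).mem
  have hk1 := Nat.le_succ k
  have hv : ∀ o, E.vers (k + 1) o = E.vers k o := fun o => by simp [vers, ghost, hl, Ghost.next]
  have hcnt : (E.ghost (k + 1)).cnt p = 0 := by simp [ghost, hl, Ghost.next]
  have hU : E.Unpub (k + 1) k := by
    intro o v hvo
    rw [hv] at hvo
    exact (hm.op_lt o v hvo).ne
  have hinv : E.Invoked k op := ⟨hk, p, hl⟩
  have hcams : ∀ s, E.ReturnedBefore .newCamera (.cam s) k →
      ∃ t, (E.cfg (k + 1)).mem.cams s = some t := by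
    rintro s ⟨i, b, h1, h2, h3⟩
    obtain ⟨q, hc, hL⟩ := locOK_of_respondsAt (fun j hj => hI j (by omega)) h1 h2
    cases hL with
    | @camRet _ τ h4 h5 h6 =>
      obtain ⟨_, -, -, -, -, h7⟩ := h6
      obtain ⟨t, h8⟩ := Option.ne_none_iff_exists'.1 h7
      obtain ⟨t', h9, -⟩ := E.cams_mono (k' := k + 1) (by omega) (by omega) h8
      exact ⟨t', h9⟩
  have hobjs : ∀ o, (∃ v s, E.ReturnedBefore (.newVCAS v s) (.obj o) k) →
      E.vers (k + 1) o ≠ [] := by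
    rintro o ⟨v, s, i, b, h1, h2, h3⟩
    obtain ⟨x, hx, -⟩ := exists_version_of_created (fun j hj => hI j (by omega)) h1 h2
    exact List.ne_nil_of_mem (E.vers_mono (k' := k + 1) (by omega) hx)
  cases op with
  | newCamera => exact .camNew
  | newVCAS v s =>
    obtain ⟨t, ht⟩ := hcams s (hpre.camera k s (.inr ⟨v, hinv⟩))
    exact .objNew ht hU
  | takeSnapshot s =>
    obtain ⟨t, ht⟩ := hcams s (hpre.camera k s (.inl hinv))
    exact .snapRead ht
  | vRead o => exact .readHead (hobjs o (hpre.object k o (.inl hinv)))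
  | vCAS o a b => exact .casHead (hobjs o (hpre.object k o (.inr ⟨a, b, hinv⟩))) hU
  | readSnapshot o ts =>
    obtain ⟨s, a, b, τ, -, -, h3, h4, h5, -, -, x, hx, d, t, -, h6, h7⟩ :=
      snapshot_spec hpre (fun j hj => hI j hj.le) hinv
    exact .rsHead ⟨x, E.vers_mono (by omega) hx, d, t, E.dec_mono (by omega) h6, h7⟩ hcnt

open Classical in
-- All earlier instances of the invariant are needed, since the preconditions speak of past
-- responses, whose meaning is given by `LocOK` at the time of the response.
theorem Inv.succ (hpre : E.RespectsPreconditions) {k : ℕ} (hk : k < E.len)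
    (hI : ∀ j ≤ k, E.Inv j) : E.Inv (k + 1) := by
  have h := hI k le_rfl
  have others : ∀ p i op, (E.lab k).proc ≠ p → (E.ghost (k + 1)).cur p = some (i, op) →
      (∀ n, ((E.cfg k).loc p).priv = some n →
        (E.cfg (k + 1)).mem.nodes n = (E.cfg k).mem.nodes n) →
      E.LocOK (k + 1) p i op ((E.cfg (k + 1)).loc p) := by
    intro p i op hp hc hN
    rw [(E.ghost_step_other hp).1] at hc
    rw [E.loc_step hk hp]
    exact (h.loc p i op hc).frame hk (unpub_succ hc hp) hN hp
  have idle_others : ∀ p, (E.lab k).proc ≠ p → (E.ghost (k + 1)).cur p = none →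
      (E.cfg (k + 1)).loc p = .idle := by
    intro p hp hc
    rw [(E.ghost_step_other hp).1] at hc
    rw [E.loc_step hk hp]
    exact h.idle p hc
  -- events that do not change the shared memory
  have silent : ∀ p, (E.lab k).proc = p → E.lab k ≠ .instr p →
      ((E.cfg (k + 1)).loc p).priv = none → ((E.cfg (k + 1)).loc p).ctor = none →
      (E.cfg (k + 1)).mem = (E.cfg k).mem →
      ((E.ghost (k + 1)).cur p = none → (E.cfg (k + 1)).loc p = .idle) →
      (∀ i op, (E.ghost (k + 1)).cur p = some (i, op) →
        E.LocOK (k + 1) p i op ((E.cfg (k + 1)).loc p)) → E.Inv (k + 1) := by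
    intro p hp hni hpr hct hmem hid hloc
    have hv : ∀ o, E.vers (k + 1) o = E.vers k o := by
      intro o
      rcases E.vers_succ k o with h' | ⟨q, _, h', -⟩
      · exact h'
      · rw [h'] at hp hni
        exact absurd (congrArg Label.instr hp) hni
    have hd : ∀ n, E.dec (k + 1) n = E.dec k n := by
      intro n
      rcases E.dec_succ k n with h' | ⟨-, q, _, _, _, h', -⟩
      · exact h'
      · rw [h'] at hp hni
        exact absurd (congrArg Label.instr hp) hni
    have hoth : ∀ q ≠ p, (E.cfg (k + 1)).loc q = (E.cfg k).loc q :=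
      fun q hq => E.loc_step hk (by rw [hp]; exact hq.symm)
    refine ⟨h.mem.frame hk hv hd (fun _ _ _ => by rw [hmem]) (fun _ _ h' => .inl (by rwa [hmem] at h')),
      fun q hq => ?_, fun q i op hq => ?_,
      h.priv_frame hoth (fun o v hvo => .inl (by rwa [hv] at hvo)) (fun n hn => .inl (by rwa [hmem]))
        (.inl hpr),
      h.ctor_frame hoth (fun o => .inl (hv o)) (fun o ho => by rwa [hmem]) (.inl hct)⟩
    · by_cases e : q = p
      · subst e; exact hid hq
      · exact idle_others q (by rw [hp]; exact Ne.symm e) hq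
    · by_cases e : q = p
      · subst e; exact hloc i op hq
      · exact others q i op (by rw [hp]; exact Ne.symm e) hq fun _ _ => by rw [hmem]
  rcases E.step_cases hk with ⟨p, op, hl, hidle, hcfg⟩ | ⟨p, M', l', hl, hInstr, hcfg⟩ |
    ⟨p, r, hl, hret, hcfg⟩
  · have hloc : (E.cfg (k + 1)).loc p = op.start := by simp [hcfg]
    have hcur : (E.ghost (k + 1)).cur p = some (k, op) := by simp [ghost, hl, Ghost.next]
    refine silent p (by rw [hl]; rfl) (by simp [hl]) ?_ ?_ (by rw [hcfg]) ?_ ?_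
    · rw [hloc]; cases op <;> rfl
    · rw [hloc]; cases op <;> rfl
    · simp [hcur]
    · intro i op' h'
      rw [hcur] at h'
      cases h'
      rw [hloc]
      exact locOK_start hpre hk hI hl
  · have hidle : (E.cfg k).loc p ≠ .idle := by
      intro h'
      rw [h'] at hInstr
      cases hInstr
    have hcfg' : E.cfg (k + 1) = ⟨M', Function.update (E.cfg k).loc p l'⟩ := hcfg
    obtain ⟨i, op, hcur⟩ := h.exists_cur hidle
    obtain ⟨hpriv, hctor⟩ := h.priv_ctor_instr hl hcur hInstr hcfg'
    have hcur' : (E.ghost (k + 1)).cur p = some (i, op) := by rw [ghost_of_instr hl]; exact hcur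
    have hproc : (E.lab k).proc = p := by rw [hl]; rfl
    refine ⟨h.mem_instr hk hl hcur hInstr hcfg', fun q hq => ?_, fun q i' op' hq => ?_, hpriv, hctor⟩
    · by_cases e : q = p
      · subst e; rw [hcur'] at hq; cases hq
      · exact idle_others q (by rw [hproc]; exact Ne.symm e) hq
    · by_cases e : q = p
      · subst e
        rw [hcur'] at hq
        cases hq
        have := h.loc_instr hk hl hcur hInstr hcfg'
        rw [hcfg]
        simpa using this
      · refine others q i' op' (by rw [hproc]; exact Ne.symm e) hq fun n hn => ?_
        -- The private node of `q` survives a step of `p`: allocation takes a free address, deletion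
        -- hits only the private node of `p`, and timestamps go to listed nodes.
        obtain ⟨h1, h2, h3⟩ := h.priv q n hn
        have h3 := h3 p (Ne.symm e)
        have hL := h.loc p i op hcur
        rw [hcfg]
        clear hcfg hcfg' hcur' hcur others idle_others silent hpriv hctor
        generalize (E.cfg k).loc p = l at *
        cases hInstr <;> try rfl
        case objNode n' _ hn' => exact Function.update_of_ne (by rintro rfl; exact h1 hn') _ _
        case casNode n' _ hn' => exact Function.update_of_ne (by rintro rfl; exact h1 hn') _ _
        case casDelete => exact Function.update_of_ne (by rintro rfl; exact h3 rfl) _ _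
        case tsCASSucc =>
          refine Function.update_of_ne ?_ _ _
          rintro rfl
          cases hL with
          | tsCAS hx =>
            obtain ⟨v, hv, hvn⟩ := hx
            exact h2 _ v hv hvn
  · have hloc : (E.cfg (k + 1)).loc p = .idle := by simp [hcfg]
    have hcur : (E.ghost (k + 1)).cur p = none := by simp [ghost, hl, Ghost.next]
    refine silent p (by rw [hl]; rfl) (by simp [hl]) ?_ ?_ (by rw [hcfg]) ?_ ?_
    · rw [hloc]; rfl
    · rw [hloc]; rfl
    · exact fun _ => hloc
    · simp [hcur]

theorem inv_of_le (hpre : E.RespectsPreconditions) {k : ℕ} (hk : k ≤ E.len) : E.Inv k := by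
  induction k using Nat.strong_induction_on with
  | _ k ih =>
    cases k with
    | zero => exact Inv.zero
    | succ k => exact Inv.succ hpre hk fun j hj => ih j (by omega) (by omega)

end Execution

/-! ### Progress -/

theorem Set.Finite.of_update {β : Type*} {f : ℕ → Option β} (hf : {x | f x ≠ none}.Finite) (a : ℕ)
    (b : Option β) : {x | Function.update f a b x ≠ none}.Finite := by
  refine (hf.insert a).subset fun x hx => ?_
  by_cases e : x = a
  · exact .inl e
  · exact .inr (by simpa [Function.update_of_ne e] using hx)

theorem Set.Finite.exists_eq_none {β : Type*} {f : ℕ → Option β} (hf : {x | f x ≠ none}.Finite) :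
    ∃ x, f x = none := by
  obtain ⟨x, hx⟩ := hf.exists_notMem
  exact ⟨x, by simpa using hx⟩

/-- Only finitely many addresses are allocated. -/
def Mem.AllocFinite {V : Type*} (M : Mem V) : Prop :=
  {s | M.cams s ≠ none}.Finite ∧ {o | M.objs o ≠ none}.Finite ∧ {n | M.nodes n ≠ none}.Finite

/-- Finiteness leaves a free address of each kind, so no allocation can block. -/
theorem Instr.allocFinite {V : Type*} {M M' : Mem V} {l l' : Loc V} (h : Instr M l M' l')
    (hM : M.AllocFinite) : M'.AllocFinite := by
  obtain ⟨h1, h2, h3⟩ := hM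
  cases h <;> first
    | exact ⟨h1, h2, h3⟩
    | exact ⟨h1.of_update _ _, h2, h3⟩
    | exact ⟨h1, h2.of_update _ _, h3⟩
    | exact ⟨h1, h2, h3.of_update _ _⟩

namespace Execution

variable {P V : Type*} {E : Execution P V}

theorem allocFinite {k : ℕ} (hk : k ≤ E.len) : (E.cfg k).mem.AllocFinite := by
  induction k with
  | zero => simp [E.start, Config.initial, Mem.AllocFinite]
  | succ k ih =>
    rcases E.mem_step hk with h | ⟨p, l', -, h⟩
    · rw [h]; exact ih (by omega)
    · exact h.allocFinite (ih (by omega))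

theorem MemInv.exists_head {k o : ℕ} (h : E.MemInv k) (hv : E.vers k o ≠ []) :
    ∃ O n t, (E.cfg k).mem.objs o = some O ∧ O.VHead = some n ∧
      (E.cfg k).mem.cams O.S = some t := by
  cases ho : (E.cfg k).mem.objs o with
  | none => exact absurd (h.obj_none o ho) hv
  | some O =>
    obtain ⟨h1, t, h2⟩ := h.obj_some o O ho
    obtain ⟨v, post, h3⟩ := List.exists_cons_of_ne_nil hv
    exact ⟨O, v.node, t, rfl, by rw [h1, h3]; rfl, h2⟩

theorem HeadRead.exists_node {k i o : ℕ} {v : Version V} (h : E.HeadRead i k o v)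
    (hm : E.MemInv k) : ∃ N, (E.cfg k).mem.nodes v.node = some N :=
  ⟨_, (hm.node_of_mem h.mem).choose_spec⟩

theorem Scan.exists_node {k i o ts : ℕ} {pre : List (Version V)} {v : Version V}
    (h : E.Scan i k o ts pre v) (hm : E.MemInv k) :
    ∃ N, (E.cfg k).mem.nodes v.node = some N ∧ N.ts = (E.dec k v.node).map Prod.snd := by
  obtain ⟨nx, h1⟩ := hm.node_of_mem h.mem
  exact ⟨_, h1, rfl⟩

theorem Overtaken.vers_ne {k i o : ℕ} {a : V} {x : Version V} (h : E.Overtaken i k o a x) :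
    E.vers k o ≠ [] := by
  obtain ⟨τ, h, pre, post, -, -, -, -, h5⟩ := h
  rw [h5]
  simp

theorem Inv.exists_step {k : ℕ} (h : E.Inv k) (hk : k ≤ E.len) (hf : (E.cfg k).mem.AllocFinite) {p : P}
    (hp : (E.cfg k).loc p ≠ .idle) :
    (∃ M' l', Instr (E.cfg k).mem ((E.cfg k).loc p) M' l') ∨ ∃ r, (E.cfg k).loc p = .ret r := by
  obtain ⟨i, op, hc⟩ := h.exists_cur hp
  have hm := h.mem
  have hL := h.loc p i op hc
  have hpriv := h.priv p
  have hctor := h.ctor p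
  obtain ⟨hf1, hf2, hf3⟩ := hf
  clear hc hp
  generalize (E.cfg k).loc p = l at *
  have mkInstr : ∀ {l M' l'}, Instr (E.cfg k).mem l M' l' →
      (∃ M' l', Instr (E.cfg k).mem l M' l') ∨ ∃ r, l = .ret r := fun h => .inl ⟨_, _, h⟩
  cases hL with
  | camNew =>
    obtain ⟨s, hs⟩ := hf1.exists_eq_none
    exact mkInstr (.camNew hs)
  | camRet => exact .inr ⟨_, rfl⟩
  | objNew =>
    obtain ⟨o, ho⟩ := hf2.exists_eq_none
    exact mkInstr (.objNew ho)
  | objNode =>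
    obtain ⟨n, hn⟩ := hf3.exists_eq_none
    exact mkInstr (.objNode hn)
  | objSetHead =>
    obtain ⟨O, hO⟩ := Option.ne_none_iff_exists'.1 (hctor _ rfl).2.1
    exact mkInstr (.objSetHead hO)
  | objInit hx =>
    obtain ⟨O, n, t, h1, h2, -⟩ := hm.exists_head (List.ne_nil_of_mem hx)
    exact mkInstr (.objInit h1 h2)
  | objRet => exact .inr ⟨_, rfl⟩
  | tsCheck hx =>
    obtain ⟨v, hv, rfl⟩ := hx
    obtain ⟨nx, hN⟩ := hm.node_of_mem hv
    by_cases e : (E.dec k v.node).map Prod.snd = none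
    · exact mkInstr (.tsCheckTBD hN e)
    · exact mkInstr (.tsCheckValid hN e)
  | tsRead hx =>
    obtain ⟨v, hv, -⟩ := hx
    obtain ⟨O, n, t, h1, -, h2⟩ := hm.exists_head (List.ne_nil_of_mem hv)
    exact mkInstr (.tsRead h1 h2)
  | tsCAS hx =>
    obtain ⟨v, hv, rfl⟩ := hx
    obtain ⟨nx, hN⟩ := hm.node_of_mem hv
    by_cases e : (E.dec k v.node).map Prod.snd = none
    · exact mkInstr (.tsCASSucc hN e)
    · exact mkInstr (.tsCASFail hN e)
  | snapRead hs => exact mkInstr (.snapRead hs)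
  | @snapCAS s t τ h1 h2 hs =>
    obtain ⟨t', ht', -⟩ := E.cams_mono h2.le hk hs
    by_cases e : t' = t
    · exact mkInstr (.snapCASSucc (e ▸ ht'))
    · exact mkInstr (.snapCASFail ht' e)
  | snapRet => exact .inr ⟨_, rfl⟩
  | readHead hv =>
    obtain ⟨O, n, t, h1, h2, -⟩ := hm.exists_head hv
    exact mkInstr (.readHead h1 h2)
  | readVal hr hn =>
    subst hn
    obtain ⟨N, hN⟩ := hr.exists_node hm
    exact mkInstr (.readVal hN)
  | readRet => exact .inr ⟨_, rfl⟩
  | casHead hv =>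
    obtain ⟨O, n, t, h1, h2, -⟩ := hm.exists_head hv
    exact mkInstr (.casHead h1 h2)
  | @casCmpVal _ a _ _ _ _ hr hn =>
    subst hn
    obtain ⟨N, hN⟩ := hr.exists_node hm
    by_cases e : N.val = a
    · exact mkInstr (.casCmpValEq hN e)
    · exact mkInstr (.casCmpValNe hN e)
  | @casCmpNew _ a b =>
    by_cases e : b = a
    · exact mkInstr (.casCmpNewEq e)
    · exact mkInstr (.casCmpNewNe e)
  | casNode =>
    obtain ⟨n, hn⟩ := hf3.exists_eq_none
    exact mkInstr (.casNode hn)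
  | @casAppend _ _ _ n _ _ _ hr =>
    obtain ⟨O, -, -, h1, -, -⟩ := hm.exists_head (List.ne_nil_of_mem hr.mem)
    by_cases e : O.VHead = some n
    · exact mkInstr (.casAppendSucc h1 e)
    · exact mkInstr (.casAppendFail h1 e)
  | casDelete =>
    obtain ⟨N, hN⟩ := Option.ne_none_iff_exists'.1 (hpriv _ rfl).1
    exact mkInstr (.casDelete hN)
  | casInit _ ho =>
    obtain ⟨O, n, t, h1, h2, -⟩ := hm.exists_head ho.vers_ne
    exact mkInstr (.casInit h1 h2)
  | casRet => exact .inr ⟨_, rfl⟩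
  | casRetTrue => exact .inr ⟨_, rfl⟩
  | rsHead hold =>
    obtain ⟨w, hw, -⟩ := hold
    obtain ⟨O, n, t, h1, h2, -⟩ := hm.exists_head (List.ne_nil_of_mem hw)
    exact mkInstr (.rsHead h1 h2)
  | @rsWhile _ ts _ _ _ hs hn hd =>
    subst hn
    obtain ⟨N, hN, hts⟩ := hs.exists_node hm
    obtain ⟨⟨d, t⟩, hd⟩ := Option.ne_none_iff_exists'.1 hd
    rw [hd] at hts
    rcases lt_or_ge ts t with e | e
    · exact mkInstr (.rsWhileTrue hN hts e)
    · exact mkInstr (.rsWhileFalse hN hts e)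
  | @rsNext o ts _ pre d t v hs hn hd ht =>
    subst hn
    obtain ⟨m, post, h1, h2, h3, h4, h5, w, hw, d', t', h6, h7⟩ := hs
    obtain ⟨pre', h8⟩ := E.vers_suffix h2.le o
    rw [h4, ← List.append_assoc] at h8
    have hN := hm.node o _ v post h8.symm
    cases post with
    -- The version just rejected would be the oldest one, but `HasOld` requires a timestamp at most
    -- `ts` from it on.
    | nil =>
      rw [List.mem_singleton.1 hw, hd] at h6
      cases h6
      omega
    | cons v' post => exact mkInstr (.rsNext hN rfl)
  | rsVal hs hn =>
    subst hn
    obtain ⟨N, hN, -⟩ := hs.exists_node hm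
    exact mkInstr (.rsVal hN)
  | rsRet => exact .inr ⟨_, rfl⟩

theorem neverStuck (hpre : E.RespectsPreconditions) : E.NeverStuck := by
  intro k hk p hp
  rcases (inv_of_le hpre hk).exists_step hk (allocFinite hk) hp with ⟨M', l', h⟩ | ⟨r, h⟩
  · exact ⟨_, .inl (.instr h)⟩
  · exact ⟨_, .inr ⟨r, .res h⟩⟩

/-! ### Counting instructions -/

/-- The end of an operation: either its response or the end of the execution. -/
theorem exists_end (hpre : E.RespectsPreconditions) {i : ℕ} {op : Op V} (hi : E.Invoked i op) :
    ∃ e p, e ≤ E.len ∧ (E.ghost e).cur p = some (i, op) ∧ E.instrCount i = (E.ghost e).cnt p ∧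
      ∀ b r, E.RespondsAt i b r → e = b := by
  classical
  obtain ⟨hlen, p, hp⟩ := hi
  have hI : ∀ j ≤ E.len, E.Inv j := fun j hj => inv_of_le hpre hj
  have count : ∀ e ≤ E.len, (E.ghost e).cur p = some (i, op) → (∀ j, E.Performs i j → j < e) →
      E.instrCount i = (E.ghost e).cnt p := by
    intro e he hc hperf
    rw [E.cnt_eq_ncard he hc, History.instrCount]
    congr 1
    ext j
    exact ⟨fun h => ⟨hperf j h, h⟩, fun h => h.2⟩
  by_cases hr : ∃ b, i < b ∧ b < E.len ∧ ∃ r, E.lab b = .res p r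
  · obtain ⟨h1, h2, r, h3⟩ := Nat.find_spec hr
    have hmin := fun m (hm : m < Nat.find hr) => Nat.find_min hr hm
    set e := Nat.find hr
    have hbefore : ∀ m r, i < m → m < e → E.lab m ≠ .res p r :=
      fun m r hm1 hm2 hm3 => hmin m hm2 ⟨hm1, by omega, r, hm3⟩
    have hc := cur_of_pending h2.le (fun j hj => hI j (by omega)) hp h1 hbefore
    refine ⟨e, p, h2.le, hc, count e h2.le hc ?_, ?_⟩
    · rintro j ⟨q, ⟨⟨op', h4⟩, h5, h6, h7⟩, h8⟩
      rw [hp] at h4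
      cases h4
      by_contra hj
      rcases (not_lt.1 hj).eq_or_lt with he | hj
      · rw [← he, h3] at h8
        cases h8
      · exact h7 e r h1 hj h3
    · rintro b r' ⟨q, ⟨⟨op', h4⟩, h5, h6, h7⟩, h8⟩
      rw [hp] at h4
      cases h4
      rcases lt_trichotomy e b with hj | hj | hj
      · exact absurd h3 (h7 e r h1 hj)
      · exact hj
      · exact absurd h8 (hbefore b r' h5 hj)
  · have hbefore : ∀ m r, i < m → m < E.len → E.lab m ≠ .res p r :=
      fun m r hm1 hm2 hm3 => hr ⟨m, hm1, hm2, r, hm3⟩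
    have hc := cur_of_pending le_rfl (fun j hj => hI j (by omega)) hp hlen hbefore
    refine ⟨E.len, p, le_rfl, hc, count _ le_rfl hc ?_, ?_⟩
    · rintro j ⟨q, ⟨-, h5, h6, h7⟩, h8⟩
      exact h6
    · rintro b r' ⟨q, ⟨⟨op', h4⟩, h5, h6, h7⟩, h8⟩
      rw [hp] at h4
      cases h4
      exact absurd h8 (hbefore b r' h5 h6)

end Execution

/-- A bound on the number of instructions that remain, for operations without loops. -/
def Loc.potential {V : Type*} : Loc V → ℕ
  | .tsCheck _ _ next => next.potential + 3
  | .tsRead _ _ next => next.potential + 2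
  | .tsCAS _ _ _ next => next.potential + 1
  | .snapRead _ => 2
  | .snapCAS _ _ => 1
  | .readHead _ => 5
  | .readVal _ => 1
  -- One read of `VHead`, at most three instructions of `initTS`, and 9 for the longest
  -- continuation, through a failed CAS, the deletion and a second `initTS`.
  | .casHead _ _ _ => 13
  | .casCmpVal _ _ _ _ => 9
  | .casCmpNew _ _ _ _ => 8
  | .casNode _ _ _ => 7
  | .casAppend _ _ _ => 6
  | .casDelete _ _ => 5
  | .casInit _ => 4
  | .camNew => 1
  | .objNew _ _ => 7
  | .objNode _ _ => 6
  | .objSetHead _ _ => 5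
  | .objInit _ => 4
  | _ => 0

/-- The instruction does not belong to `readSnapshot`. -/
def Loc.LoopFree {V : Type*} : Loc V → Prop
  | .tsCheck _ _ next => next.LoopFree
  | .tsRead _ _ next => next.LoopFree
  | .tsCAS _ _ _ next => next.LoopFree
  | .rsHead _ _ => False
  | .rsWhile _ _ => False
  | .rsNext _ _ => False
  | .rsVal _ => False
  | _ => True

theorem Instr.potential_lt {V : Type*} {M M' : Mem V} {l l' : Loc V} (h : Instr M l M' l')
    (hl : l.LoopFree) : l'.LoopFree ∧ l'.potential < l.potential := by
  cases h <;> simp_all [Loc.LoopFree, Loc.potential]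

namespace Execution

variable {P V : Type*} {E : Execution P V}

/-- Each instruction raises the counter by one and lowers the potential by at least one, so their
sum never exceeds its initial value. -/
theorem cnt_add_potential_le {k : ℕ} (hk : k ≤ E.len) {p : P} {i : ℕ} {op : Op V}
    (hc : (E.ghost k).cur p = some (i, op)) (hop : op.start.LoopFree) :
    ((E.cfg k).loc p).LoopFree ∧
      (E.ghost k).cnt p + ((E.cfg k).loc p).potential ≤ op.start.potential := by
  induction k with
  | zero => simp [ghost] at hc
  | succ k ih =>
    by_cases hp : (E.lab k).proc = p
    · rcases E.step_cases hk with ⟨q, op', h1, h2, h3⟩ | ⟨q, M', l', h1, h2, h3⟩ |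
        ⟨q, r, h1, h2, h3⟩
      · rw [h1] at hp
        simp only [Label.proc] at hp
        subst hp
        simp only [ghost, h1, Ghost.next, Function.update_self, Option.some.injEq,
          Prod.mk.injEq] at hc
        obtain ⟨rfl, rfl⟩ := hc
        rw [h3]
        simp [ghost, h1, Ghost.next, hop]
      · rw [h1] at hp
        simp only [Label.proc] at hp
        subst hp
        have hc' : (E.ghost k).cur q = some (i, op) := by
          rw [ghost_of_instr h1] at hc; exact hc
        obtain ⟨h4, h5⟩ := ih (by omega) hc'
        obtain ⟨h6, h7⟩ := h2.potential_lt h4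
        rw [h3, ghost_of_instr h1]
        simp only [Function.update_self]
        exact ⟨h6, by omega⟩
      · rw [h1] at hp
        simp only [Label.proc] at hp
        subst hp
        simp [ghost, h1, Ghost.next] at hc
    · rw [(E.ghost_step_other hp).1] at hc
      rw [(E.ghost_step_other hp).2.2, E.loc_step hk hp]
      exact ih (by omega) hc

theorem instrCount_le (hpre : E.RespectsPreconditions) {i : ℕ} {op : Op V} (hi : E.Invoked i op)
    (hop : op.start.LoopFree) : E.instrCount i ≤ op.start.potential := by
  obtain ⟨e, p, he, hc, h, -⟩ := exists_end hpre hi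
  have := (cnt_add_potential_le he hc hop).2
  omega

/-! ### The cost of `readSnapshot` -/

theorem MemInv.nodup_op {k : ℕ} (h : E.MemInv k) (o : ℕ) {l : List (Version V)}
    (hl : l <:+ E.vers k o) : (l.map Version.op).Nodup := by
  induction l with
  | nil => simp
  | cons x l ih =>
    obtain ⟨pre, hpre⟩ := hl
    refine List.nodup_cons.2 ⟨fun hx => ?_, ih ⟨pre ++ [x], by simp [← hpre]⟩⟩
    obtain ⟨y, hy, hxy⟩ := List.mem_map.1 hx
    obtain ⟨a, b, rfl⟩ := List.append_of_mem hy
    have := (h.op_inj o o pre (pre ++ x :: a) x y _ b hpre.symm (by simp [← hpre]) hxy.symm).2.2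
    have := congrArg List.length this
    simp at this
    omega

/-- Timestamps, and the times at which they were read, decrease along the version list. -/
theorem MemInv.dec_lt {k : ℕ} (h : E.MemInv k) (hk : k ≤ E.len) {o d t d' t' : ℕ}
    {pre post : List (Version V)} {v w : Version V} (hv : E.vers k o = pre ++ v :: post)
    (hd : E.dec k v.node = some (d, t)) (hw : w ∈ post) (hd' : E.dec k w.node = some (d', t')) :
    d' < d ∧ t' ≤ t := by
  obtain ⟨a, b, rfl⟩ := List.append_of_mem hw
  obtain ⟨h1, h2, h3⟩ := h.decided _ _ _ _ _ _ hv hd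
  obtain ⟨h4, h5, h6⟩ := h.decided o (pre ++ v :: a) w b d' t' (by simp [hv]) hd'
  have hlt : d' < d := E.vers_lt (o := o) (by rw [h2, h5]; simp)
  obtain ⟨s, h7, h8⟩ := h3.ts
  obtain ⟨s', h9, h10⟩ := h6.ts
  obtain rfl := (h9.mono hlt.le (by omega)).unique h7
  exact ⟨hlt, E.cams_le hlt.le (by omega) h10 h8⟩

/-- Unlike `rsRet`, this also applies to an operation that is still pending when the execution ends.
-/
theorem LocOK.scan {k : ℕ} {p : P} {i o ts : ℕ} {l : Loc V}
    (h : E.LocOK k p i (.readSnapshot o ts) l) : (E.ghost k).cnt p = 0 ∨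
      ∃ pre v, E.Scan i k o ts pre v ∧ (E.ghost k).cnt p ≤ 2 * pre.length + 6 := by
  have hA : ∀ {c n next}, E.AfterTS k p i c (.readSnapshot o ts) o n next → c ≤ 6 →
      ∃ pre v, E.Scan i k o ts pre v ∧ (E.ghost k).cnt p ≤ 2 * pre.length + 6 := by
    intro c n next h hc
    cases h with
    | snap h hn hc' => exact ⟨_, _, h, by simp; omega⟩
  have hA' : ∀ {c o' n next}, E.AfterTS k p i c (.readSnapshot o ts) o' n next → o' = o := by
    intro c o' n next h
    cases h
    rfl
  cases h with
  | tsCheck hn h => obtain rfl := hA' h; exact .inr (hA h (by omega))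
  | tsRead hn h => obtain rfl := hA' h; exact .inr (hA h (by omega))
  | tsCAS hn h => obtain rfl := hA' h; exact .inr (hA h (by omega))
  | rsHead h hc => exact .inl hc
  | rsWhile h hn hd hc => exact .inr ⟨_, _, h, by omega⟩
  | rsNext h hn hd ht hc => exact .inr ⟨_, _, h, by omega⟩
  | rsVal h hn hd ht hc => exact .inr ⟨_, _, h, by omega⟩
  | rsRet h hv hd ht hc => exact .inr ⟨_, _, h, by omega⟩

theorem exists_version_of_appends (hpre : E.RespectsPreconditions) {i k o n : ℕ}
    (h : E.Appends i k o n) : ∃ v ∈ E.vers (k + 1) o, v.node = n ∧ v.op = i := by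
  obtain ⟨p, head, O, ⟨⟨op, h1⟩, h2, h3, h4⟩, h5, h6, h7, h8⟩ := h
  have hc := cur_of_pending h3.le (fun j hj => inv_of_le hpre (by omega)) h1 h2 h4
  obtain ⟨N, hN⟩ := Option.ne_none_iff_exists'.1
    ((inv_of_le hpre h3.le).priv p n (by rw [h6]; rfl)).1
  refine ⟨⟨n, N.val, i⟩, ?_, rfl, rfl⟩
  rw [vers_eq_of_instr h5]
  have : (E.ghost k).published (E.cfg k) p = some (o, ⟨n, N.val, i⟩) := by
    simp [Ghost.published, h6, hc, h7, h8, hN]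
  simp [Ghost.nextVers, this]

theorem newerVCAS_subset (hpre : E.RespectsPreconditions) {m o ts : ℕ} (hm : m ≤ E.len) {i : ℕ}
    (hi : i ∈ E.newerVCAS m o ts) :
    ∃ v ∈ E.vers m o, v.op = i ∧ ∃ d t, E.dec m v.node = some (d, t) ∧ ts < t := by
  obtain ⟨-, k, n, N, t, hk, ha, hN, ht, hlt⟩ := hi
  obtain ⟨v, hv, rfl, hop⟩ := exists_version_of_appends hpre ha
  have hv := E.vers_mono (k' := m) (by omega) hv
  obtain ⟨nx, h1⟩ := (inv_of_le hpre hm).mem.node_of_mem hv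
  rw [hN] at h1
  cases h1
  obtain ⟨⟨d, t'⟩, h2, rfl⟩ := Option.map_eq_some_iff.1 ht
  exact ⟨v, hv, hop, d, t', h2, hlt⟩

theorem newerVCAS_finite (hpre : E.RespectsPreconditions) {m o ts : ℕ} (hm : m ≤ E.len) :
    (E.newerVCAS m o ts).Finite := by
  classical
  refine ((E.vers m o).map Version.op).toFinset.finite_toSet.subset fun i hi => ?_
  obtain ⟨v, hv, hop, -⟩ := newerVCAS_subset hpre hm hi
  simp only [Finset.mem_coe, List.mem_toFinset, List.mem_map]
  exact ⟨v, hv, hop⟩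

/-- All skipped versions except possibly the first one had larger timestamps when the search
began. -/
theorem length_le_newerVCAS (hpre : E.RespectsPreconditions) {k m o ts : ℕ} (hmk : m ≤ k)
    (hk : k ≤ E.len) {pre post : List (Version V)} {v : Version V}
    (hv : E.vers m o = pre ++ v :: post)
    (hts : ∀ w ∈ pre, ∃ d t, E.dec k w.node = some (d, t) ∧ ts < t) :
    pre.length ≤ (E.newerVCAS m o ts).ncard + 1 := by
  classical
  have hm := (inv_of_le hpre (hmk.trans hk)).mem
  cases pre with
  | nil => simp
  | cons x pre =>
    have hnd : (pre.map Version.op).Nodup := by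
      have := hm.nodup_op o (l := pre ++ v :: post) ⟨[x], by simp [hv]⟩
      rw [List.map_append] at this
      exact this.of_append_left
    have hsub : ((pre.map Version.op).toFinset : Set ℕ) ⊆ E.newerVCAS m o ts := by
      intro i hi
      simp only [Finset.mem_coe, List.mem_toFinset, List.mem_map] at hi
      obtain ⟨w, hw, rfl⟩ := hi
      obtain ⟨a, b, rfl⟩ := List.append_of_mem hw
      obtain ⟨y, rest, hy⟩ : ∃ y rest, b ++ v :: post = y :: rest :=
        List.exists_cons_of_ne_nil (by simp)
      have hw' : E.vers m o = (x :: a) ++ w :: y :: rest := by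
        rw [hv, ← hy]; simp
      -- Below the head, timestamps are already present at time `m`. Only the head `x` may receive
      -- its timestamp later, which accounts for the `+ 1` in the bound.
      obtain ⟨⟨d, t⟩, hd⟩ := Option.ne_none_iff_exists'.1 (hm.tail o _ w _ hw' (by simp))
      obtain ⟨d', t', hd', hlt⟩ := hts w (by simp)
      rw [E.dec_mono hmk hd] at hd'
      cases hd'
      obtain ⟨-, ⟨p, hp⟩, c, hc, ha⟩ := hm.later o _ w y rest hw'
      have hlt' := hm.op_lt o w (by rw [hw']; simp)
      exact ⟨⟨_, _, by omega, p, hp⟩, c, w.node, _, t, hc, ha, hm.node o _ w _ hw',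
        by rw [hd]; rfl, hlt⟩
    have := Set.ncard_le_ncard hsub (newerVCAS_finite hpre (hmk.trans hk))
    rw [Set.ncard_coe_finset, List.toFinset_card_of_nodup hnd] at this
    simpa using this

/-- All versions that had larger timestamps when the search began are skipped. -/
theorem newerVCAS_le_length (hpre : E.RespectsPreconditions) {k m o ts d t : ℕ} (hmk : m ≤ k)
    (hk : k ≤ E.len) {pre post : List (Version V)} {v : Version V}
    (hv : E.vers m o = pre ++ v :: post) (hd : E.dec k v.node = some (d, t)) (ht : t ≤ ts) :
    (E.newerVCAS m o ts).ncard ≤ pre.length := by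
  classical
  have hm := (inv_of_le hpre hk).mem
  have hsub : E.newerVCAS m o ts ⊆ ((pre.map Version.op).toFinset : Set ℕ) := by
    intro i hi
    obtain ⟨w, hw, rfl, d', t', hd', hlt⟩ := newerVCAS_subset hpre (hmk.trans hk) hi
    simp only [Finset.mem_coe, List.mem_toFinset, List.mem_map]
    refine ⟨w, ?_, rfl⟩
    have hd' := E.dec_mono hmk hd'
    rw [hv] at hw
    rcases List.mem_append.1 hw with hw | hw
    · exact hw
    · exfalso
      rcases List.mem_cons.1 hw with rfl | hw
      · rw [hd] at hd'
        cases hd'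
        omega
      · obtain ⟨pre', hpre'⟩ := E.vers_suffix hmk o
        rw [hv, ← List.append_assoc] at hpre'
        have := (hm.dec_lt hk hpre'.symm hd hw hd').2
        omega
  calc _ ≤ (pre.map Version.op).toFinset.card := by
        rw [← Set.ncard_coe_finset]
        exact Set.ncard_le_ncard hsub (Finset.finite_toSet _)
    _ ≤ _ := by
        refine (List.toFinset_card_le _).trans ?_
        simp

/-- With `k` newer versions at time `m`, between `k` and `k + 1` versions are skipped by a search
that completes, and at most `k + 1` by any search. A search that skips `l` versions performs at most
`2 * l + 6` instructions, and at least `2 * l + 1` if it completes. -/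
theorem readSnapshot_instrCount (hpre : E.RespectsPreconditions) {i o ts : ℕ}
    (hi : E.Invoked i (.readSnapshot o ts)) (hpos : 0 < E.instrCount i) :
    ∃ m, E.ReadsHead i m o ts ∧ E.instrCount i ≤ 13 * ((E.newerVCAS m o ts).ncard + 1) ∧
      ((∃ b r, E.RespondsAt i b r) → (E.newerVCAS m o ts).ncard + 1 ≤ E.instrCount i) := by
  obtain ⟨e, p, he, hc, hcount, hend⟩ := exists_end hpre hi
  by_cases hr : ∃ b r, E.RespondsAt i b r
  · obtain ⟨b, r, hr⟩ := hr
    obtain rfl := hend b r hr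
    obtain ⟨q, hq, hL⟩ := locOK_of_respondsAt (fun j hj => inv_of_le hpre (by omega)) hi hr
    have := (E.cur_spec hc).2.1
    rw [(E.cur_spec hq).2.1] at this
    cases this
    cases hL with
    | rsRet h hv hd ht hc hc' =>
      obtain ⟨m, post, h1, h2, h3, h4, h5, h6⟩ := h
      have l1 := length_le_newerVCAS hpre h2.le he h4 h5
      have l2 := newerVCAS_le_length hpre h2.le he h4 hd ht
      exact ⟨m, h3, by omega, fun _ => by omega⟩
  · rcases ((inv_of_le hpre he).loc _ _ _ hc).scan with h | ⟨pre, v, h, hle⟩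
    · omega
    · obtain ⟨m, post, h1, h2, h3, h4, h5, h6⟩ := h
      have l1 := length_le_newerVCAS hpre h2.le he h4 h5
      exact ⟨m, h3, by omega, fun h => absurd h hr⟩

end Execution

/-! ### From linearization points to a linearization -/

/-- A history is linearizable if its operations can be given linearization points such that the
abstract states between these points are known and each operation is legal at its point. -/
theorem History.linearizable_of_points {P V : Type*} (H : History P (Op V) (Resp V))
    (pt : ℕ → Op V → Resp V → ℕ → Prop) (abs : ℕ → SeqState V) (N : ℕ)
    (h_inv : ∀ {i op r κ}, pt i op r κ → H.Invoked i op)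
    (h_lt : ∀ {i op r κ}, pt i op r κ → κ < N)
    (h_fun : ∀ {i op r r' κ κ'}, pt i op r κ → pt i op r' κ' → r = r' ∧ κ = κ')
    (h_complete : ∀ {i b op r}, H.Invoked i op → H.RespondsAt i b r → ∃ κ, pt i op r κ)
    (h_order : ∀ {i j op op' r r' κ κ'}, pt i op r κ → pt j op' r' κ' → H.Precedes i j → κ < κ')
    (h_zero : abs 0 = SeqState.empty)
    (h_apply : ∀ {i op r κ}, pt i op r κ → (abs κ).apply (op, r) = abs (κ + 1))
    (h_quiet : ∀ κ < N, (¬ ∃ i op r, pt i op r κ) → abs (κ + 1) = abs κ)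
    (h_multi : ∀ {i j op op' r r' κ}, pt i op r κ → pt j op' r' κ → i ≠ j →
      abs (κ + 1) = abs κ)
    (h_legal : ∀ L : List (ℕ × Op V × Resp V),
      (∀ {m : ℕ} {x : ℕ × Op V × Resp V}, L[m]? = some x →
        ∃ κ, pt x.1 x.2.1 x.2.2 κ ∧ SeqState.after (L.map Prod.snd) m = abs κ) →
      (∀ {i op r κ}, pt i op r κ → ∃ m : ℕ, L[m]? = some (i, op, r)) →
      (∀ {m m' : ℕ} {x y : ℕ × Op V × Resp V} {κ κ' : ℕ}, L[m]? = some x → L[m']? = some y → pt x.1 x.2.1 x.2.2 κ →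
        pt y.1 y.2.1 y.2.2 κ' → κ < κ' → m < m') →
      ∀ {m : ℕ} {i op r}, L[m]? = some (i, op, r) → LegalAt (L.map Prod.snd) m (op, r)) :
    H.Linearizable SeqSpec := by
  classical
  have op_eq : ∀ {i op op' r r' κ κ'}, pt i op r κ → pt i op' r' κ' → op = op' := by
    intro i op op' r r' κ κ' h h'
    obtain ⟨-, p, hp⟩ := h_inv h
    obtain ⟨-, q, hq⟩ := h_inv h'
    rw [hp] at hq
    cases hq
    rfl
  have ext : ∀ {x y : ℕ × Op V × Resp V} {κ κ'}, pt x.1 x.2.1 x.2.2 κ → pt y.1 y.2.1 y.2.2 κ' →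
      x.1 = y.1 → x = y ∧ κ = κ' := by
    rintro ⟨i, op, r⟩ ⟨j, op', r'⟩ κ κ' h h' e
    simp only at h h' e
    subst e
    obtain rfl := op_eq h h'
    obtain ⟨rfl, rfl⟩ := h_fun h h'
    exact ⟨rfl, rfl⟩
  -- Induction on the points: the operations with point `n` are appended as a block, in arbitrary
  -- order, to those with smaller points.
  have main : ∀ n ≤ N, ∃ L : List (ℕ × Op V × Resp V),
      (∀ x, x ∈ L ↔ ∃ κ < n, pt x.1 x.2.1 x.2.2 κ) ∧ (L.map Prod.fst).Nodup ∧
      L.Pairwise (fun x y => ∀ κ κ', pt x.1 x.2.1 x.2.2 κ → pt y.1 y.2.1 y.2.2 κ' → κ ≤ κ') ∧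
      (L.map Prod.snd).foldl SeqState.apply SeqState.empty = abs n ∧
      ∀ (m : ℕ) (x : ℕ × Op V × Resp V), L[m]? = some x →
        ∃ κ, pt x.1 x.2.1 x.2.2 κ ∧ SeqState.after (L.map Prod.snd) m = abs κ := by
    intro n
    induction n with
    | zero =>
      intro _
      exact ⟨[], by simp, by simp, by simp, by simp [h_zero], by simp⟩
    | succ n ih =>
      intro hn
      obtain ⟨L, h1, h2, h3, h4, h5⟩ := ih (by omega)
      have hfin : {x : ℕ × Op V × Resp V | pt x.1 x.2.1 x.2.2 n}.Finite := by
        refine Set.Finite.of_finite_image (f := Prod.fst) ?_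
          fun x hx y hy e => (ext hx hy e).1
        refine (Set.finite_lt_nat H.len).subset ?_
        rintro _ ⟨x, hx, rfl⟩
        exact (h_inv hx).1
      obtain ⟨B, hB, hBnd⟩ : ∃ B : List (ℕ × Op V × Resp V),
          (∀ x, x ∈ B ↔ pt x.1 x.2.1 x.2.2 n) ∧ B.Nodup :=
        ⟨hfin.toFinset.toList, by simp, Finset.nodup_toList _⟩
      -- By `h_quiet` and `h_multi`, the state can change across a block only if the block consists
      -- of a single operation, so each operation of the block finds the state `abs n`.
      have hfold : ((B.map Prod.snd).foldl SeqState.apply (abs n) = abs (n + 1)) ∧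
          ∀ m < B.length, ((B.map Prod.snd).take m).foldl SeqState.apply (abs n) = abs n := by
        by_cases hconst : abs (n + 1) = abs n
        · have : ∀ B' : List (ℕ × Op V × Resp V), (∀ x ∈ B', x ∈ B) →
              (B'.map Prod.snd).foldl SeqState.apply (abs n) = abs n := by
            intro B'
            induction B' with
            | nil => simp
            | cons x B' ih =>
              intro hx
              have := h_apply ((hB x).1 (hx x (by simp)))
              rw [List.map_cons, List.foldl_cons, Prod.eta] at *
              rw [this, hconst]
              exact ih fun y hy => hx y (by simp [hy])
          refine ⟨by rw [hconst]; exact this B fun x hx => hx, fun m _ => ?_⟩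
          rw [← List.map_take]
          exact this _ fun x hx => List.mem_of_mem_take hx
        · match B, hB, hBnd with
          | [], hB, _ =>
            refine absurd (h_quiet n (by omega) ?_) hconst
            rintro ⟨i, op, r, h⟩
            simpa using (hB (i, op, r)).2 h
          | [x], hB, _ =>
            refine ⟨by simpa using h_apply ((hB x).1 (by simp)), fun m hm => ?_⟩
            simp only [List.length_singleton, Nat.lt_one_iff] at hm
            subst hm
            simp
          | x :: y :: B, hB, hBnd =>
            have hx := (hB x).1 (by simp)
            have hy := (hB y).1 (by simp)
            refine absurd (h_multi hx hy fun e => ?_) hconst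
            obtain rfl := (ext hx hy e).1
            simp at hBnd
      refine ⟨L ++ B, ?_, ?_, ?_, ?_, ?_⟩
      · intro x
        rw [List.mem_append, h1, hB]
        constructor
        · rintro (⟨κ, hκ, h⟩ | h)
          · exact ⟨κ, by omega, h⟩
          · exact ⟨n, by omega, h⟩
        · rintro ⟨κ, hκ, h⟩
          rcases Nat.lt_succ_iff_lt_or_eq.1 hκ with hκ | rfl
          · exact .inl ⟨κ, hκ, h⟩
          · exact .inr h
      · rw [List.map_append, List.nodup_append]
        refine ⟨h2, hBnd.map_on fun x hx y hy e =>
          (ext ((hB x).1 hx) ((hB y).1 hy) e).1, ?_⟩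
        intro a ha b hb e
        obtain ⟨x, hx, rfl⟩ := List.mem_map.1 ha
        obtain ⟨y, hy, rfl⟩ := List.mem_map.1 hb
        obtain ⟨κ, hκ, hx⟩ := (h1 x).1 hx
        have := (ext hx ((hB y).1 hy) e).2
        omega
      · rw [List.pairwise_append]
        refine ⟨h3, ?_, ?_⟩
        · refine List.pairwise_of_forall_mem_list fun x hx y hy κ κ' hκ hκ' => ?_
          rw [(ext hκ ((hB x).1 hx) rfl).2, (ext hκ' ((hB y).1 hy) rfl).2]
        · intro x hx y hy κ κ' hκ hκ'
          obtain ⟨κ0, h0, hx⟩ := (h1 x).1 hx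
          rw [(ext hκ hx rfl).2, (ext hκ' ((hB y).1 hy) rfl).2]
          omega
      · rw [List.map_append, List.foldl_append, h4]
        exact hfold.1
      · intro m x hx
        rcases lt_or_ge m L.length with hm | hm
        · rw [List.getElem?_append_left hm] at hx
          obtain ⟨κ, hκ, h⟩ := h5 m x hx
          refine ⟨κ, hκ, ?_⟩
          rw [← h, SeqState.after, SeqState.after, List.map_append,
            List.take_append_of_le_length (by simpa using hm.le)]
        · rw [List.getElem?_append_right hm] at hx
          have hxB := (hB x).1 (List.mem_of_getElem? hx)
          have hlt : m - L.length < B.length := by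
            by_contra hc
            rw [List.getElem?_eq_none (by omega)] at hx
            simp at hx
          refine ⟨n, hxB, ?_⟩
          rw [SeqState.after, List.map_append, List.take_append, List.foldl_append,
            List.take_of_length_le (by simpa using hm), h4, List.length_map]
          exact hfold.2 _ hlt
  obtain ⟨L, h1, h2, h3, -, h5⟩ := main N le_rfl
  have hmem : ∀ {i op r κ}, pt i op r κ → (i, op, r) ∈ L := fun h => (h1 _).2 ⟨_, h_lt h, h⟩
  refine ⟨L, ⟨?_, h2, ?_, ?_, ?_⟩⟩
  · intro x hx
    obtain ⟨κ, -, h⟩ := (h1 x).1 hx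
    exact h_inv h
  · intro i b op r hi hr
    obtain ⟨κ, h⟩ := h_complete hi hr
    exact hmem h
  · refine h3.imp_of_mem fun {x y} hx hy h hp => ?_
    obtain ⟨κ, -, hx⟩ := (h1 x).1 hx
    obtain ⟨κ', -, hy⟩ := (h1 y).1 hy
    exact absurd (h_order hy hx hp) (not_lt.2 (h κ κ' hx hy))
  · intro m e he
    rw [List.getElem?_map, Option.map_eq_some_iff] at he
    obtain ⟨⟨i, op, r⟩, hx, rfl⟩ := he
    refine h_legal L (fun {m x} => h5 m x) (fun h => List.getElem?_of_mem (hmem h)) ?_ hx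
    intro m m' x y κ κ' hx hy hκ hκ' hlt
    by_contra hc
    rcases (not_lt.1 hc).eq_or_lt with rfl | hc
    · rw [hx] at hy
      cases hy
      have := (ext hκ hκ' rfl).2
      omega
    · have hm : m < L.length := by
        by_contra h
        rw [List.getElem?_eq_none (by omega)] at hx
        simp at hx
      have hm' : m' < L.length := hc.trans hm
      rw [List.getElem?_eq_getElem hm, Option.some.injEq] at hx
      rw [List.getElem?_eq_getElem hm', Option.some.injEq] at hy
      subst hx hy
      have := List.pairwise_iff_getElem.1 h3 m' m hm' hm hc _ _ hκ' hκ
      omega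

theorem History.RespondsAt.unique {P Op R : Type*} {H : History P Op R} {i b b' : ℕ} {r r' : R}
    (h : H.RespondsAt i b r) (h' : H.RespondsAt i b' r') : b = b' ∧ r = r' := by
  obtain ⟨p, ⟨⟨op, h1⟩, h2, h3, h4⟩, h5⟩ := h
  obtain ⟨q, ⟨⟨op', h1'⟩, h2', h3', h4'⟩, h5'⟩ := h'
  rw [h1] at h1'
  cases h1'
  obtain rfl : b = b' := by
    rcases lt_trichotomy b b' with hb | hb | hb
    · exact absurd h5 (h4' _ _ h2 hb)
    · exact hb
    · exact absurd h5' (h4 _ _ h2' hb)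
  rw [h5] at h5'
  cases h5'
  exact ⟨rfl, rfl⟩

theorem History.Ongoing.lt_of_respondsAt {P Op R : Type*} {H : History P Op R} {p : P} {i τ b : ℕ}
    {r : R} (h : H.Ongoing p i τ) (hl : H.lab τ = .instr p) (hr : H.RespondsAt i b r) : τ < b := by
  obtain ⟨⟨op, h1⟩, h2, h3, h4⟩ := h
  obtain ⟨q, ⟨⟨op', h1'⟩, h2', h3', h4'⟩, h5'⟩ := hr
  rw [h1] at h1'
  cases h1'
  rcases lt_trichotomy τ b with hb | rfl | hb
  · exact hb
  · rw [hl] at h5'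
    cases h5'
  · exact absurd h5' (h4 _ _ h2' hb)

/-! ### Abstract states and linearization points -/

namespace Execution

variable {P V : Type*} {E : Execution P V}

/-- An operation adds no version after its response. -/
theorem Unpub.of_respondsAt {i b : ℕ} {r : Resp V} (h : E.Unpub b i) (hr : E.RespondsAt i b r)
    {k : ℕ} (hk : b ≤ k) (hlen : k ≤ E.len) : E.Unpub k i := by
  induction hk with
  | refl => exact h
  | @step k hk ih =>
    have hk : b ≤ k := hk
    intro o v hv
    rcases E.vers_succ k o with h' | ⟨q, w, h1, h2, h3⟩
    · rw [Nat.succ_eq_add_one, h'] at hv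
      exact ih (by omega) o v hv
    · rw [Nat.succ_eq_add_one, h3] at hv
      rcases List.mem_cons.1 hv with rfl | hv
      · rintro rfl
        obtain ⟨op, hc⟩ := cur_of_published h2
        have := (E.ongoing_of_cur (by omega) hc).lt_of_respondsAt h1 hr
        omega
      · exact ih (by omega) o v hv

variable (E)

/-- The final timestamp of the node `n` was read before time `τ`. -/
def DecidedBefore (τ n : ℕ) : Prop := ∃ d t, E.dec E.len n = some (d, t) ∧ d < τ

open Classical in
/-- The version of `o` whose value is the abstract value of `o` at time `τ`. -/
noncomputable def current (τ o : ℕ) : Option (Version V) :=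
  ((E.vers E.len o).filter fun v => E.DecidedBefore τ v.node).head?

/-- The camera of `o`. -/
noncomputable def camera (o : ℕ) : ℕ := ((E.cfg E.len).mem.objs o).elim 0 VObj.S

/-- The abstract state at time `τ`. -/
noncomputable def abstractState (τ : ℕ) : SeqState V where
  cams := {s | (E.cfg τ).mem.cams s ≠ none}
  objs o := (E.current τ o).map fun v => (E.camera o, v.val)

variable {E}

theorem HasCam.camera_eq {o s : ℕ} (h : E.HasCam E.len o s) : E.camera o = s := by
  obtain ⟨O, h1, h2⟩ := h
  simp [camera, h1, h2]

theorem current_eq {τ o d t : ℕ} {pre post : List (Version V)} {v : Version V}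
    (hv : E.vers E.len o = pre ++ v :: post) (hd : E.dec E.len v.node = some (d, t)) (hτ : d < τ)
    (hpre : ∀ w ∈ pre, ∀ d' t', E.dec E.len w.node = some (d', t') → τ ≤ d') :
    E.current τ o = some v := by
  classical
  rw [current, hv, List.filter_append, List.filter_cons_of_pos (by simpa using ⟨d, t, hd, hτ⟩)]
  have : pre.filter (fun v => E.DecidedBefore τ v.node) = [] := by
    rw [List.filter_eq_nil_iff]
    intro w hw
    simp only [decide_eq_true_eq]
    rintro ⟨d', t', h1, h2⟩
    have := hpre w hw d' t' h1
    omega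
  rw [this]
  rfl

theorem current_eq_none {τ o : ℕ}
    (h : ∀ w ∈ E.vers E.len o, ∀ d' t', E.dec E.len w.node = some (d', t') → τ ≤ d') :
    E.current τ o = none := by
  classical
  rw [current, List.head?_eq_none_iff, List.filter_eq_nil_iff]
  intro w hw
  simp only [decide_eq_true_eq]
  rintro ⟨d', t', h1, h2⟩
  have := h w hw d' t' h1
  omega

theorem current_ne_none {τ o d t : ℕ} {v : Version V} (hv : v ∈ E.vers E.len o)
    (hd : E.dec E.len v.node = some (d, t)) (hτ : d < τ) : E.current τ o ≠ none := by
  classical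
  rw [current, Ne, List.head?_eq_none_iff, List.filter_eq_nil_iff]
  push Not
  exact ⟨v, hv, by simpa using ⟨d, t, hd, hτ⟩⟩

theorem current_succ {τ o : ℕ}
    (h : ∀ v ∈ E.vers E.len o, ∀ t, E.dec E.len v.node ≠ some (τ, t)) :
    E.current (τ + 1) o = E.current τ o := by
  classical
  rw [current, current]
  congr 1
  refine List.filter_congr fun v hv => ?_
  simp only [decide_eq_decide]
  constructor
  · rintro ⟨d, t, h1, h2⟩
    rcases Nat.lt_succ_iff_lt_or_eq.1 h2 with h2 | rfl
    · exact ⟨d, t, h1, h2⟩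
    · exact absurd h1 (h v hv t)
  · rintro ⟨d, t, h1, h2⟩
    exact ⟨d, t, h1, by omega⟩

/-- The timestamp of `w` is read while `w` is the newest version, when the list is strictly longer
than `l`. -/
theorem dec_gt_of_newer (hpre : E.RespectsPreconditions) {τ o d t : ℕ}
    {pre l : List (Version V)} {w : Version V} (hv : E.vers E.len o = pre ++ l) (hw : w ∈ pre)
    (hl : E.vers τ o = l) (hd : E.dec E.len w.node = some (d, t)) : τ < d := by
  obtain ⟨a, b, rfl⟩ := List.append_of_mem hw
  obtain ⟨-, h1, -⟩ := (inv_of_le hpre le_rfl).mem.decided o a w (b ++ l) d t (by simp [hv]) hd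
  exact E.vers_lt (o := o) (by rw [h1, hl]; simp)

/-- The versions above `v` in the final list were added after `τ`, and hence their timestamps were
read after `τ`. -/
theorem ReadPoint.current_eq (hpre : E.RespectsPreconditions) {i b o : ℕ} {v : Version V}
    (h : E.ReadPoint i b o v) (hb : b ≤ E.len) :
    ∃ τ, i < τ ∧ τ < b ∧ E.current (τ + 1) o = some v := by
  obtain ⟨τ, d, t, post, h1, h2, h3, h4, h5⟩ := h
  obtain ⟨pre, h6⟩ := E.vers_suffix (k := τ + 1) (k' := E.len) (by omega) o
  refine ⟨τ, h1, h2, Execution.current_eq (by rw [← h6, h3]) (E.dec_mono hb h4) (by omega) ?_⟩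
  intro w hw d' t' hd'
  exact (dec_gt_of_newer hpre h6.symm hw rfl hd').le

variable (E)

/-- The operation `op`, invoked at time `i`, changes the abstract state at time `τ` and has the
response `r`. -/
inductive Mutates : ℕ → Op V → Resp V → ℕ → Prop
  | newCamera {i τ s} (hi : E.Invoked i .newCamera) (h : E.CreatesCam i τ s) :
      Mutates i .newCamera (.cam s) τ
  | newVCAS {i u o pre v s τ t} (h : E.vers E.len o = pre ++ [v])
      (hd : E.dec E.len v.node = some (τ, t)) (ho : v.op = i) (hu : v.val = u)
      (hi : E.Invoked i (.newVCAS u s)) (hs : E.HasCam E.len o s) :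
      Mutates i (.newVCAS u s) (.obj o) τ
  -- No response is required: a pending `vCAS` has taken effect once its node has a timestamp,
  -- possibly written by another process.
  | vCAS {i o a b pre v w post τ t} (h : E.vers E.len o = pre ++ v :: w :: post)
      (hd : E.dec E.len v.node = some (τ, t)) (ho : v.op = i) (ha : w.val = a) (hb : v.val = b)
      (hne : a ≠ b) (hi : E.Invoked i (.vCAS o a b)) :
      Mutates i (.vCAS o a b) (.bool true) τ

/-- The abstract state just after time `τ` justifies the response `r` of the operation `op`, which
does not change this state. -/
inductive Justifies (i τ : ℕ) : Op V → Resp V → Prop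
  | takeSnapshot {s t} (h : E.Bump τ s t) : Justifies i τ (.takeSnapshot s) (.handle t)
  | vRead {o v} (h : E.current (τ + 1) o = some v) : Justifies i τ (.vRead o) (.val v.val)
  | vCAS {o a b v r} (hu : E.Unpub E.len i) (h : E.current (τ + 1) o = some v)
      (hr : r = true ↔ v.val = a) (hb : r = true → b = a) :
      Justifies i τ (.vCAS o a b) (.bool r)
  -- `hv` speaks of increments of the camera because each `takeSnapshot` returning `ts` is
  -- linearized at one, and there is only one from `ts` to `ts + 1`.
  | readSnapshot {o ts v s a b} (h : E.current (τ + 1) o ≠ none) (hs : E.HasCam E.len o s)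
      (ha : E.Invoked a (.takeSnapshot s)) (hb : E.RespondsAt a b (.handle ts)) (hbτ : b < τ)
      (hv : ∀ τ' < E.len, E.Bump τ' s ts → ∃ y, E.current (τ' + 1) o = some y ∧ y.val = v) :
      Justifies i τ (.readSnapshot o ts) (.val v)

/-- The operation `op`, invoked at time `i`, returns `r`, and time `τ` is a possible linearization
point at which the abstract state does not change. -/
def Reads (i : ℕ) (op : Op V) (r : Resp V) (τ : ℕ) : Prop :=
  E.Invoked i op ∧ (∃ b, E.RespondsAt i b r ∧ i < τ ∧ τ < b) ∧ E.Justifies i τ op r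

/-- The linearization points. Operations that change the abstract state precede those that do not
at the same time. -/
def Point (i : ℕ) (op : Op V) (r : Resp V) (κ : ℕ) : Prop :=
  (∃ τ, E.Mutates i op r τ ∧ κ = 2 * τ) ∨
    -- Several times may qualify; one of them is fixed.
    ∃ h : ∃ τ, E.Reads i op r τ, κ = 2 * h.choose + 1

variable {E}

theorem Bump.unique {τ τ' s t : ℕ} (h : E.Bump τ s t) (h' : E.Bump τ' s t) (hτ : τ < E.len)
    (hτ' : τ' < E.len) : τ = τ' := by
  rcases lt_trichotomy τ τ' with hlt | rfl | hlt
  · have := E.cams_le (k := τ + 1) (k' := τ') hlt hτ'.le h.2 h'.1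
    omega
  · rfl
  · have := E.cams_le (k := τ' + 1) (k' := τ) hlt hτ.le h'.2 h.1
    omega

/-- Every completed operation has a linearization point. -/
theorem mutates_or_reads (hpre : E.RespectsPreconditions) {i b : ℕ} {op : Op V} {r : Resp V}
    (hi : E.Invoked i op) (hr : E.RespondsAt i b r) :
    ∃ τ, E.Mutates i op r τ ∨ E.Reads i op r τ := by
  have hI : ∀ j ≤ E.len, E.Inv j := fun j hj => inv_of_le hpre hj
  have hm := (hI _ le_rfl).mem
  have hb : b < E.len := by
    obtain ⟨_, ⟨_, _, hb, _⟩, _⟩ := hr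
    exact hb
  obtain ⟨p, hc, hL⟩ := locOK_of_respondsAt (fun j hj => hI j (by omega)) hi hr
  have hlab := (E.cur_spec hc).2.1
  cases hL with
  | @camRet s τ h1 h2 h3 => exact ⟨τ, .inl (.newCamera hi h3)⟩
  | @objRet v s o x hx ho hd =>
    obtain ⟨⟨d, t⟩, hd⟩ := Option.ne_none_iff_exists'.1 hd
    obtain ⟨pre, post, hx⟩ := List.append_of_mem (E.vers_mono hb.le hx)
    cases post with
    | nil =>
      obtain ⟨q, s', h1, h2⟩ := hm.first o pre x hx
      rw [ho, hlab] at h1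
      injection h1 with _ h1
      injection h1 with h1 h3
      subst h3
      exact ⟨d, .inl (.newVCAS hx (E.dec_mono hb.le hd) ho h1.symm hi h2)⟩
    | cons w post =>
      obtain ⟨-, ⟨q, h1⟩, -⟩ := hm.later o pre x w post hx
      rw [ho, hlab] at h1
      cases h1
  | @snapRet s t τ h1 h2 h3 => exact ⟨τ, .inr ⟨hi, ⟨b, hr, h1, h2⟩, .takeSnapshot h3⟩⟩
  | @readRet o x v h hv =>
    subst hv
    obtain ⟨τ, h1, h2, h3⟩ := h.current_eq hpre hb.le
    exact ⟨τ, .inr ⟨hi, ⟨b, hr, h1, h2⟩, .vRead h3⟩⟩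
  | casRet hu h hv hab =>
    obtain ⟨τ, h1, h2, h3⟩ := h.current_eq hpre hb.le
    exact ⟨τ, .inr ⟨hi, ⟨b, hr, h1, h2⟩, .vCAS (hu.of_respondsAt hr hb.le le_rfl) h3 hv hab⟩⟩
  | @casRetTrue o a c x hx ho hd =>
    obtain ⟨⟨d, t⟩, hd⟩ := Option.ne_none_iff_exists'.1 hd
    obtain ⟨pre, post, hx⟩ := List.append_of_mem (E.vers_mono hb.le hx)
    cases post with
    | nil =>
      obtain ⟨q, s', h1, h2⟩ := hm.first o pre x hx
      rw [ho, hlab] at h1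
      cases h1
    | cons w post =>
      obtain ⟨hne, ⟨q, h1⟩, -⟩ := hm.later o pre x w post hx
      rw [ho, hlab] at h1
      injection h1 with _ h1
      injection h1 with h1 h2 h3
      exact ⟨d, .inl (.vCAS hx (E.dec_mono hb.le hd) ho h2.symm h3.symm
        (by rw [h2, h3]; exact hne.symm) hi)⟩
  | @rsRet o ts x pre d t v h hv hd ht hcnt hcnt' =>
    subst hv
    obtain ⟨m, post, h1, h2, h3, h4, h5, -⟩ := h
    obtain ⟨s, a, b', τ, h6, h7, h8, h9, h10, h11, h12, -⟩ :=
      snapshot_spec hpre (fun j hj => hI j (by omega)) hi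
    obtain ⟨pre', hpre'⟩ := E.vers_suffix (k := m) (k' := E.len) (by omega) o
    have hv : E.vers E.len o = (pre' ++ pre) ++ v :: post := by rw [← hpre', h4]; simp
    have hs : E.HasCam E.len o s := h12.mono (by omega) le_rfl
    have hd := E.dec_mono hb.le hd
    -- versions that were assigned `t'` before the end of the snapshot have `t' ≤ ts`
    have hts : ∀ {pre w post d' t'}, E.vers E.len o = pre ++ w :: post →
        E.dec E.len w.node = some (d', t') →
        (d' ≤ τ → t' ≤ ts) ∧ (t' ≤ ts → d' ≤ τ) := by
      intro pre w post d' t' hw hd'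
      obtain ⟨hlt, -, hrd⟩ := hm.decided _ _ _ _ _ _ hw hd'
      obtain ⟨s', h13, h14⟩ := hrd.ts
      obtain rfl := (h13.mono hlt.le le_rfl).unique hs
      refine ⟨fun hle => E.cams_le hle (by omega) h14 h11.1, fun hle => ?_⟩
      by_contra hc
      have := E.cams_le (k := τ + 1) (k' := d') (by omega) hlt.le h11.2 h14
      omega
    have hdτ : d ≤ τ := (hts hv hd).2 ht
    have hcur : E.current (τ + 1) o = some v := by
      -- Versions added after the read of `VHead` at `m` got their timestamps after `m`, hence after
      -- the increment at `τ`. Skipped versions have timestamps above `ts`, which were also read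
      -- after `τ`.
      refine Execution.current_eq hv hd (by omega) fun w hw d' t' hd' => ?_
      rcases List.mem_append.1 hw with hw' | hw'
      · have := dec_gt_of_newer hpre hpre'.symm hw' rfl hd'
        omega
      · by_contra hc
        obtain ⟨a', c, hac⟩ := List.append_of_mem hw
        have := (hts (pre := a') (w := w) (post := c ++ v :: post) (by rw [hv, hac]; simp) hd').1
          (by omega)
        obtain ⟨d'', t'', h13, h14⟩ := h5 w hw'
        rw [E.dec_mono hb.le h13] at hd'
        cases hd'
        omega
    refine ⟨m, .inr ⟨hi, ⟨b, hr, h1, h2⟩, .readSnapshot (s := s) (a := a) (b := b') ?_ hs h6 h7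
      (by omega) fun τ' hτ' hbump => ⟨v, ?_, rfl⟩⟩⟩
    · exact current_ne_none (v := v) (by rw [hv]; simp) hd (by omega)
    · rw [hbump.unique h11 hτ' (by omega)]
      exact hcur

/-! ### Operations that change the abstract state -/

theorem ReadsTs.mem_eq {d o n t : ℕ} (h : E.ReadsTs d o n t) (hd : d < E.len) :
    (E.cfg (d + 1)).mem = (E.cfg d).mem := by
  obtain ⟨q, next, h1, h2⟩ := h.lab
  rcases E.mem_step hd with h' | ⟨p, l', h3, h4⟩
  · exact h'
  · rw [h1] at h3
    cases h3
    rw [h2] at h4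
    generalize (E.cfg (d + 1)).mem = M' at *
    cases h4
    rfl

theorem CreatesCam.cams_ne_none {i τ s : ℕ} (h : E.CreatesCam i τ s) (s' : ℕ) :
    (E.cfg (τ + 1)).mem.cams s' ≠ none ↔ s' = s ∨ (E.cfg τ).mem.cams s' ≠ none := by
  obtain ⟨p, ⟨-, -, hτ, -⟩, h1, h2, h3, h4⟩ := h
  rcases E.mem_step hτ with h' | ⟨q, l', h5, h6⟩
  · rw [h'] at h4
    exact absurd h3 h4
  · rw [h1] at h5
    cases h5
    rw [h2] at h6
    generalize (E.cfg (τ + 1)).mem = M' at *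
    cases h6 with
    | @camNew s0 h =>
      obtain rfl : s = s0 := by
        by_contra e
        simp only [Function.update_of_ne e] at h4
        exact h4 h3
      by_cases e : s' = s
      · subst e
        simp
      · simp [e]

/-- The instruction budget of `Camera()` is one, so the constructor cannot execute `camNew` twice.
-/
theorem CreatesCam.unique {i τ τ' s s' : ℕ} (hpre : E.RespectsPreconditions)
    (hi : E.Invoked i .newCamera) (h : E.CreatesCam i τ s) (h' : E.CreatesCam i τ' s') :
    τ = τ' ∧ s = s' := by
  have once : ∀ {τ τ' s s'}, E.CreatesCam i τ s → E.CreatesCam i τ' s' → ¬ τ < τ' := by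
    rintro τ τ' s s' ⟨p, h1, h2, -⟩ ⟨q, ⟨⟨op, h3⟩, h4, h5, h6⟩, h7, h8, -⟩ hlt
    have hc := cur_of_pending h5.le (fun j hj => inv_of_le hpre (by omega)) h3 h4 h6
    obtain ⟨-, q', hq'⟩ := hi
    rw [h3] at hq'
    cases hq'
    have hle := (cnt_add_potential_le h5.le hc trivial).2
    rw [h8, E.cnt_eq_ncard h5.le hc] at hle
    have hpos : 0 < {j | j < τ' ∧ E.Performs i j}.ncard :=
      (Set.ncard_pos ((Set.finite_lt_nat τ').subset fun j hj => hj.1)).2 ⟨τ, hlt, p, h1, h2⟩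
    simp only [Loc.potential, Op.start] at hle
    omega
  obtain rfl : τ = τ' := le_antisymm (not_lt.1 (once h' h)) (not_lt.1 (once h h'))
  refine ⟨rfl, ?_⟩
  obtain ⟨-, -, -, -, h3, h4⟩ := h'
  exact (((h.cams_ne_none s').1 h4).resolve_right (by simp [h3])).symm

theorem Mutates.invoked {i τ : ℕ} {op : Op V} {r : Resp V} (h : E.Mutates i op r τ) :
    E.Invoked i op := by
  cases h <;> assumption

theorem Mutates.cases {i τ : ℕ} {op : Op V} {r : Resp V} (h : E.Mutates i op r τ) :
    (∃ s, op = .newCamera ∧ r = .cam s ∧ E.CreatesCam i τ s) ∨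
      ∃ o pre v post t, E.vers E.len o = pre ++ v :: post ∧
        E.dec E.len v.node = some (τ, t) ∧ v.op = i := by
  cases h with
  | newCamera hi h => exact .inl ⟨_, rfl, rfl, h⟩
  | newVCAS h hd ho => exact .inr ⟨_, _, _, _, _, h, hd, ho⟩
  | vCAS h hd ho => exact .inr ⟨_, _, _, _, _, h, hd, ho⟩

theorem Mutates.unique (hpre : E.RespectsPreconditions) {i τ τ' : ℕ} {op : Op V} {r r' : Resp V}
    (h : E.Mutates i op r τ) (h' : E.Mutates i op r' τ') : r = r' ∧ τ = τ' := by
  have hm := (inv_of_le (E := E) hpre le_rfl).mem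
  cases h with
  | newCamera hi h =>
    cases h' with
    | newCamera hi' h' =>
      obtain ⟨rfl, rfl⟩ := h.unique hpre hi h'
      exact ⟨rfl, rfl⟩
  | newVCAS h hd ho =>
    cases h' with
    | newVCAS h' hd' ho' =>
      obtain ⟨rfl, rfl, -⟩ := hm.op_inj _ _ _ _ _ _ _ _ h h' (ho.trans ho'.symm)
      rw [hd] at hd'
      cases hd'
      exact ⟨rfl, rfl⟩
  | vCAS h hd ho =>
    cases h' with
    | vCAS h' hd' ho' =>
      obtain ⟨-, rfl, -⟩ := hm.op_inj _ _ _ _ _ _ _ _ h h' (ho.trans ho'.symm)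
      rw [hd] at hd'
      cases hd'
      exact ⟨rfl, rfl⟩

/-- At the time `τ` of the read, the version is already listed, so its operation was invoked before.
A completed operation that added a version has made sure, through its own `initTS`, that the
timestamp is present before it responds. -/
theorem Mutates.bounds (hpre : E.RespectsPreconditions) {i τ : ℕ} {op : Op V} {r : Resp V}
    (h : E.Mutates i op r τ) :
    i < τ ∧ τ < E.len ∧ ∀ b r', E.RespondsAt i b r' → τ < b := by
  have hm := (inv_of_le (E := E) hpre le_rfl).mem
  have version : ∀ {o pre v post t}, E.vers E.len o = pre ++ v :: post →
      E.dec E.len v.node = some (τ, t) → v.op = i →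
      (∀ b r', E.RespondsAt i b r' → ¬ E.Unpub b i → ∃ o', ∃ x ∈ E.vers b o', x.op = i ∧
        E.dec b x.node ≠ none) →
      i < τ ∧ τ < E.len ∧ ∀ b r', E.RespondsAt i b r' → τ < b := by
    rintro o pre v post t hv hd rfl hres
    obtain ⟨h1, h2, -⟩ := hm.decided _ _ _ _ _ _ hv hd
    refine ⟨(inv_of_le hpre h1.le).mem.op_lt o v (by rw [h2]; simp), h1, fun b r' hr => ?_⟩
    have hb : b ≤ E.len := by
      obtain ⟨_, ⟨_, _, hb, _⟩, _⟩ := hr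
      exact hb.le
    obtain ⟨o', x, hx, hxo, hxd⟩ := hres b r' hr fun hu =>
      hu.of_respondsAt hr hb le_rfl o v (by rw [hv]; simp) rfl
    obtain ⟨pre', post', hx'⟩ := List.append_of_mem hx
    obtain ⟨pre'', post'', hx''⟩ := List.append_of_mem (E.vers_mono hb hx)
    obtain ⟨rfl, rfl, -⟩ := hm.op_inj _ _ _ _ _ _ _ _ hv hx'' hxo.symm
    obtain ⟨⟨d', t'⟩, hd'⟩ := Option.ne_none_iff_exists'.1 hxd
    have := ((inv_of_le hpre hb).mem.decided _ _ _ _ _ _ hx' hd').1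
    rw [E.dec_mono hb hd'] at hd
    cases hd
    exact this
  have locOK : ∀ {b r'}, E.RespondsAt i b r' → ∃ p, E.LocOK b p i op (.ret r') := by
    intro b r' hr
    obtain ⟨p, -, hL⟩ := locOK_of_respondsAt (fun j hj => inv_of_le hpre (by
      obtain ⟨_, ⟨_, _, hb, _⟩, _⟩ := hr
      omega)) h.invoked hr
    exact ⟨p, hL⟩
  cases h with
  | newCamera hi h =>
    obtain ⟨p, h1, h2, -⟩ := h
    exact ⟨h1.2.1, h1.2.2.1, fun b r' hr => h1.lt_of_respondsAt h2 hr⟩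
  | newVCAS h hd ho =>
    refine version h hd ho fun b r' hr hu => ?_
    obtain ⟨p, hL⟩ := locOK hr
    cases hL with
    | objRet hx ho hd => exact ⟨_, _, hx, ho, hd⟩
  | vCAS h hd ho =>
    refine version h hd ho fun b r' hr hu => ?_
    obtain ⟨p, hL⟩ := locOK hr
    cases hL with
    | casRet hu' => exact absurd hu' hu
    | casRetTrue hx ho hd => exact ⟨_, _, hx, ho, hd⟩

/-- At most one operation changes the abstract state at any time. -/
theorem Mutates.eq_of_time (hpre : E.RespectsPreconditions) {i j τ : ℕ} {op op' : Op V}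
    {r r' : Resp V} (h : E.Mutates i op r τ) (h' : E.Mutates j op' r' τ) : i = j := by
  have hm := (inv_of_le (E := E) hpre le_rfl).mem
  have clash : ∀ {i s o pre v post t}, E.CreatesCam i τ s → E.vers E.len o = pre ++ v :: post →
      E.dec E.len v.node = some (τ, t) → False := by
    rintro i s o pre v post t ⟨p, -, h1, h2, -⟩ hv hd
    obtain ⟨q, next, h3, h4⟩ := (hm.decided _ _ _ _ _ _ hv hd).2.2.lab
    rw [h1] at h3
    cases h3
    rw [h2] at h4
    cases h4
  rcases h.cases with ⟨s, -, -, h1⟩ | ⟨o, pre, v, post, t, h1, h2, rfl⟩ <;>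
  rcases h'.cases with ⟨s', -, -, h1'⟩ | ⟨o', pre', v', post', t', h1', h2', rfl⟩
  · obtain ⟨p, h2, h3, -⟩ := h1
    obtain ⟨p', h2', h3', -⟩ := h1'
    rw [h3] at h3'
    cases h3'
    obtain ⟨⟨op1, h4⟩, h5, h6, h7⟩ := h2
    obtain ⟨⟨op2, h4'⟩, h5', h6', h7'⟩ := h2'
    have hI : ∀ j < τ, E.Inv j := fun j hj => inv_of_le hpre (by omega)
    have e := (cur_of_pending h6.le hI h4 h5 h7).symm.trans (cur_of_pending h6.le hI h4' h5' h7')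
    cases e
    rfl
  · exact (clash h1 h1' h2').elim
  · exact (clash h1' h1 h2).elim
  · obtain ⟨q, next, h3, h4⟩ := (hm.decided _ _ _ _ _ _ h1 h2).2.2.lab
    obtain ⟨q', next', h3', h4'⟩ := (hm.decided _ _ _ _ _ _ h1' h2').2.2.lab
    rw [h3] at h3'
    cases h3'
    rw [h4] at h4'
    injection h4' with _ h5
    rw [(hm.node_inj _ _ _ _ _ _ _ _ h1 h1' h5).2.1]

/-- The current version of an object changes only when an eventual timestamp is read, and the set of
cameras only through `camNew`. Either event is the point of some operation in `Mutates`. -/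
theorem abstractState_succ_of_not_mutates (hpre : E.RespectsPreconditions) {τ : ℕ}
    (hτ : τ < E.len) (h : ¬ ∃ i op r, E.Mutates i op r τ) :
    E.abstractState (τ + 1) = E.abstractState τ := by
  have hm := (inv_of_le (E := E) hpre le_rfl).mem
  have hInv := inv_of_le hpre hτ.le
  have hcur : ∀ o, E.current (τ + 1) o = E.current τ o := by
    intro o
    refine current_succ fun v hv t hd => h ?_
    have hlt := hm.op_lt o v hv
    obtain ⟨pre, post, hv⟩ := List.append_of_mem hv
    cases post with
    | nil =>
      obtain ⟨p, s, h1, h2⟩ := hm.first o pre v hv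
      exact ⟨_, _, _, .newVCAS hv hd rfl rfl ⟨hlt, p, h1⟩ h2⟩
    | cons w post =>
      obtain ⟨h1, ⟨p, h2⟩, -⟩ := hm.later o pre v w post hv
      exact ⟨_, _, _, .vCAS hv hd rfl rfl rfl h1.symm ⟨hlt, p, h2⟩⟩
  have hcams : ∀ s, (E.cfg (τ + 1)).mem.cams s ≠ none ↔ (E.cfg τ).mem.cams s ≠ none := by
    intro s
    constructor
    · intro h1 h2
      rcases E.mem_step hτ with h' | ⟨p, l', h3, h4⟩
      · rw [h'] at h1
        exact h1 h2
      · have hloc : (E.cfg τ).loc p = .camNew := by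
          have h1' := h1
          generalize (E.cfg (τ + 1)).mem = M' at *
          generalize (E.cfg τ).loc p = l at *
          cases h4 <;> try exact absurd h2 h1'
          · rfl
          · rename_i s' t' hs
            refine absurd ?_ h1'
            rw [← h2]
            exact Function.update_of_ne (by rintro rfl; simp [hs] at h2) _ _
        obtain ⟨i, op, hc⟩ := hInv.exists_cur (p := p) (by rw [hloc]; simp)
        have hL := hInv.loc p i op hc
        rw [hloc] at hL
        cases hL
        have hspec := E.cur_spec hc
        exact h ⟨i, _, _, .newCamera ⟨by omega, p, hspec.2.1⟩
          ⟨p, E.ongoing_of_cur hτ hc, h3, hloc, h2, h1⟩⟩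
    · intro h1
      obtain ⟨t, ht⟩ := Option.ne_none_iff_exists'.1 h1
      rcases E.cams_succ hτ ht with h2 | h2 <;> simp [h2]
  simp only [abstractState, hcur, hcams]

/-- A version is current until the timestamp of the next one is read. -/
theorem current_of_later (hpre : E.RespectsPreconditions) {o τ t : ℕ}
    {pre post : List (Version V)} {v w : Version V} (hv : E.vers E.len o = pre ++ v :: w :: post)
    (hd : E.dec E.len v.node = some (τ, t)) : E.current τ o = some w := by
  have hm := (inv_of_le (E := E) hpre le_rfl).mem
  have hv' : E.vers E.len o = (pre ++ [v]) ++ w :: post := by simp [hv]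
  obtain ⟨⟨d', t'⟩, hd'⟩ := Option.ne_none_iff_exists'.1 (hm.tail o _ w post hv' (by simp))
  refine current_eq hv' hd' (hm.dec_lt le_rfl hv hd (by simp) hd').1 fun x hx d t hdx => ?_
  rcases List.mem_append.1 hx with hx | hx
  · exact (dec_gt_of_newer hpre hv hx (hm.decided _ _ _ _ _ _ hv hd).2.1 hdx).le
  · rw [List.mem_singleton.1 hx, hd] at hdx
    cases hdx
    exact le_rfl

theorem SeqState.ext_iff' {st st' : SeqState V} (h : ∀ s, s ∈ st.cams ↔ s ∈ st'.cams)
    (h' : ∀ o, st.objs o = st'.objs o) : st = st' := by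
  cases st
  cases st'
  simp only [SeqState.mk.injEq]
  exact ⟨Set.ext h, funext h'⟩

/-- Reading the eventual timestamp of `v` makes `v` the current version of its object and affects
nothing else, since one event cannot be the point of two operations in `Mutates`. For a `vCAS`, the
version replaced is the next older one, whose value is `oldV`. -/
theorem Mutates.apply_abstractState (hpre : E.RespectsPreconditions) {i τ : ℕ} {op : Op V}
    {r : Resp V} (h : E.Mutates i op r τ) :
    (E.abstractState τ).apply (op, r) = E.abstractState (τ + 1) := by
  have hm := (inv_of_le (E := E) hpre le_rfl).mem
  have hτ := (h.bounds hpre).2.1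
  have hcur : ∀ o, (∀ v ∈ E.vers E.len o, v.op ≠ i) → E.current (τ + 1) o = E.current τ o := by
    intro o hne
    refine current_succ fun v hv t hd => ?_
    obtain ⟨pre, post, hv'⟩ := List.append_of_mem hv
    have hlt := hm.op_lt o v hv
    refine hne v hv ?_
    cases post with
    | nil =>
      obtain ⟨p, s, h1, h2⟩ := hm.first o pre v hv'
      exact Mutates.eq_of_time hpre (.newVCAS hv' hd rfl rfl ⟨hlt, p, h1⟩ h2) h
    | cons w post =>
      obtain ⟨h1, ⟨p, h2⟩, -⟩ := hm.later o pre v w post hv'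
      exact Mutates.eq_of_time hpre (.vCAS hv' hd rfl rfl rfl h1.symm ⟨hlt, p, h2⟩) h
  -- an operation that adds the version `v` of `o`
  have version : ∀ {o pre v post t}, E.vers E.len o = pre ++ v :: post →
      E.dec E.len v.node = some (τ, t) → v.op = i →
      (∀ s, (E.cfg (τ + 1)).mem.cams s ≠ none ↔ (E.cfg τ).mem.cams s ≠ none) ∧
      (∀ o' ≠ o, E.current (τ + 1) o' = E.current τ o') ∧ E.current (τ + 1) o = some v := by
    rintro o pre v post t hv hd rfl
    have hr := (hm.decided _ _ _ _ _ _ hv hd).2.2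
    refine ⟨fun s => by rw [hr.mem_eq hτ], fun o' ho' => hcur o' fun x hx hxo => ?_,
      current_eq hv hd (by omega) fun w hw d' t' hd' => ?_⟩
    · obtain ⟨a, c, hx⟩ := List.append_of_mem hx
      exact ho' (hm.op_inj _ _ _ _ _ _ _ _ hx hv hxo).1
    · exact dec_gt_of_newer hpre hv hw (hm.decided _ _ _ _ _ _ hv hd).2.1 hd'
  cases h with
  | newCamera hi h =>
    refine SeqState.ext_iff' (fun s => ?_) fun o => ?_
    · exact (h.cams_ne_none s).symm
    · refine congrArg (Option.map fun v => (E.camera o, v.val)) (hcur o fun v hv hvo => ?_).symm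
      obtain ⟨-, p, hp⟩ := hi
      obtain ⟨pre, post, hv'⟩ := List.append_of_mem hv
      cases post with
      | nil =>
        obtain ⟨p', s', h1, -⟩ := hm.first o pre v hv'
        rw [hvo, hp] at h1
        cases h1
      | cons w post =>
        obtain ⟨-, ⟨p', h1⟩, -⟩ := hm.later o pre v w post hv'
        rw [hvo, hp] at h1
        cases h1
  | @newVCAS u o pre v s _ t hv hd ho hu hi hs =>
    obtain ⟨h1, h2, h3⟩ := version hv hd ho
    refine SeqState.ext_iff' (fun s => (h1 s).symm) fun o' => ?_
    by_cases e : o' = o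
    · subst e
      simp [SeqState.apply, abstractState, h3, hs.camera_eq, hu]
    · simp [SeqState.apply, abstractState, h2 o' e, Function.update_of_ne e]
  | @vCAS o a b pre v w post _ t hv hd ho ha hb hne hi =>
    obtain ⟨h1, h2, h3⟩ := version hv hd ho
    have hw := current_of_later hpre hv hd
    have happ : (E.abstractState τ).apply (.vCAS o a b, .bool true) =
        { E.abstractState τ with
          objs := Function.update (E.abstractState τ).objs o (some (E.camera o, b)) } := by
      simp [SeqState.apply, abstractState, hw, ha]
    rw [happ]
    refine SeqState.ext_iff' (fun s => (h1 s).symm) fun o' => ?_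
    by_cases e : o' = o
    · subst e
      simp [abstractState, h3, hb]
    · simp [abstractState, h2 o' e, Function.update_of_ne e]

theorem Justifies.apply_abstractState {i τ : ℕ} {op : Op V} {r : Resp V}
    (h : E.Justifies i τ op r) :
    (E.abstractState (τ + 1)).apply (op, r) = E.abstractState (τ + 1) := by
  cases h with
  | takeSnapshot => rfl
  | vRead => rfl
  | readSnapshot => rfl
  | @vCAS o a b v r hu h hr hb =>
    by_cases e : v.val = a
    -- Old and new value agree here, so the update writes the value that is already present.
    · obtain rfl := hb (hr.2 e)
      have : (E.abstractState (τ + 1)).objs o = some (E.camera o, b) := by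
        simp [abstractState, h, e]
      simp only [SeqState.apply, this, if_true]
      refine SeqState.ext_iff' (fun s => Iff.rfl) fun o' => ?_
      by_cases e : o' = o
      · subst e
        simp [this]
      · simp [Function.update_of_ne e]
    · have : (E.abstractState (τ + 1)).objs o = some (E.camera o, v.val) := by
        simp [abstractState, h]
      simp only [SeqState.apply, this, e, if_false]

/-! ### Assembling the linearization -/

theorem Point.bounds (hpre : E.RespectsPreconditions) {i κ : ℕ} {op : Op V} {r : Resp V}
    (h : E.Point i op r κ) : E.Invoked i op ∧ ∃ τ, (κ = 2 * τ ∧ E.Mutates i op r τ ∨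
      κ = 2 * τ + 1 ∧ E.Reads i op r τ) ∧ i < τ ∧ τ < E.len ∧
      ∀ b r', E.RespondsAt i b r' → τ < b := by
  rcases h with ⟨τ, h, rfl⟩ | ⟨h, rfl⟩
  · exact ⟨h.invoked, τ, .inl ⟨rfl, h⟩, h.bounds hpre⟩
  · obtain ⟨h1, ⟨b, h2, h3, h4⟩, h5⟩ := h.choose_spec
    refine ⟨h1, _, .inr ⟨rfl, h.choose_spec⟩, h3, ?_, fun b' r' h' => ?_⟩
    · obtain ⟨_, ⟨_, _, hb, _⟩, _⟩ := h2
      omega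
    · rw [(h'.unique h2).1]
      exact h4

/-- No operation has points of both kinds. For a `vCAS`, this is decided by whether it ever adds a
version. -/
theorem Reads.not_mutates {i τ τ' : ℕ} {op : Op V} {r r' : Resp V} (h : E.Reads i op r τ)
    (h' : E.Mutates i op r' τ') : False := by
  obtain ⟨-, -, h⟩ := h
  cases h' with
  | newCamera => cases h
  | newVCAS => cases h
  | vCAS hv hd ho =>
    cases h with
    | vCAS hu => exact hu _ _ (by rw [hv]; simp) ho

theorem linearizable (hpre : E.RespectsPreconditions) : E.Linearizable SeqSpec := by
  have complete : ∀ {i b op r}, E.Invoked i op → E.RespondsAt i b r → ∃ κ, E.Point i op r κ := by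
    intro i b op r hi hr
    obtain ⟨τ, h | h⟩ := mutates_or_reads hpre hi hr
    · exact ⟨_, .inl ⟨τ, h, rfl⟩⟩
    · exact ⟨_, .inr ⟨⟨τ, h⟩, rfl⟩⟩
  have half : ∀ τ, (2 * τ + 1) / 2 = τ ∧ (2 * τ + 1 + 1) / 2 = τ + 1 ∧
      (2 * τ + 1 + 1 + 1) / 2 = τ + 1 := fun τ => by omega
  -- The even point `2 * τ` leads from the abstract state at `τ` to that at `τ + 1`; at the odd
  -- point `2 * τ + 1` the state is the one at `τ + 1` both before and after.
  refine E.linearizable_of_points E.Point (fun κ => E.abstractState ((κ + 1) / 2)) (2 * E.len)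
    ?_ ?_ ?_ complete ?_ ?_ ?_ ?_ ?_ ?_
  · exact fun h => (h.bounds hpre).1
  · intro i op r κ h
    obtain ⟨-, τ, h1, -, h2, -⟩ := h.bounds hpre
    rcases h1 with ⟨rfl, -⟩ | ⟨rfl, -⟩ <;> omega
  · rintro i op r r' κ κ' (⟨τ, h, rfl⟩ | ⟨h, rfl⟩) (⟨τ', h', rfl⟩ | ⟨h', rfl⟩)
    · obtain ⟨rfl, rfl⟩ := h.unique hpre h'
      exact ⟨rfl, rfl⟩
    · exact (h'.choose_spec.not_mutates h).elim
    · exact (h.choose_spec.not_mutates h').elim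
    · obtain ⟨-, ⟨b, h1, -⟩, -⟩ := h.choose_spec
      obtain ⟨-, ⟨b', h1', -⟩, -⟩ := h'.choose_spec
      obtain ⟨-, rfl⟩ := h1.unique h1'
      exact ⟨rfl, rfl⟩
  · intro i j op op' r r' κ κ' h h' hp
    obtain ⟨-, τ, h1, -, -, h2⟩ := h.bounds hpre
    obtain ⟨-, τ', h1', h2', -⟩ := h'.bounds hpre
    obtain ⟨b, r0, h3, h4⟩ := hp
    have := h2 b r0 h3
    rcases h1 with ⟨rfl, -⟩ | ⟨rfl, -⟩ <;> rcases h1' with ⟨rfl, -⟩ | ⟨rfl, -⟩ <;> omega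
  · refine SeqState.ext_iff' (fun s => ?_) fun o => ?_
    · simp [abstractState, SeqState.empty, E.start, Config.initial]
    · simp [abstractState, SeqState.empty,
        current_eq_none (E := E) (τ := 0) (o := o) fun _ _ _ _ _ => Nat.zero_le _]
  · intro i op r κ h
    obtain ⟨-, τ, ⟨rfl, h'⟩ | ⟨rfl, -, -, h'⟩, -⟩ := h.bounds hpre
    · simp only [half]
      exact h'.apply_abstractState hpre
    · simp only [half]
      exact h'.apply_abstractState
  · intro κ hκ h
    obtain ⟨τ, rfl | rfl⟩ : ∃ τ, κ = 2 * τ ∨ κ = 2 * τ + 1 := ⟨κ / 2, by omega⟩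
    · simp only [half]
      refine abstractState_succ_of_not_mutates hpre (by omega) ?_
      rintro ⟨i, op, r, h'⟩
      exact h ⟨i, op, r, .inl ⟨τ, h', rfl⟩⟩
    · simp only [half]
  · intro i j op op' r r' κ h h' hne
    obtain ⟨-, τ, h1, -⟩ := h.bounds hpre
    obtain ⟨-, τ', h1', -⟩ := h'.bounds hpre
    rcases h1 with ⟨rfl, h1⟩ | ⟨rfl, h1⟩
    · rcases h1' with ⟨h2, h1'⟩ | ⟨h2, -⟩
      · obtain rfl : τ = τ' := by omega
        exact absurd (h1.eq_of_time hpre h1') hne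
      · omega
    · simp only [half]
  · intro L hstate hmem hsorted m i op r hx
    have hm := (inv_of_le (E := E) hpre le_rfl).mem
    obtain ⟨κ, hκ, hst⟩ := hstate hx
    obtain ⟨-, τ, h, hiτ, hτ, hresp⟩ := Point.bounds hpre hκ
    rcases h with ⟨rfl, h⟩ | ⟨rfl, -, -, h⟩
    · simp only [half] at hst
      cases h with
      | newCamera hi h =>
        obtain ⟨p, -, -, -, h, -⟩ := h
        simp only [LegalAt, hst]
        simpa [abstractState] using h
      | @newVCAS u o pre v s _ t hv hd ho hu hi hs =>
        obtain ⟨h1, h2, h3⟩ := hm.decided _ _ _ _ _ _ hv hd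
        obtain ⟨s', h4, h5⟩ := h3.ts
        obtain rfl := (h4.mono h1.le le_rfl).unique hs
        -- The version of the constructor is the oldest, so no timestamp in the list was read before
        -- its own.
        have hnone : E.current τ o = none := by
          refine current_eq_none fun w hw d' t' hd' => ?_
          rw [hv] at hw
          rcases List.mem_append.1 hw with hw | hw
          · exact (dec_gt_of_newer hpre hv hw h2 hd').le
          · rw [List.mem_singleton.1 hw, hd] at hd'
            cases hd'
            exact le_rfl
        simp only [LegalAt, hst]
        simp [abstractState, h5, hnone]
      | @vCAS o a b pre v w post _ t hv hd ho ha hb hne hi =>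
        have hw := current_of_later hpre hv hd
        simp only [LegalAt, hst]
        exact ⟨E.camera o, w.val, by simp [abstractState, hw], by simp [ha]⟩
    · simp only [half] at hst
      cases h with
      | takeSnapshot h =>
        simp only [LegalAt, hst]
        simp [abstractState, h.2]
      | vRead h =>
        simp only [LegalAt, hst]
        simp [abstractState, h]
      | @vCAS o a b v r hu h hr hb =>
        simp only [LegalAt, hst]
        exact ⟨E.camera o, v.val, by simp [abstractState, h], hr⟩
      | @readSnapshot o ts v s a b h hs ha hb hbτ hv =>
        obtain ⟨y, hy⟩ := Option.ne_none_iff_exists'.1 h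
        -- every `takeSnapshot` that returned `ts` is linearized when the timestamp is incremented
        have snap : ∀ {m' : ℕ} {j : ℕ}, L[m']? = some (j, .takeSnapshot s, .handle ts) →
            ∃ τ', E.Point j (.takeSnapshot s) (.handle ts) (2 * τ' + 1) ∧
              SeqState.after (L.map Prod.snd) m' = E.abstractState (τ' + 1) ∧
              (∀ b r', E.RespondsAt j b r' → τ' < b) ∧
              ∃ y, E.current (τ' + 1) o = some y ∧ y.val = v := by
          intro m' j hj
          obtain ⟨κ', hκ', hst'⟩ := hstate hj
          obtain ⟨-, τ', h', -, hτ', hr'⟩ := Point.bounds hpre hκ'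
          rcases h' with ⟨-, h'⟩ | ⟨rfl, -, -, h'⟩
          · cases h'
          · simp only [half] at hst'
            cases h' with
            | takeSnapshot h' => exact ⟨τ', hκ', hst', hr', hv τ' hτ' h'⟩
        simp only [LegalAt, hst]
        refine ⟨s, y.val, by simp [abstractState, hy, hs.camera_eq], ?_, ?_⟩
        · obtain ⟨κ', hκ'⟩ := complete ha hb
          obtain ⟨m', hm'⟩ := hmem hκ'
          obtain ⟨τ', h1, h2, h3, z, h4, h5⟩ := snap hm'
          -- The `takeSnapshot` of the precondition is linearized before its response at `b`, and
          -- `b` precedes the read of `VHead`.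
          refine ⟨m', hsorted hm' hx h1 hκ (by have := h3 b _ hb; omega),
            by rw [List.getElem?_map, hm']; rfl, ?_⟩
          rw [h2]
          simp [abstractState, h4]
        · intro m' hm' s' z hz
          rw [List.getElem?_map, Option.map_eq_some_iff] at hm'
          obtain ⟨⟨j, op', r'⟩, hm', he⟩ := hm'
          simp only [Prod.mk.injEq] at he
          obtain ⟨rfl, rfl⟩ := he
          obtain ⟨τ', h1, h2, h3, w, h4, h5⟩ := snap hm'
          rw [h2] at hz
          simp only [abstractState, h4, Option.map_some, Option.some.injEq, Prod.mk.injEq] at hz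
          rw [← hz.2, h5]

end Execution

/-! ### The theorem -/

theorem theorem1 :
    ∃ C : ℕ, ∀ (P V : Type*) (E : Execution P V), E.RespectsPreconditions →
      -- linearizability
      E.Linearizable SeqSpec ∧
      -- a pending operation can always take its next step
      E.NeverStuck ∧
      -- constant time for `vRead`, `vCAS` and `takeSnapshot`
      (∀ i o, E.Invoked i (.vRead o) → E.instrCount i ≤ C) ∧
      (∀ i o oldV newV, E.Invoked i (.vCAS o oldV newV) → E.instrCount i ≤ C) ∧
      (∀ i s, E.Invoked i (.takeSnapshot s) → E.instrCount i ≤ C) ∧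
      -- the time of `readSnapshot`, where `m` is the time at which it reads `VHead`
      (∀ i o ts, E.Invoked i (.readSnapshot o ts) → 0 < E.instrCount i →
        ∃ m, E.ReadsHead i m o ts ∧
          E.instrCount i ≤ C * ((E.newerVCAS m o ts).ncard + 1) ∧
          ((∃ b r, E.RespondsAt i b r) → (E.newerVCAS m o ts).ncard + 1 ≤ E.instrCount i)) := by
  -- 13 is the initial potential of `vCAS`; those of `vRead` and `takeSnapshot` are 5 and 2. It also
  -- covers `readSnapshot`, as `2 * (k + 1) + 6 ≤ 13 * (k + 1)`.
  refine ⟨13, fun P V E hpre => ⟨E.linearizable hpre, E.neverStuck hpre, ?_, ?_, ?_, ?_⟩⟩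
  · exact fun i o hi => (E.instrCount_le hpre hi trivial).trans (by simp [Op.start, Loc.potential])
  · exact fun i o a b hi =>
      (E.instrCount_le hpre hi trivial).trans (by simp [Op.start, Loc.potential])
  · exact fun i s hi => (E.instrCount_le hpre hi trivial).trans (by simp [Op.start, Loc.potential])
  · exact fun i o ts hi hpos => E.readSnapshot_instrCount hpre hi hpos
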